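/- **Setting.** Let $a<b$, $T>0$, and let $u$ be the classical ($C^1$ on $[a,b]\times[0,T]$) solution of $\partial_t u+\partial_x u=0$ on $[a,b]\times(0,T]$, $u(x,0)=u_0(x)$, with either the periodic condition $u(a,t)=u(b,t)$ or the inflow condition $u(a,t)=g(t)$, for $t\in[0,T]$. Let $k\ge 1$ be an integer. *Mesh.* Let $a=x_{1/2}<x_{3/2}<\dots<x_{N+1/2}=b$, $\tau_i=(x_{i-1/2},x_{i+1/2})$, $h_i=x_{i+1/2}-x_{i-1/2}$, $h=\max_i h_i$, with $h\le c\,h_i$ for all $i$. In each $\tau_i$ take points $x_{i-1/2}=x_{i,0}<x_{i,1}<\dots<x_{i,k}<x_{i,k+1}=x_{i+1/2}$ and $\tau_{i,j}=(x_{i,j},x_{i,j+1})$, where, with $L_{i,m}$ the Legendre polynomial of degree $m$ on $\tau_i$, the $x_{i,1},\dots,x_{i,k}$ are the zeros of $L_{i,k}$ (OF-LSV), or the zeros of $L_{i,k+1}-L_{i,k}$ other than $x_{i+1/2}$ (OF-RRSV). Let $\mathcal U_h$ be the space of functions that are polynomials of degree at most $k$ on each $\tau_i$. *Scheme.* For $p\in\mathcal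 U_h$ let $P_h^l p$ be the cellwise $L^2$ projection onto polynomials of degree at most $l$, $P_h^{-1}=P_h^0$, and $$\sigma_i^l(p)=\frac{2(2l+1)}{2k-1}\,\frac{h^l}{l!}\Big(\frac1{N_e}\big([\![\partial_x^l p]\!]_{i-1/2}^2+[\![\partial_x^l p]\!]_{i+1/2}^2\big)\Big)^{1/2},\qquad 0\le l\le k,$$ where $N_e\ge1$ is a fixed integer and $[\![\cdot]\!]$ is the jump at a mesh point (cyclic for periodic conditions; for inflow conditions the exterior value of $p$ at $a$ is $g(t)$, and all other boundary jumps are zero). A function $u_h(\cdot,t)\in\mathcal U_h$, with coefficients differentiable in $t\in[0,T]$, is a solution of the scheme if for all $t\in(0,T]$, $1\le i\le N$, $0\le j\le k$, $$\int_{\tau_{i,j}}\partial_t u_h\,dx+u_h^-(x_{i,j+1})-u_h^-(x_{i,j})+\sum_{l=0}^k\frac{\sigma_i^l(u_h)}{h_i}\int_{\tau_{i,j}}(u_h-P_h^{l-1}u_h)\,dx=0,$$ where $^-$ denotes the left limit, and $u_h^-(x_{1/2})$ is $u_h^-(x_{N+1/2})$ for periodic and $g(t)$ for inflow conditions. *Corrected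 initial value.* Let $v_I\in\mathcal U_h$ be the Lagrange interpolant of $v$ at $x_{i,j}$, $1\le j\le k+1$. Let $A_{i,j}$ be the weights of the interpolatory quadrature on $\tau_i$ with nodes $x_{i,1},\dots,x_{i,k}$ (OF-LSV) or $x_{i,1},\dots,x_{i,k+1}$ (OF-RRSV). For a polynomial $v$ on $\tau_i$ let $v^*$ be the function equal to $v^*_{i,j}$ on $\tau_{i,j}$, where $v^*_{i,0}=v(x_{i-1/2})$ and $v^*_{i,j}-v^*_{i,j-1}=A_{i,j}v_x(x_{i,j})$ for $1\le j\le k$. Put $\eta=u_I-u$ or $\eta=u-u_I$ (either convention). The initial value is corrected if $u_h(\cdot,0)=(u_0)_I-\omega$, where $\omega\in\mathcal U_h$ satisfies, at $t=0$ and for every $i$, $\omega(x_{i+1/2}^-)=0$ and $$(\omega,v_x)_{\tau_i}=(\partial_t\eta,v^*)_{\tau_i}+\sum_{l=0}^k\frac{\sigma_i^l(u_h)}{h_i}(u_I-P_h^{l-1}u_I,v^*)_{\tau_i}$$ for all polynomials $v$ of degree at most $k$ with $\int_{\tau_i}v\,dx=0$. **Theorem.** Assume $u(\cdot,t)\in H^{k+3}(a,b)$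 for all $t\in[0,T]$, and $k\ge2$ in the case of OF-LSV ($k\ge1$ in the case of OF-RRSV). Then there are constants $C,h_0>0$, which may depend on $u$ and on $a,b,T,k,c,N_e$ but not on the mesh or on $u_h$, such that for every mesh as above with $h\le h_0$, for every solution $u_h$ of OF-LSV, respectively OF-RRSV, with corrected initial value, and for all $t\in[0,T]$, $$e_n:=\Big(\frac1N\sum_{i=1}^N (u-u_h)^2(x_{i+1/2}^-,t)\Big)^{1/2}\le C h^{k+2},$$ $$e_c:=\Big(\frac1N\sum_{i=1}^N\Big(\frac1{h_i}\int_{\tau_i}(u-u_h)(x,t)\,dx\Big)^2\Big)^{1/2}\le C h^{k+2}.$$ -/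

import Mathlib

open MeasureTheory Set Polynomial

noncomputable section

namespace OFSV

/-! ### Sobolev functions and the exact solution -/

/-- `f ∈ H^m(a,b)`: `f` has weak derivatives `g 0 = f, g 1, …, g m`, all of them in `L²(a,b)`. -/
def MemSobolev (m : ℕ) (a b : ℝ) (f : ℝ → ℝ) : Prop :=
  ∃ g : ℕ → ℝ → ℝ, g 0 = f ∧ ∀ j ≤ m,
    MemLp (g j) 2 (volume.restrict (Ioo a b)) ∧
    ∀ φ : ℝ → ℝ, ContDiff ℝ ((⊤ : ℕ∞) : WithTop ℕ∞) φ → HasCompactSupport φ → tsupport φ ⊆ Ioo a b →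
      ∫ x in Ioo a b, f x * iteratedDeriv j φ x = (-1) ^ j * ∫ x in Ioo a b, g j x * φ x

/-- The boundary condition: periodic, or inflow with the prescribed value `g t` at the left end. -/
inductive Boundary where
  | periodic : Boundary
  | inflow (g : ℝ → ℝ) : Boundary

/-- `u` satisfies the boundary condition on `[a,b] × [0,T]`. -/
def Boundary.Holds (bc : Boundary) (a b T : ℝ) (u : ℝ → ℝ → ℝ) : Prop :=
  match bc with
  | .periodic => ∀ t ∈ Icc 0 T, u a t = u b t
  | .inflow g => ∀ t ∈ Icc 0 T, u a t = g t

/-- `u = u(x,t)` is a classical solution of `∂ₜu + ∂ₓu = 0` on `[a,b] × (0,T]` with initial value `u₀` and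
boundary condition `bc`. -/
structure IsExactSolution (a b T : ℝ) (bc : Boundary) (u₀ : ℝ → ℝ) (u : ℝ → ℝ → ℝ) : Prop where
  contDiffOn : ContDiffOn ℝ 1 (fun p : ℝ × ℝ => u p.1 p.2) (Icc a b ×ˢ Icc 0 T)
  pde : ∀ x ∈ Icc a b, ∀ t ∈ Ioc 0 T,
    derivWithin (fun s => u x s) (Icc 0 T) t + derivWithin (fun y => u y t) (Icc a b) x = 0
  init : ∀ x ∈ Icc a b, u x 0 = u₀ x
  boundary : bc.Holds a b T u

/-! ### Meshes and control volumes -/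

/-- A partition `a = x_{1/2} < x_{3/2} < ⋯ < x_{N+1/2} = b` into `N` spectral volumes. The cell with index
`i : Fin N` (counted from `0`) is `(node i.castSucc, node i.succ)`. -/
structure Mesh (a b : ℝ) where
  N : ℕ
  node : Fin (N + 1) → ℝ
  strictMono : StrictMono node
  node_first : node 0 = a
  node_last : node (Fin.last N) = b

namespace Mesh

variable {a b : ℝ} (M : Mesh a b)

/-- Left end point `x_{i-1/2}` of a cell. -/
def left (i : Fin M.N) : ℝ := M.node i.castSucc

/-- Right end point `x_{i+1/2}` of a cell. -/
def right (i : Fin M.N) : ℝ := M.node i.succ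

/-- Cell length `h_i`. -/
def len (i : Fin M.N) : ℝ := M.right i - M.left i

/-- Mesh size `h = max_i h_i`. -/
def size : ℝ := ⨆ i : Fin M.N, M.len i

/-- Shape regularity with constant `c`: `h ≤ c h_i` for every cell. -/
def ShapeRegular (c : ℝ) : Prop := ∀ i, M.size ≤ c * M.len i

/-- The cyclic predecessor of a cell. -/
def prev (i : Fin M.N) : Fin M.N := (finRotate M.N).symm i

/-- The cyclic successor of a cell. -/
def next (i : Fin M.N) : Fin M.N := finRotate M.N i

end Mesh

/-- The two families of control volumes: Gauss points (`LSV`) or interior right Radau points (`RRSV`). -/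
inductive Scheme where
  | LSV : Scheme
  | RRSV : Scheme

/-- The Legendre polynomial of degree `n` transplanted from `[-1,1]` to `[0,1]`, normalized to be `1` at `1`
(Mathlib's `shiftedLegendre n` is `1` at `0`). The Legendre polynomial of a cell is
`L_{i,n}(x) = legendre01 n ((x - x_{i-1/2}) / h_i)`. -/
def legendre01 (n : ℕ) (y : ℝ) : ℝ := (-1) ^ n * aeval y (shiftedLegendre n)

/-- `0 = ρ_0 < ρ_1 < ⋯ < ρ_k < ρ_{k+1} = 1` are the reference positions of the end points of the control
volumes: `ρ_1, …, ρ_k` are the zeros of the Legendre polynomial of degree `k` (Gauss points), respectively the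
zeros of `L_{k+1} - L_k` other than the right end point (interior right Radau points). -/
structure IsReferencePoints (s : Scheme) (k : ℕ) (ρ : Fin (k + 2) → ℝ) : Prop where
  strictMono : StrictMono ρ
  first : ρ 0 = 0
  last : ρ (Fin.last (k + 1)) = 1
  zeros : ∀ j : Fin (k + 2), j ≠ 0 → j ≠ Fin.last (k + 1) →
    match s with
    | .LSV => legendre01 k (ρ j) = 0
    | .RRSV => legendre01 (k + 1) (ρ j) - legendre01 k (ρ j) = 0

/-! ### `L²` projection of polynomials -/

theorem exists_l2Proj {α β : ℝ} (hαβ : α < β) (n : ℕ) (p : ℝ[X]) :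
    ∃ q : ℝ[X], q.natDegree ≤ n ∧
      ∀ r : ℝ[X], r.natDegree ≤ n → ∫ x in α..β, (p - q).eval x * r.eval x = 0 := by
  have hint : ∀ f : ℝ[X], IntervalIntegrable (fun x => f.eval x) volume α β :=
    fun f => f.continuous.intervalIntegrable _ _
  let B : ℝ[X] →ₗ[ℝ] ℝ[X] →ₗ[ℝ] ℝ :=
    LinearMap.mk₂ ℝ (fun f g => ∫ x in α..β, (f * g).eval x)
      (fun f f' g => by
        simp only [add_mul, eval_add]
        exact intervalIntegral.integral_add (hint _) (hint _))
      (fun c f g => by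
        simp only [smul_mul_assoc, eval_smul]
        exact intervalIntegral.integral_smul _ _)
      (fun f g g' => by
        simp only [mul_add, eval_add]
        exact intervalIntegral.integral_add (hint _) (hint _))
      (fun c f g => by
        simp only [mul_smul_comm, eval_smul]
        exact intervalIntegral.integral_smul _ _)
  let W := degreeLT ℝ (n + 1)
  have hW : ∀ f : ℝ[X], f ∈ W ↔ f.natDegree ≤ n := fun f => by
    rw [mem_degreeLT, natDegree_le_iff_degree_le]
    by_cases hf : f = 0
    · simp [hf]
    · rw [degree_eq_natDegree hf]
      norm_cast
      omega
  have : FiniteDimensional ℝ W := (degreeLTEquiv ℝ (n + 1)).symm.finiteDimensional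
  let Φ : W →ₗ[ℝ] Module.Dual ℝ W := B.domRestrict₁₂ W W
  have hinj : Function.Injective Φ := by
    rw [← LinearMap.ker_eq_bot, LinearMap.ker_eq_bot']
    intro f hf
    have h0 : ∫ x in α..β, (f.1 * f.1).eval x = 0 := LinearMap.congr_fun hf f
    have h1 := (intervalIntegral.integral_eq_zero_iff_of_le_of_nonneg_ae hαβ.le
      (Filter.Eventually.of_forall fun x => by simpa using mul_self_nonneg (f.1.eval x)) (hint _)).1 h0
    have h2 : EqOn (fun x => (f.1 * f.1).eval x) 0 (Ioo α β) :=
      Measure.eqOn_open_of_ae_eq (ae_restrict_of_ae_restrict_of_subset Ioo_subset_Ioc_self h1) isOpen_Ioo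
        (f.1 * f.1).continuous.continuousOn continuousOn_const
    apply Subtype.ext
    refine eq_zero_of_infinite_isRoot _ ((Ioo_infinite hαβ).mono fun x hx => ?_)
    have h3 := h2 hx
    simpa using h3
  have hsurj : Function.Surjective Φ :=
    (LinearMap.injective_iff_surjective_of_finrank_eq_finrank Subspace.dual_finrank_eq.symm).1 hinj
  obtain ⟨q, hq⟩ := hsurj ((B p).comp W.subtype)
  refine ⟨q.1, (hW _).1 q.2, fun r hr => ?_⟩
  have h4 : ∫ x in α..β, (q.1 * r).eval x = ∫ x in α..β, (p * r).eval x :=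
    LinearMap.congr_fun hq ⟨r, (hW r).2 hr⟩
  have h5 : ∀ x, (p - q.1).eval x * r.eval x = (p * r).eval x - (q.1 * r).eval x := fun x => by
    simp only [eval_sub, eval_mul]
    ring
  simp only [h5]
  rw [intervalIntegral.integral_sub (hint _) (hint _), h4, sub_self]

open Classical in
/-- The `L²(α,β)` projection of a polynomial `p` onto the polynomials of degree at most `n`. -/
def l2Proj (α β : ℝ) (n : ℕ) (p : ℝ[X]) : ℝ[X] :=
  if h : ∃ q : ℝ[X], q.natDegree ≤ n ∧
      ∀ r : ℝ[X], r.natDegree ≤ n → ∫ x in α..β, (p - q).eval x * r.eval x = 0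
  then h.choose else 0

theorem l2Proj_spec {α β : ℝ} (hαβ : α < β) (n : ℕ) (p : ℝ[X]) :
    (l2Proj α β n p).natDegree ≤ n ∧
      ∀ r : ℝ[X], r.natDegree ≤ n → ∫ x in α..β, (p - l2Proj α β n p).eval x * r.eval x = 0 := by
  have h := exists_l2Proj hαβ n p
  rw [l2Proj, dif_pos h]
  exact h.choose_spec

/-! ### The oscillation-free spectral volume scheme

A function of the space `𝒰_h` is a family `p : Fin N → ℝ[X]` of polynomials of degree at most `k`, one for each
cell (written in the global variable `x`). A function of the test space `𝒱_h` is a family `w i j` of values on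
the control volumes `(x_{i,j}, x_{i,j+1})`, `0 ≤ j ≤ k`. -/

variable {a b : ℝ} {k : ℕ} (M : Mesh a b) (ρ : Fin (k + 2) → ℝ)

/-- The point `x_{i,j}`, `0 ≤ j ≤ k + 1`; `x_{i,0}` and `x_{i,k+1}` are the end points of the cell. -/
def pt (i : Fin M.N) (j : Fin (k + 2)) : ℝ := M.left i + M.len i * ρ j

/-- The integral of `f` over the control volume `(x_{i,j}, x_{i,j+1})`. -/
def cvIntegral (i : Fin M.N) (j : Fin (k + 1)) (f : ℝ → ℝ) : ℝ :=
  ∫ x in (pt M ρ i j.castSucc)..(pt M ρ i j.succ), f x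

/-- `(f, w)_i`, the `L²` product over a cell of `f` with a test function `w` that is constant on each control
volume of the cell. -/
def cellPairing (i : Fin M.N) (f : ℝ → ℝ) (w : Fin (k + 1) → ℝ) : ℝ :=
  ∑ j, w j * cvIntegral M ρ i j f

/-- The left limit `p^-` at `x_{i,j}`. At the left end of a cell it is taken from the preceding cell; at the
left end of the domain it is the value at the right end (periodic) or the inflow value. -/
def leftLimit (bc : Boundary) (t : ℝ) (p : Fin M.N → ℝ[X]) (i : Fin M.N) (j : Fin (k + 2)) : ℝ :=
  if j = 0 then
    match bc with
    | .periodic => (p (M.prev i)).eval (M.right (M.prev i))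
    | .inflow g => if i.val = 0 then g t else (p (M.prev i)).eval (M.right (M.prev i))
  else (p i).eval (pt M ρ i j)

/-- The jump of `∂ₓˡ p` at the left end point of a cell. For inflow conditions, at the left end of the domain the
exterior value of `p` is the inflow value, and derivatives have no exterior value and contribute no jump. -/
def jumpLeft (bc : Boundary) (t : ℝ) (p : Fin M.N → ℝ[X]) (i : Fin M.N) (l : ℕ) : ℝ :=
  let interior := (derivative^[l] (p i)).eval (M.left i) -
    (derivative^[l] (p (M.prev i))).eval (M.right (M.prev i))
  match bc with
  | .periodic => interior
  | .inflow g =>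
    if i.val = 0 then (if l = 0 then (p i).eval (M.left i) - g t else 0) else interior

/-- The jump of `∂ₓˡ p` at the right end point of a cell. For inflow conditions there is no exterior value, hence
no jump, at the right end of the domain. -/
def jumpRight (bc : Boundary) (p : Fin M.N → ℝ[X]) (i : Fin M.N) (l : ℕ) : ℝ :=
  let interior := (derivative^[l] (p (M.next i))).eval (M.left (M.next i)) -
    (derivative^[l] (p i)).eval (M.right i)
  match bc with
  | .periodic => interior
  | .inflow _ => if i.val + 1 = M.N then 0 else interior

/-- The damping coefficient `σ_i^l` of `p`; `Ne` is the normalizing number `N_e` of the averaged squared jumps. -/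
def damping (k Ne : ℕ) (bc : Boundary) (t : ℝ) (p : Fin M.N → ℝ[X]) (i : Fin M.N) (l : ℕ) : ℝ :=
  2 * (2 * (l : ℝ) + 1) / (2 * (k : ℝ) - 1) * (M.size ^ l / (l.factorial : ℝ)) *
    √(1 / (Ne : ℝ) * (jumpLeft M bc t p i l ^ 2 + jumpRight M bc p i l ^ 2))

/-- `∑_l (σ^l / h_i) (q - P_h^{l-1} q, w)_i` over `0 ≤ l ≤ k`, with `P_h^{-1} = P_h^0` (the subtraction `l - 1` is
that of natural numbers, so it is `0` for `l = 0`). -/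
def dampingForm (σ : ℕ → ℝ) (i : Fin M.N) (q : ℝ[X]) (w : Fin (k + 1) → ℝ) : ℝ :=
  ∑ l ∈ Finset.range (k + 1), σ l / M.len i *
    cellPairing M ρ i (fun x => (q - l2Proj (M.left i) (M.right i) (l - 1) q).eval x) w

/-- The form `a_h(v, w)` at time `t`, where `v s : Fin N → ℝ[X]` is the discrete function at time `s ∈ [0,T]`. -/
def ah (Ne : ℕ) (T : ℝ) (bc : Boundary) (v : ℝ → Fin M.N → ℝ[X]) (t : ℝ)
    (w : Fin M.N → Fin (k + 1) → ℝ) : ℝ :=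
  ∑ i, (cellPairing M ρ i (fun x => derivWithin (fun s => (v s i).eval x) (Icc 0 T) t) (w i) +
    ∑ j : Fin (k + 1),
      w i j * (leftLimit M ρ bc t (v t) i j.succ - leftLimit M ρ bc t (v t) i j.castSucc) +
    dampingForm M ρ (damping M k Ne bc t (v t) i) i (v t i) (w i))

/-- `uh` is a solution of the semi-discrete scheme on `[0,T]`. -/
structure IsOFSVSolution (Ne : ℕ) (T : ℝ) (bc : Boundary) (uh : ℝ → Fin M.N → ℝ[X]) : Prop where
  natDegree_le : ∀ t ∈ Icc 0 T, ∀ i, (uh t i).natDegree ≤ k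
  differentiable : ∀ i n, DifferentiableOn ℝ (fun t => (uh t i).coeff n) (Icc 0 T)
  scheme : ∀ t ∈ Ioc 0 T, ∀ w : Fin M.N → Fin (k + 1) → ℝ, ah M ρ Ne T bc uh t w = 0

/-! ### Interpolation, the map to the test space, and the corrected initial value -/

/-- The Lagrange interpolation `v_I` on a cell, at the points `x_{i,j}`, `1 ≤ j ≤ k + 1`. -/
def interp (v : ℝ → ℝ) (i : Fin M.N) : ℝ[X] :=
  Lagrange.interpolate Finset.univ (fun j : Fin (k + 1) => pt M ρ i j.succ)
    (fun j : Fin (k + 1) => v (pt M ρ i j.succ))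

/-- Indices of the quadrature points: the `k` Gauss points, or the `k + 1` right Radau points. -/
def quadIndices (s : Scheme) (k : ℕ) : Finset (Fin (k + 2)) :=
  match s with
  | .LSV => Finset.univ.filter fun j => j ≠ 0 ∧ j ≠ Fin.last (k + 1)
  | .RRSV => Finset.univ.filter fun j => j ≠ 0

/-- The quadrature weights `A_{i,j}`, integrals of the Lagrange basis polynomials over the cell. -/
def quadWeight (s : Scheme) (i : Fin M.N) (j : Fin (k + 2)) : ℝ :=
  ∫ x in (M.left i)..(M.right i), (Lagrange.basis (quadIndices s k) (pt M ρ i) j).eval x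

/-- The values `v*_{i,j}` of `v* = ℱ v` on the control volumes of a cell: `v*_{i,0} = v(x_{i-1/2}^+)` and
`v*_{i,j} - v*_{i,j-1} = A_{i,j} v_x(x_{i,j})` for `1 ≤ j ≤ k`. -/
def star (s : Scheme) (i : Fin M.N) (v : ℝ[X]) (j : Fin (k + 1)) : ℝ :=
  v.eval (M.left i) + ∑ m ∈ Finset.univ.filter (fun m : Fin (k + 2) => m ≠ 0 ∧ m.val ≤ j.val),
    quadWeight M ρ s i m * (derivative v).eval (pt M ρ i m)

/-- `ω` is the correction function at time `t` for `u` and the damping coefficients `σ i l`: it is a polynomial of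
degree at most `k` on each cell, vanishes at `x_{i+1/2}^-`, and
`(ω, v_x)_i = (∂ₜη, v*)_i + ∑_l (σ_i^l / h_i) (u_I - P_h^{l-1} u_I, v*)_i` for all polynomials `v` of degree at
most `k` with mean value zero on the cell. Here `η = ε (u_I - u)`, where `ε = ±1` is a sign convention. -/
structure IsCorrection (s : Scheme) (ε T : ℝ) (u : ℝ → ℝ → ℝ) (σ : Fin M.N → ℕ → ℝ) (t : ℝ)
    (ω : Fin M.N → ℝ[X]) : Prop where
  natDegree_le : ∀ i, (ω i).natDegree ≤ k
  right : ∀ i, (ω i).eval (M.right i) = 0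
  eq : ∀ i, ∀ v : ℝ[X], v.natDegree ≤ k → ∫ x in (M.left i)..(M.right i), v.eval x = 0 →
    ∫ x in (M.left i)..(M.right i), (ω i).eval x * (derivative v).eval x =
      cellPairing M ρ i
        (fun x => derivWithin
          (fun r => ε * ((interp M ρ (fun y => u y r) i).eval x - u x r)) (Icc 0 T) t)
        (star M ρ s i v) +
      dampingForm M ρ (σ i) i (interp M ρ (fun y => u y t) i) (star M ρ s i v)

/-- `p` is the corrected initial value: `p = (u₀)_I - ω`, where `ω` is the correction function at time `0` with
the damping coefficients of `p` itself. -/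
def IsCorrectedInitial (s : Scheme) (ε : ℝ) (Ne : ℕ) (T : ℝ) (bc : Boundary) (u₀ : ℝ → ℝ)
    (u : ℝ → ℝ → ℝ) (p : Fin M.N → ℝ[X]) : Prop :=
  ∃ ω : Fin M.N → ℝ[X],
    IsCorrection M ρ s ε T u (fun i l => damping M k Ne bc 0 p i l) 0 ω ∧
    ∀ i, p i = interp M ρ u₀ i - ω i

/-! ### Errors -/

/-- Root mean square error at the downwind points `x_{i+1/2}^-`. -/
def nodalError (u : ℝ → ℝ → ℝ) (uh : ℝ → Fin M.N → ℝ[X]) (t : ℝ) : ℝ :=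
  √(1 / (M.N : ℝ) * ∑ i, (u (M.right i) t - (uh t i).eval (M.right i)) ^ 2)

/-- Root mean square error of the cell averages. -/
def cellAverageError (u : ℝ → ℝ → ℝ) (uh : ℝ → Fin M.N → ℝ[X]) (t : ℝ) : ℝ :=
  √(1 / (M.N : ℝ) *
    ∑ i, (1 / M.len i * ∫ x in (M.left i)..(M.right i), (u x t - (uh t i).eval x)) ^ 2)

end OFSV

end

/-! Along characteristics the solution is a travelling wave u(x,t) = V(x - t). The Sobolev
hypothesis at all times makes V of class C^(k+2), and V^(k+2) has the modulus of continuity of a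
primitive of a square integrable function (`IsExactSolution.exists_profile`).

The discrete solution is compared not with the interpolant u_I but with u_I - ω, where ω is a small
polynomial correction that vanishes at the downwind points. The scheme is tested with ξ* for ξ = u_h
- u_I + ω. On the reference cell, Gauss or right Radau quadrature turns the pairing of p with v*
into ∫ p v + κ p_k v_k with κ ≥ 0, and the upwind fluxes into those of the discontinuous Galerkin
method (`exists_refPairing_eq`). Hence the energy of ξ is equivalent to its L² norm, the fluxes only
dissipate, and it remains to estimate the residual of u_I - ω (`exists_cell_residual_bound`).

Two terms of that residual are one order too large. The time derivative of the interpolation error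
starts with a multiple of h^(k+1) V^(k+2) `refError`. In the damping, the coefficients of u_I are
O(h^(k+1)), and for l ≤ 1 the part of u_I left by the projection starts with h V' `centered`, whose
factor h is cancelled by the division by h_i. Both reference polynomials have mean zero, so there
are fixed polynomials Z and W, zero at the right end point, whose integrals against v' reproduce the
pairings of these polynomials with v (`exists_correction`). A combination of Z and W serves as ω and
cancels both terms. For Gauss points, the mean of `refError` is zero because k ≥ 2
(`integ_refError`).

The damping is nonlinear, but its coefficients are Lipschitz in u_h. They may be replaced by those
of u_I at a cost controlled by ξ on the cell and its two neighbours, and the damping of ξ tested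
with ξ is nonnegative. Because ω has to be differentiable in time, the square roots in it are
regularized at the level h^(k+2) (`waveDamping`). The oscillation of V^(k+2) over a single cell need
not be O(h), but its squares, weighted with the cell lengths, sum to O(h²)
(`WaveProfile.sum_waveOsc_sq`); this gives the last power of h.

Gronwall's inequality (`exists_energy_growth`) bounds ξ(t) by ξ(0) and h^(k+2). The prescribed
initial correction is itself O(h^(k+2)) on fine meshes (`exists_initial_defect_bound`), hence so is
ξ(0). At a downwind point the error is exactly ξ up to sign. In a cell average the leading
interpolation error has mean zero, and what is left is O(h^(k+2)). -/

noncomputable section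

namespace OFSV

/-! ### One-dimensional Sobolev functions -/

/-- Smooth functions with compact support in `(a,b)`. -/
structure IsTest (a b : ℝ) (φ : ℝ → ℝ) : Prop where
  contDiff : ContDiff ℝ ((⊤ : ℕ∞) : WithTop ℕ∞) φ
  compact : HasCompactSupport φ
  subset : tsupport φ ⊆ Ioo a b

namespace IsTest

variable {a b : ℝ} {φ θ : ℝ → ℝ}

theorem deriv (h : IsTest a b φ) : IsTest a b (deriv φ) where
  contDiff := ((contDiff_infty_iff_deriv (f := φ)).1 h.contDiff).2
  compact := h.compact.deriv
  subset := tsupport_deriv_subset.trans h.subset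

theorem iteratedDeriv (h : IsTest a b φ) (m : ℕ) : IsTest a b (iteratedDeriv m φ) := by
  induction m with
  | zero => simpa using h
  | succ m ih => rw [iteratedDeriv_succ]; exact ih.deriv

theorem eq_zero_of_notMem (h : IsTest a b φ) {x : ℝ} (hx : x ∉ Ioo a b) : φ x = 0 :=
  image_eq_zero_of_notMem_tsupport fun hx' => hx (h.subset hx')

theorem continuous (h : IsTest a b φ) : Continuous φ := h.contDiff.continuous

theorem sub (h : IsTest a b φ) (h' : IsTest a b θ) : IsTest a b (fun x => φ x - θ x) where
  contDiff := h.contDiff.sub h'.contDiff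
  compact := h.compact.sub h'.compact
  subset := (tsupport_sub φ θ).trans (union_subset h.subset h'.subset)

theorem const_mul (h : IsTest a b φ) (c : ℝ) : IsTest a b (fun x => c * φ x) where
  contDiff := contDiff_const.mul h.contDiff
  compact := h.compact.mul_left (f := fun _ => c)
  subset := (closure_mono fun _ hx => right_ne_zero_of_mul hx).trans h.subset

/-- A test function with zero mean is the derivative of a test function. -/
theorem exists_primitive (hab : a < b) (h : IsTest a b φ) (h0 : ∫ x in a..b, φ x = 0) :
    ∃ θ, IsTest a b θ ∧ _root_.deriv θ = φ := by
  have hd : ∀ x, HasDerivAt (fun x => ∫ y in a..x, φ y) (φ x) x := fun x =>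
    intervalIntegral.integral_hasDerivAt_right (h.continuous.intervalIntegrable _ _)
      (h.continuous.stronglyMeasurableAtFilter _ _) h.continuous.continuousAt
  have hder : _root_.deriv (fun x => ∫ y in a..x, φ y) = φ := funext fun x => (hd x).deriv
  obtain ⟨α, β, hα, hβ, hs⟩ : ∃ α β, a < α ∧ β < b ∧ tsupport φ ⊆ Icc α β := by
    rcases (tsupport φ).eq_empty_or_nonempty with he | hne
    -- For an empty support the reversed end points make `Icc α β` empty, and both strict
    -- inequalities read `a < b`.
    · exact ⟨b, a, hab, hab, by simp [he]⟩
    · have hc : IsCompact (tsupport φ) := h.compact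
      refine ⟨sInf (tsupport φ), sSup (tsupport φ), (h.subset (hc.sInf_mem hne)).1,
        (h.subset (hc.sSup_mem hne)).2, fun x hx => ⟨csInf_le hc.bddBelow hx, le_csSup hc.bddAbove hx⟩⟩
  have hz : ∀ x, x ∉ Icc α β → φ x = 0 := fun x hx =>
    image_eq_zero_of_notMem_tsupport fun hx' => hx (hs hx')
  -- To the left of the support of `φ` the primitive is zero by its choice of base point, to the
  -- right of it because the total integral is zero.
  have hsupp : Function.support (fun x => ∫ y in a..x, φ y) ⊆ Icc α β := by
    intro x hx
    by_contra hx'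
    apply hx
    rcases lt_or_ge x α with h1 | h1
    · refine intervalIntegral.integral_zero_ae (Filter.Eventually.of_forall fun y hy => hz y fun hy' => ?_)
      rcases Set.mem_uIoc.1 hy with h2 | h2 <;> linarith [h2.1, h2.2, hy'.1]
    · have h2 : β < x := by
        by_contra h3
        exact hx' ⟨h1, not_lt.1 h3⟩
      have h4 : ∫ y in b..x, φ y = 0 := by
        refine intervalIntegral.integral_zero_ae (Filter.Eventually.of_forall fun y hy => hz y fun hy' => ?_)
        rcases Set.mem_uIoc.1 hy with h2 | h2 <;> linarith [h2.1, h2.2, hy'.2]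
      change ∫ y in a..x, φ y = 0
      rw [← intervalIntegral.integral_add_adjacent_intervals (h.continuous.intervalIntegrable a b)
        (h.continuous.intervalIntegrable b x), h0, h4, add_zero]
  have hts : tsupport (fun x => ∫ y in a..x, φ y) ⊆ Icc α β := closure_minimal hsupp isClosed_Icc
  refine ⟨fun x => ∫ y in a..x, φ y, ⟨?_, ?_, ?_⟩, hder⟩
  · rw [contDiff_infty_iff_deriv, hder]
    exact ⟨fun x => (hd x).differentiableAt, h.contDiff⟩
  · exact HasCompactSupport.of_support_subset_isCompact isCompact_Icc hsupp
  · exact hts.trans fun x hx => ⟨hα.trans_le hx.1, hx.2.trans_lt hβ⟩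

theorem exists_integral_eq_one (hab : a < b) : ∃ θ, IsTest a b θ ∧ ∫ x in a..b, θ x = 1 := by
  let f : ContDiffBump ((a + b) / 2) := ⟨(b - a) / 8, (b - a) / 4, by linarith, by linarith⟩
  have hs : tsupport (f.normed volume) ⊆ Ioo a b := by
    rw [f.tsupport_normed_eq, Real.closedBall_eq_Icc]
    intro x hx
    have h1 := hx.1
    have h2 := hx.2
    simp only [f] at h1 h2
    constructor <;> linarith
  refine ⟨f.normed volume, ⟨f.contDiff_normed, f.hasCompactSupport_normed, hs⟩, ?_⟩
  rw [intervalIntegral.integral_eq_integral_of_support_subset, f.integral_normed]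
  exact (subset_tsupport _).trans (hs.trans Ioo_subset_Ioc_self)

end IsTest

theorem integral_polynomial_mul_iteratedDeriv {a b : ℝ} {θ : ℝ → ℝ} (m : ℕ) (hθ : IsTest a b θ) (p : ℝ[X]) :
    ∫ x in a..b, p.eval x * iteratedDeriv m θ x = (-1) ^ m * ∫ x in a..b, (derivative^[m] p).eval x * θ x := by
  induction m generalizing p with
  | zero => simp
  | succ m ih =>
    have h1 : ∫ x in a..b, p.eval x * iteratedDeriv (m + 1) θ x =
        -∫ x in a..b, (derivative p).eval x * iteratedDeriv m θ x := by
      rw [intervalIntegral.integral_mul_deriv_eq_deriv_mul (u := fun x => p.eval x)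
        (v := iteratedDeriv m θ) (fun x _ => p.hasDerivAt x) (fun x _ => ?_)
        ((derivative p).continuous.intervalIntegrable _ _)
        ((hθ.iteratedDeriv (m + 1)).continuous.intervalIntegrable _ _),
        (hθ.iteratedDeriv m).eq_zero_of_notMem (x := a) (by simp),
        (hθ.iteratedDeriv m).eq_zero_of_notMem (x := b) (by simp)]
      · simp
      · rw [iteratedDeriv_succ]
        exact ((hθ.iteratedDeriv m).contDiff.differentiable (by simp) x).hasDerivAt
    rw [h1, ih, Function.iterate_succ_apply, pow_succ]
    ring

/-- The lemma of du Bois-Reymond for higher derivatives. -/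
theorem exists_polynomial_of_integral_iteratedDeriv_eq_zero {a b : ℝ} (hab : a < b) (m : ℕ) {ψ : ℝ → ℝ}
    (hψ : ContinuousOn ψ (Icc a b))
    (h : ∀ φ, IsTest a b φ → ∫ x in a..b, ψ x * iteratedDeriv m φ x = 0) :
    ∃ p : ℝ[X], p.degree < m ∧ EqOn ψ (fun x => p.eval x) (Ioo a b) := by
  induction m generalizing ψ with
  | zero =>
    refine ⟨0, by simp, ?_⟩
    have h1 : ∀ᵐ x, x ∈ Ioo a b → ψ x = 0 := by
      refine isOpen_Ioo.ae_eq_zero_of_integral_contDiff_smul_eq_zero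
        ((hψ.mono Ioo_subset_Icc_self).locallyIntegrableOn measurableSet_Ioo) fun g hg hgc hgs => ?_
      have h2 := h g ⟨hg, hgc, hgs⟩
      rw [intervalIntegral.integral_eq_integral_of_support_subset] at h2
      · simpa [mul_comm] using h2
      · intro x hx
        exact Ioo_subset_Ioc_self (hgs (subset_tsupport _ (by simpa using right_ne_zero_of_mul hx)))
    have h2 : ψ =ᵐ[volume.restrict (Ioo a b)] fun _ => (0 : ℝ) := by
      rw [Filter.EventuallyEq, ae_restrict_iff' measurableSet_Ioo]
      exact h1
    simpa using Measure.eqOn_open_of_ae_eq h2 isOpen_Ioo (hψ.mono Ioo_subset_Icc_self) continuousOn_const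
  | succ m ih =>
    obtain ⟨β, hβ, hβ1⟩ := IsTest.exists_integral_eq_one hab
    have hint : ∀ {f θ : ℝ → ℝ}, ContinuousOn f (Icc a b) → IsTest a b θ →
        IntervalIntegrable (fun x => f x * θ x) volume a b := fun hf hθ =>
      (hf.mul hθ.continuous.continuousOn).intervalIntegrable_of_Icc hab.le
    set c : ℝ := ∫ x in a..b, ψ x * iteratedDeriv m β x with hc
    -- The m-th derivative of `r` is the constant `(-1)^m c`. Subtracting `r` from `ψ` extends the
    -- orthogonality from derivatives of test functions to all test functions, with one derivative
    -- less.
    set r : ℝ[X] := C (c * (-1) ^ m / m.factorial) * X ^ m with hr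
    have hrd : derivative^[m] r = C (c * (-1) ^ m) := by
      rw [hr, iterate_derivative_C_mul, iterate_derivative_X_pow_eq_smul, Nat.descFactorial_self]
      rw [Nat.sub_self, pow_zero, smul_eq_C_mul, mul_one, ← C_mul]
      congr 1
      field_simp
    have hmain : ∀ θ, IsTest a b θ → ∫ x in a..b, (ψ x - r.eval x) * iteratedDeriv m θ x = 0 := by
      intro θ hθ
      have h1 : ∫ x in a..b, ψ x * iteratedDeriv m θ x = (∫ x in a..b, θ x) * c := by
        set I := ∫ x in a..b, θ x with hI
        -- Removing a multiple of the fixed bump `β` gives mean zero, hence the derivative of a test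
        -- function, to which the hypothesis of order m + 1 applies.
        have hζ : IsTest a b (fun x => θ x - I * β x) := hθ.sub (hβ.const_mul I)
        have hζ0 : ∫ x in a..b, (θ x - I * β x) = 0 := by
          rw [intervalIntegral.integral_sub (hθ.continuous.intervalIntegrable _ _)
            ((hβ.const_mul I).continuous.intervalIntegrable _ _), intervalIntegral.integral_const_mul, hβ1]
          simp [hI]
        obtain ⟨φ, hφ, hφd⟩ := hζ.exists_primitive hab hζ0
        have h2 := h φ hφ
        rw [iteratedDeriv_succ', hφd] at h2
        have h3 : ∀ x, iteratedDeriv m (fun x => θ x - I * β x) x =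
            iteratedDeriv m θ x - I * iteratedDeriv m β x := fun x => by
          have h4 : ContDiffAt ℝ m θ x := (hθ.contDiff.of_le (by exact_mod_cast le_top)).contDiffAt
          have h5 : ContDiffAt ℝ m β x := (hβ.contDiff.of_le (by exact_mod_cast le_top)).contDiffAt
          have h6 := iteratedDeriv_fun_sub (n := m) h4 (contDiffAt_const.mul h5 : ContDiffAt ℝ m (fun y => I * β y) x)
          rw [h6, iteratedDeriv_const_mul_field]
        simp only [h3, mul_sub] at h2
        rw [intervalIntegral.integral_sub (hint hψ (hθ.iteratedDeriv m))] at h2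
        · have h5 : ∫ x in a..b, ψ x * (I * iteratedDeriv m β x) = I * c := by
            rw [hc, ← intervalIntegral.integral_const_mul]
            congr 1 with x
            ring
          rw [h5] at h2
          linarith
        · exact hint hψ ((hβ.iteratedDeriv m).const_mul I)
      have h2 := integral_polynomial_mul_iteratedDeriv m hθ r
      simp only [hrd, eval_C] at h2
      rw [intervalIntegral.integral_const_mul] at h2
      simp only [sub_mul]
      rw [intervalIntegral.integral_sub (hint hψ (hθ.iteratedDeriv m))
        (hint r.continuous.continuousOn (hθ.iteratedDeriv m)), h1, h2]
      have h3 : ((-1 : ℝ) ^ m) * (-1) ^ m = 1 := by rw [← mul_pow]; simp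
      linear_combination -((∫ x in a..b, θ x) * c) * h3
    obtain ⟨p, hp, hpe⟩ := ih (hψ.sub r.continuous.continuousOn) hmain
    refine ⟨p + r, ?_, fun x hx => ?_⟩
    · refine (degree_add_le _ _).trans_lt (max_lt (hp.trans (by exact_mod_cast Nat.lt_succ_self m)) ?_)
      exact (degree_C_mul_X_pow_le _ _).trans_lt (by exact_mod_cast Nat.lt_succ_self m)
    · have := hpe hx
      simp only [eval_add, Pi.sub_apply] at this ⊢
      linarith

end OFSV

/-! ### Sobolev functions as iterated primitives; the modulus of continuity of the highest
derivative. -/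

namespace OFSV

/-- Integration by parts against a test function for the primitive of an integrable function. -/
theorem integral_primitive_mul_deriv {a b : ℝ} {f θ : ℝ → ℝ} (hf : IntervalIntegrable f volume a b)
    (hθ : IsTest a b θ) :
    ∫ x in a..b, (∫ y in a..x, f y) * deriv θ x = -∫ x in a..b, f x * θ x := by
  have h1 := (hf.absolutelyContinuousOnInterval_intervalIntegral (c := a) (by simp)).integral_mul_deriv_eq_deriv_mul
    ((hθ.contDiff.of_le (by exact_mod_cast le_top) : ContDiff ℝ 1 θ).contDiffOn.absolutelyContinuousOnInterval (a := a) (b := b))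
  rw [h1, hθ.eq_zero_of_notMem (x := a) (by simp), hθ.eq_zero_of_notMem (x := b) (by simp)]
  simp only [mul_zero, sub_zero, zero_sub]
  congr 1
  refine intervalIntegral.integral_congr_ae ?_
  filter_upwards [hf.ae_hasDerivAt_integral] with x hx hx'
  rw [(hx (Set.uIoc_subset_uIcc hx') a (by simp)).deriv]

/-- Iterated primitives, vanishing at `a`. -/
def iterPrimitive (a : ℝ) (g : ℝ → ℝ) : ℕ → ℝ → ℝ
  | 0 => g
  | m + 1 => fun x => ∫ y in a..x, iterPrimitive a g m y

theorem continuous_iterPrimitive_succ (a : ℝ) {g : ℝ → ℝ} (hg : Integrable g) (m : ℕ) :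
    Continuous (iterPrimitive a g (m + 1)) := by
  induction m with
  | zero => exact intervalIntegral.continuous_primitive (fun _ _ => hg.intervalIntegrable) a
  | succ m ih => exact intervalIntegral.continuous_primitive (fun _ _ => ih.intervalIntegrable _ _) a

theorem intervalIntegrable_iterPrimitive (a : ℝ) {g : ℝ → ℝ} (hg : Integrable g) (m : ℕ) (c d : ℝ) :
    IntervalIntegrable (iterPrimitive a g m) volume c d := by
  cases m with
  | zero => exact hg.intervalIntegrable
  | succ m => exact (continuous_iterPrimitive_succ a hg m).intervalIntegrable _ _

theorem hasDerivAt_iterPrimitive (a : ℝ) {g : ℝ → ℝ} (hg : Integrable g) (m : ℕ) (x : ℝ) :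
    HasDerivAt (iterPrimitive a g (m + 2)) (iterPrimitive a g (m + 1) x) x := by
  have hc := continuous_iterPrimitive_succ a hg m
  exact intervalIntegral.integral_hasDerivAt_right (hc.intervalIntegrable _ _)
    (hc.stronglyMeasurableAtFilter _ _) hc.continuousAt

theorem contDiff_iterPrimitive (a : ℝ) {g : ℝ → ℝ} (hg : Integrable g) (m : ℕ) :
    ContDiff ℝ m (iterPrimitive a g (m + 1)) := by
  induction m with
  | zero => exact_mod_cast contDiff_zero.2 (continuous_iterPrimitive_succ a hg 0)
  | succ m ih =>
    have hd : deriv (iterPrimitive a g (m + 2)) = iterPrimitive a g (m + 1) :=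
      funext fun x => (hasDerivAt_iterPrimitive a hg m x).deriv
    rw [show ((m + 1 : ℕ) : WithTop ℕ∞) = m + 1 by push_cast; rfl, contDiff_succ_iff_deriv, hd]
    refine ⟨fun x => (hasDerivAt_iterPrimitive a hg m x).differentiableAt, fun h => ?_, ih⟩
    exact absurd h (WithTop.natCast_ne_top (n := m) (α := ℕ∞))

theorem iteratedDeriv_iterPrimitive (a : ℝ) {g : ℝ → ℝ} (hg : Integrable g) (m : ℕ) :
    iteratedDeriv m (iterPrimitive a g (m + 1)) = iterPrimitive a g 1 := by
  induction m with
  | zero => simp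
  | succ m ih =>
    have hd : deriv (iterPrimitive a g (m + 2)) = iterPrimitive a g (m + 1) :=
      funext fun x => (hasDerivAt_iterPrimitive a hg m x).deriv
    rw [iteratedDeriv_succ', hd, ih]

theorem integral_iterPrimitive_mul_iteratedDeriv {a b : ℝ} {g φ : ℝ → ℝ} (hg : Integrable g)
    (m : ℕ) (hφ : IsTest a b φ) :
    ∫ x in a..b, iterPrimitive a g m x * iteratedDeriv m φ x = (-1) ^ m * ∫ x in a..b, g x * φ x := by
  induction m with
  | zero => simp [iterPrimitive]
  | succ m ih =>
    have h := integral_primitive_mul_deriv (intervalIntegrable_iterPrimitive a hg m a b) (hφ.iteratedDeriv m)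
    rw [iteratedDeriv_succ]
    change ∫ x in a..b, (∫ y in a..x, iterPrimitive a g m y) * _ = _
    rw [h, ih, pow_succ]
    ring

/-- Cauchy–Schwarz, read off from the nonnegativity of the variance of `g` about its mean `c`. -/
theorem sq_integral_le_mul_integral_sq {g : ℝ → ℝ} (hg : Integrable g) (hg2 : Integrable fun x => g x ^ 2)
    {z y : ℝ} (hzy : z ≤ y) : (∫ x in z..y, g x) ^ 2 ≤ (y - z) * ∫ x in z..y, g x ^ 2 := by
  rcases hzy.eq_or_lt with rfl | hlt
  · simp
  have hpos : 0 < y - z := sub_pos.2 hlt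
  set I := ∫ x in z..y, g x with hI
  set c := I / (y - z) with hc
  have h0 : 0 ≤ ∫ x in z..y, (g x - c) ^ 2 :=
    intervalIntegral.integral_nonneg hzy fun x _ => sq_nonneg _
  have h1 : ∫ x in z..y, (g x - c) ^ 2 = (∫ x in z..y, g x ^ 2) - 2 * c * I + c ^ 2 * (y - z) := by
    have h2 : ∀ x, (g x - c) ^ 2 = g x ^ 2 - 2 * c * g x + c ^ 2 := fun x => by ring
    simp only [h2]
    rw [intervalIntegral.integral_add, intervalIntegral.integral_sub, intervalIntegral.integral_const_mul,
      intervalIntegral.integral_const, smul_eq_mul]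
    · ring
    · exact hg2.intervalIntegrable
    · exact (hg.const_mul _).intervalIntegrable
    · exact (hg2.sub (hg.const_mul _)).intervalIntegrable
    · exact intervalIntegrable_const
  have h3 : c * (y - z) = I := by rw [hc]; field_simp
  rw [h1] at h0
  have h4 : (∫ x in z..y, g x ^ 2) - 2 * c * I + c ^ 2 * (y - z) = (∫ x in z..y, g x ^ 2) - c * I := by
    linear_combination c * h3
  rw [h4] at h0
  have h5 : I ^ 2 = (y - z) * (c * I) := by linear_combination -I * h3
  rw [h5]
  exact mul_le_mul_of_nonneg_left (by linarith) hpos.le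

/-- `U` agrees on `[α,β]` with a function of class `C^m` on the line whose `m`-th derivative has a Hölder
modulus as that of the primitive of an `L²` function. -/
def IsRegular (m : ℕ) (α β : ℝ) (U : ℝ → ℝ) : Prop :=
  ∃ V F : ℝ → ℝ, ContDiff ℝ m V ∧ Monotone F ∧ EqOn V U (Icc α β) ∧
    ∀ z y, z ≤ y → (iteratedDeriv m V y - iteratedDeriv m V z) ^ 2 ≤ (y - z) * (F y - F z)

theorem iterate_deriv_eval (p : ℝ[X]) (m : ℕ) :
    deriv^[m] (fun x => p.eval x) = fun x => (derivative^[m] p).eval x := by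
  induction m generalizing p with
  | zero => rfl
  | succ m ih =>
    rw [Function.iterate_succ_apply, Function.iterate_succ_apply, ← ih]
    congr 1
    exact funext fun x => p.deriv

/-- The difference of `f` and the (m + 1)-fold primitive of its weak derivative of order m + 1 has
vanishing weak derivative of that order, so by du Bois-Reymond it is a polynomial of degree at most
m. Continuity up to the end points removes the ambiguity of the representative. -/
theorem MemSobolev.isRegular {a b : ℝ} (hab : a < b) {m : ℕ} {f : ℝ → ℝ} (hf : MemSobolev (m + 1) a b f)
    (hc : ContinuousOn f (Icc a b)) : IsRegular m a b f := by
  obtain ⟨w, -, hw⟩ := hf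
  obtain ⟨hL2, hweak⟩ := hw (m + 1) le_rfl
  set g : ℝ → ℝ := (Ioo a b).indicator (w (m + 1)) with hg
  have hgi : Integrable g := (integrable_indicator_iff measurableSet_Ioo).2 (hL2.integrable (by norm_num))
  have hg2 : Integrable fun x => g x ^ 2 := by
    have h1 : (fun x => g x ^ 2) = (Ioo a b).indicator fun x => w (m + 1) x ^ 2 := by
      ext x
      by_cases hx : x ∈ Ioo a b <;> simp [hg, hx]
    rw [h1, integrable_indicator_iff measurableSet_Ioo]
    exact hL2.integrable_sq
  have hIoo : ∀ F : ℝ → ℝ, ∫ x in a..b, F x = ∫ x in Ioo a b, F x := fun F => by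
    rw [intervalIntegral.integral_of_le hab.le, integral_Ioc_eq_integral_Ioo]
  set P := iterPrimitive a g (m + 1) with hP
  have hPc : Continuous P := continuous_iterPrimitive_succ a hgi m
  obtain ⟨p, hp, hpe⟩ := exists_polynomial_of_integral_iteratedDeriv_eq_zero hab (m + 1)
    (ψ := fun x => f x - P x) (hc.sub hPc.continuousOn) (fun φ hφ => by
      have h1 := integral_iterPrimitive_mul_iteratedDeriv hgi (m + 1) hφ
      have h2 := hweak φ hφ.contDiff hφ.compact hφ.subset
      have hφc := (hφ.iteratedDeriv (m + 1)).continuous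
      simp only [sub_mul]
      rw [intervalIntegral.integral_sub, h1, hIoo, h2, hIoo, sub_eq_zero]
      · congr 1
        refine setIntegral_congr_fun measurableSet_Ioo fun x hx => ?_
        simp [hg, hx]
      · exact (hc.mul hφc.continuousOn).intervalIntegrable_of_Icc hab.le
      · exact (hPc.mul hφc).intervalIntegrable _ _)
  have hpC : ContDiff ℝ m fun x => p.eval x := by simpa using p.contDiff_aeval (𝕜 := ℝ) (n := m)
  refine ⟨fun x => P x + p.eval x, fun y => ∫ x in a..y, g x ^ 2,
    (contDiff_iterPrimitive a hgi m).add hpC, fun z y hzy => ?_, ?_, fun z y hzy => ?_⟩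
  · have h1 : 0 ≤ ∫ x in z..y, g x ^ 2 := intervalIntegral.integral_nonneg hzy fun x _ => sq_nonneg _
    have h2 := intervalIntegral.integral_interval_sub_left (a := a) (b := y) (c := z)
      hg2.intervalIntegrable hg2.intervalIntegrable
    change ∫ x in a..z, g x ^ 2 ≤ ∫ x in a..y, g x ^ 2
    linarith
  · have h1 : EqOn (fun x => P x + p.eval x) f (Ioo a b) := fun x hx => by
      have := hpe hx
      simp only at this ⊢
      linarith
    exact h1.of_subset_closure (hPc.add p.continuous).continuousOn hc Ioo_subset_Icc_self
      (by rw [closure_Ioo hab.ne])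
  · have h1 : ∀ x, iteratedDeriv m (fun x => P x + p.eval x) x =
        (∫ y in a..x, g y) + (derivative^[m] p).eval x := fun x => by
      rw [iteratedDeriv_fun_add (contDiff_iterPrimitive a hgi m).contDiffAt hpC.contDiffAt,
        iteratedDeriv_iterPrimitive a hgi, iteratedDeriv_eq_iterate, iterate_deriv_eval]
      rfl
    -- The polynomial contributes only a constant to the m-th derivative, so increments of that
    -- derivative are integrals of `g`.
    have h2 : (derivative^[m] p).natDegree = 0 := by
      have h3 := natDegree_iterate_derivative p m
      have h4 : p.natDegree ≤ m := natDegree_le_of_degree_le (Order.le_of_lt_succ (by exact_mod_cast hp))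
      omega
    obtain ⟨r, hr⟩ := natDegree_eq_zero.1 h2
    have h3 : ∀ z y : ℝ, (∫ x in a..y, g x) - ∫ x in a..z, g x = ∫ x in z..y, g x := fun z y =>
      intervalIntegral.integral_interval_sub_left hgi.intervalIntegrable hgi.intervalIntegrable
    have h4 := intervalIntegral.integral_interval_sub_left (a := a) (b := y) (c := z)
      hg2.intervalIntegrable hg2.intervalIntegrable
    rw [h1, h1, ← hr]
    simp only [eval_C, add_sub_add_right_eq_sub]
    rw [h3, h4]
    exact sq_integral_le_mul_integral_sq hgi hg2 hzy

theorem IsRegular.mono {m : ℕ} {α β : ℝ} {U W : ℝ → ℝ} (h : IsRegular m α β U) (hUW : EqOn U W (Icc α β)) :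
    IsRegular m α β W := by
  obtain ⟨V, F, hV, hF, he, hm⟩ := h
  exact ⟨V, F, hV, hF, he.trans hUW, hm⟩

theorem IsRegular.shift {m : ℕ} {α β : ℝ} {U : ℝ → ℝ} (h : IsRegular m α β U) (t : ℝ) :
    IsRegular m (α - t) (β - t) fun y => U (y + t) := by
  obtain ⟨V, F, hV, hF, he, hm⟩ := h
  refine ⟨fun y => V (y + t), fun y => F (y + t), hV.comp (contDiff_id.add contDiff_const),
    fun z y hzy => hF (by linarith), fun y hy => he ⟨by linarith [hy.1], by linarith [hy.2]⟩, fun z y hzy => ?_⟩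
  simp only [iteratedDeriv_comp_add_const]
  have := hm (z + t) (y + t) (by linarith)
  rwa [add_sub_add_right_eq_sub] at this

/-- Regularity on two overlapping intervals gives regularity on their union. -/
theorem IsRegular.union {m : ℕ} {α β γ δ : ℝ} {U : ℝ → ℝ} (hγβ : γ < β) (hαγ : α ≤ γ) (hβδ : β ≤ δ)
    (h₁ : IsRegular m α β U) (h₂ : IsRegular m γ δ U) : IsRegular m α δ U := by
  obtain ⟨V₁, F₁, hV₁, hF₁, he₁, hm₁⟩ := h₁
  obtain ⟨V₂, F₂, hV₂, hF₂, he₂, hm₂⟩ := h₂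
  set μ := (γ + β) / 2 with hμ
  set V : ℝ → ℝ := fun y => if y < μ then V₁ y else V₂ y with hV
  have hev : ∀ y ∈ Ioo γ β, V₁ y = V₂ y := fun y hy => by
    rw [he₁ ⟨hαγ.trans hy.1.le, hy.2.le⟩, he₂ ⟨hy.1.le, hy.2.le.trans hβδ⟩]
  have hV1 : EqOn V V₁ (Iio β) := fun y hy => by
    by_cases h : y < μ
    · simp [hV, h]
    · simp only [hV, h, if_false]
      exact (hev y ⟨by linarith [not_lt.1 h], hy⟩).symm
  have hV2 : EqOn V V₂ (Ioi γ) := fun y hy => by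
    by_cases h : y < μ
    · simp only [hV, h, if_true]
      exact hev y ⟨hy, by linarith⟩
    · simp [hV, h]
  have hn1 : ∀ y < β, V =ᶠ[nhds y] V₁ := fun y hy => hV1.eventuallyEq_of_mem (Iio_mem_nhds hy)
  have hn2 : ∀ y, γ < y → V =ᶠ[nhds y] V₂ := fun y hy => hV2.eventuallyEq_of_mem (Ioi_mem_nhds hy)
  have hd1 : ∀ y < β, iteratedDeriv m V y = iteratedDeriv m V₁ y := fun y hy => (hn1 y hy).iteratedDeriv_eq m
  have hd2 : ∀ y, γ < y → iteratedDeriv m V y = iteratedDeriv m V₂ y := fun y hy =>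
    (hn2 y hy).iteratedDeriv_eq m
  refine ⟨V, fun y => F₁ y + F₂ y, contDiff_iff_contDiffAt.2 fun y => ?_, hF₁.add hF₂, fun y hy => ?_,
    fun z y hzy => ?_⟩
  · rcases lt_or_ge y β with h | h
    · exact hV₁.contDiffAt.congr_of_eventuallyEq (hn1 y h)
    · exact hV₂.contDiffAt.congr_of_eventuallyEq (hn2 y (hγβ.trans_le h))
  · by_cases h : y < μ
    · simp only [hV, h, if_true]
      exact he₁ ⟨hy.1, by linarith⟩
    · simp only [hV, h, if_false]
      exact he₂ ⟨by linarith [not_lt.1 h], hy.2⟩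
  · have a1 := hF₁ hzy
    have a2 := hF₂ hzy
    rcases lt_or_ge y β with h | h
    · rw [hd1 y h, hd1 z (hzy.trans_lt h)]
      refine (hm₁ z y hzy).trans (mul_le_mul_of_nonneg_left ?_ (by linarith))
      linarith
    · rcases lt_or_ge γ z with h' | h'
      · rw [hd2 y (h'.trans_le hzy), hd2 z h']
        refine (hm₂ z y hzy).trans (mul_le_mul_of_nonneg_left ?_ (by linarith))
        linarith
      · have e1 := hm₁ z μ (by linarith)
        have e2 := hm₂ μ y (by linarith)
        have b1 := hF₁ (show z ≤ μ by linarith)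
        have b2 := hF₁ (show μ ≤ y by linarith)
        have b3 := hF₂ (show z ≤ μ by linarith)
        have b4 := hF₂ (show μ ≤ y by linarith)
        rw [hd2 y (by linarith), hd1 z (by linarith)]
        have e3 : iteratedDeriv m V₁ μ = iteratedDeriv m V₂ μ := by
          rw [← hd1 μ (by linarith), hd2 μ (by linarith)]
        rw [e3] at e1
        set A := iteratedDeriv m V₂ y - iteratedDeriv m V₂ μ with hA
        set B := iteratedDeriv m V₂ μ - iteratedDeriv m V₁ z with hB
        have e4 : iteratedDeriv m V₂ y - iteratedDeriv m V₁ z = A + B := by rw [hA, hB]; ring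
        rw [e4]
        set p := y - μ with hp
        set q := μ - z with hq
        have hp0 : 0 < p := by linarith
        have hq0 : 0 < q := by linarith
        have e5 : y - z = p + q := by rw [hp, hq]; ring
        rw [e5]
        -- Increments on both sides of the seam combine by (A + B)²/(p + q) ≤ A²/p + B²/q, the
        -- convexity of the square.
        have e6 : (A + B) ^ 2 ≤ (p + q) * ((F₂ y - F₂ μ) + (F₁ μ - F₁ z)) := by
          have f1 : A ^ 2 / p ≤ F₂ y - F₂ μ := by rw [div_le_iff₀ hp0]; linarith
          have f2 : B ^ 2 / q ≤ F₁ μ - F₁ z := by rw [div_le_iff₀ hq0]; linarith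
          have f3 : (A + B) ^ 2 ≤ (p + q) * (A ^ 2 / p + B ^ 2 / q) := by
            have f4 : (p + q) * (A ^ 2 / p + B ^ 2 / q) - (A + B) ^ 2 = (q * A - p * B) ^ 2 / (p * q) := by
              field_simp
              ring
            have f5 : 0 ≤ (q * A - p * B) ^ 2 / (p * q) := by positivity
            linarith
          exact f3.trans (mul_le_mul_of_nonneg_left (add_le_add f1 f2) (by linarith))
        refine e6.trans (mul_le_mul_of_nonneg_left ?_ (by linarith))
        linarith

end OFSV

/-! ### Characteristics and the wave profile. -/

namespace OFSV

/-- The solution is constant along characteristics. -/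
theorem IsExactSolution.eq_of_characteristic {a b T : ℝ} {bc : Boundary} {u₀ : ℝ → ℝ} {u : ℝ → ℝ → ℝ}
    (hab : a < b) (hT : 0 < T) (hu : IsExactSolution a b T bc u₀ u) {x t s : ℝ} (hx : x ∈ Icc a b)
    (ht : t ∈ Icc 0 T) (hs : 0 ≤ s) (hsx : s ≤ x - a) (hst : s ≤ t) : u (x - s) (t - s) = u x t := by
  have hmem : ∀ r ∈ Icc 0 s, (x - r, t - r) ∈ Icc a b ×ˢ Icc 0 T := fun r hr =>
    ⟨⟨by linarith [hr.2], by linarith [hr.1, hx.2]⟩, ⟨by linarith [hr.2], by linarith [hr.1, ht.2]⟩⟩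
  have hder : ∀ r ∈ Icc 0 s, ∃ d, HasDerivWithinAt (fun r => u (x - r) (t - r)) d (Icc 0 s) r ∧
      (r < s → d = 0) := by
    intro r hr
    have hm := hmem r hr
    obtain ⟨f', hf'⟩ := hu.contDiffOn.differentiableOn one_ne_zero _ hm
    have h1 : HasDerivWithinAt (fun y => u y (t - r)) (f' (1, 0)) (Icc a b) (x - r) := by
      have h2 : HasDerivWithinAt (fun y : ℝ => (y, t - r)) ((1 : ℝ), (0 : ℝ)) (Icc a b) (x - r) :=
        (hasDerivWithinAt_id _ _).prodMk (hasDerivWithinAt_const _ _ _)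
      have h3 : MapsTo (fun y : ℝ => (y, t - r)) (Icc a b) (Icc a b ×ˢ Icc 0 T) := fun y hy => ⟨hy, hm.2⟩
      exact hf'.comp_hasDerivWithinAt (x - r) h2 h3
    have h2 : HasDerivWithinAt (fun q => u (x - r) q) (f' (0, 1)) (Icc 0 T) (t - r) := by
      have h3 : HasDerivWithinAt (fun q : ℝ => (x - r, q)) ((0 : ℝ), (1 : ℝ)) (Icc 0 T) (t - r) :=
        (hasDerivWithinAt_const _ _ _).prodMk (hasDerivWithinAt_id _ _)
      have h4 : MapsTo (fun q : ℝ => (x - r, q)) (Icc 0 T) (Icc a b ×ˢ Icc 0 T) := fun q hq => ⟨hm.1, hq⟩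
      exact hf'.comp_hasDerivWithinAt (t - r) h3 h4
    have h3 : HasDerivWithinAt (fun r => u (x - r) (t - r)) (f' (-1, -1)) (Icc 0 s) r := by
      have h4 : HasDerivWithinAt (fun r : ℝ => (x - r, t - r)) ((-1 : ℝ), (-1 : ℝ)) (Icc 0 s) r := by
        refine HasDerivWithinAt.prodMk ?_ ?_
        · simpa using (hasDerivWithinAt_id r _).const_sub x
        · simpa using (hasDerivWithinAt_id r _).const_sub t
      exact hf'.comp_hasDerivWithinAt r h4 hmem
    -- The equation holds only at positive times, and `t - r` may reach zero at `r = s`. The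
    -- derivative is therefore shown to vanish for `r < s`, which suffices for constancy.
    refine ⟨_, h3, fun hrs => ?_⟩
    have h5 := hu.pde _ hm.1 (t - r) ⟨by linarith, hm.2.2⟩
    rw [h1.derivWithin (uniqueDiffOn_Icc hab _ hm.1), h2.derivWithin (uniqueDiffOn_Icc hT _ hm.2)] at h5
    have h6 : ((-1 : ℝ), (-1 : ℝ)) = -(((0 : ℝ), (1 : ℝ)) + ((1 : ℝ), (0 : ℝ))) := by simp
    rw [h6, map_neg, map_add, h5, neg_zero]
  rcases hs.eq_or_lt with rfl | hs'
  · simp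
  have hconst := constant_of_derivWithin_zero (f := fun r => u (x - r) (t - r)) (a := 0) (b := s)
    (fun r hr => (hder r hr).choose_spec.1.differentiableWithinAt) (fun r hr => by
      obtain ⟨d, hd, hd0⟩ := hder r (Ico_subset_Icc_self hr)
      rw [hd.derivWithin (uniqueDiffOn_Icc hs' _ (Ico_subset_Icc_self hr)), hd0 hr.2])
  simpa using hconst s ⟨hs, le_rfl⟩

/-- The solution is a travelling wave with a regular profile. -/
theorem IsExactSolution.exists_profile {a b T : ℝ} {bc : Boundary} {u₀ : ℝ → ℝ} {u : ℝ → ℝ → ℝ}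
    (hab : a < b) (hT : 0 < T) (hu : IsExactSolution a b T bc u₀ u) {m : ℕ}
    (hreg : ∀ t ∈ Icc 0 T, MemSobolev (m + 1) a b (fun x => u x t)) :
    ∃ V F : ℝ → ℝ, ContDiff ℝ m V ∧ Monotone F ∧
      (∀ x ∈ Icc a b, ∀ t ∈ Icc 0 T, u x t = V (x - t)) ∧
      ∀ z y, z ≤ y → (iteratedDeriv m V y - iteratedDeriv m V z) ^ 2 ≤ (y - z) * (F y - F z) := by
  -- The profile is read off the initial line where `y ≥ a` and off the left boundary where `y < a`.
  set U : ℝ → ℝ := fun y => if a ≤ y then u y 0 else u a (a - y) with hU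
  have huU : ∀ x ∈ Icc a b, ∀ t ∈ Icc 0 T, u x t = U (x - t) := by
    intro x hx t ht
    rcases le_or_gt a (x - t) with h | h
    · have := hu.eq_of_characteristic hab hT hx ht ht.1 (by linarith) le_rfl
      simp only [hU, h, if_true, ← this, sub_self]
    · have := hu.eq_of_characteristic hab hT hx ht (s := x - a) (by linarith [hx.1]) le_rfl (by linarith)
      simp only [hU, not_le.2 h, if_false, ← this]
      congr 1 <;> ring
  have hwin : ∀ t ∈ Icc 0 T, IsRegular m (a - t) (b - t) U := by
    intro t ht
    have hc : ContinuousOn (fun x => u x t) (Icc a b) :=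
      hu.contDiffOn.continuousOn.comp (by fun_prop : ContinuousOn (fun x : ℝ => (x, t)) (Icc a b))
        fun x hx => ⟨hx, ht⟩
    refine (((hreg t ht).isRegular hab hc).shift t).mono fun y hy => ?_
    have := huU (y + t) ⟨by linarith [hy.1], by linarith [hy.2]⟩ t ht
    simpa using this
  -- Time `t` gives regularity of `U` on the window `[a - t, b - t]` only. Moving back in steps of
  -- at most half its length keeps consecutive windows overlapping, so the windows glue to an
  -- interval that covers all values of `x - t`.
  have hall : ∀ n : ℕ, ∀ s ∈ Icc 0 T, s ≤ n * ((b - a) / 2) → IsRegular m (a - s) b U := by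
    intro n
    induction n with
    | zero =>
      intro s hs hs'
      have : s = 0 := le_antisymm (by simpa using hs') hs.1
      simpa [this] using hwin 0 ⟨le_rfl, hT.le⟩
    | succ n ih =>
      intro s hs hs'
      set r := max 0 (s - (b - a) / 2) with hr
      have hr0 : 0 ≤ r := le_max_left _ _
      have hr1 : s - (b - a) / 2 ≤ r := le_max_right _ _
      have hrs : r ≤ s := max_le hs.1 (by linarith)
      have hrn : r ≤ n * ((b - a) / 2) := by
        refine max_le (by have := sub_pos.2 hab; positivity) ?_
        push_cast at hs'
        linarith
      exact (hwin s hs).union (γ := a - r) (by linarith) (by linarith) (by linarith [hs.1])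
        (ih r ⟨hr0, hrs.trans hs.2⟩ hrn)
  obtain ⟨n, hn⟩ := exists_nat_ge (T / ((b - a) / 2))
  have hba : 0 < (b - a) / 2 := by linarith
  obtain ⟨V, F, hV, hF, he, hm⟩ := hall n T ⟨hT.le, le_rfl⟩ ((div_le_iff₀ hba).1 hn)
  refine ⟨V, F, hV, hF, fun x hx t ht => ?_, hm⟩
  rw [huU x hx t ht, he ⟨by linarith [hx.1, ht.2], by linarith [hx.2, ht.1]⟩]

end OFSV

namespace OFSV

/-! ### Integrals of polynomials -/

/-- The integral over `[α,β]` as a linear functional on polynomials. -/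
def integ (α β : ℝ) : ℝ[X] →ₗ[ℝ] ℝ where
  toFun p := ∫ x in α..β, p.eval x
  map_add' p q := by
    simp only [eval_add]
    exact intervalIntegral.integral_add (p.continuous.intervalIntegrable _ _) (q.continuous.intervalIntegrable _ _)
  map_smul' c p := by
    simp only [eval_smul, RingHom.id_apply]
    exact intervalIntegral.integral_smul _ _

theorem integ_apply (α β : ℝ) (p : ℝ[X]) : integ α β p = ∫ x in α..β, p.eval x := rfl

theorem integ_C_mul (α β c : ℝ) (p : ℝ[X]) : integ α β (C c * p) = c * integ α β p := by
  rw [← smul_eq_C_mul, map_smul, smul_eq_mul]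

theorem integ_derivative (α β : ℝ) (p : ℝ[X]) : integ α β (derivative p) = p.eval β - p.eval α :=
  intervalIntegral.integral_eq_sub_of_hasDerivAt (fun x _ => p.hasDerivAt x)
    ((derivative p).continuous.intervalIntegrable _ _)

theorem integ_derivative_mul (α β : ℝ) (p q : ℝ[X]) :
    integ α β (derivative p * q) = p.eval β * q.eval β - p.eval α * q.eval α - integ α β (p * derivative q) := by
  have h := integ_derivative α β (p * q)
  rw [derivative_mul, map_add, eval_mul, eval_mul] at h
  linarith

theorem integ_mul_self_nonneg (p : ℝ[X]) : 0 ≤ integ 0 1 (p * p) :=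
  intervalIntegral.integral_nonneg zero_le_one fun x _ => by
    rw [eval_mul]
    exact mul_self_nonneg _

/-- The weight 1 serves for the equivalence of norms, the weight `1 - X` for the uniqueness of
correction functions. -/
theorem eq_zero_of_integ_mul_self {p w : ℝ[X]} (hw : ∀ x ∈ Ioo (0 : ℝ) 1, 0 < w.eval x)
    (h : integ 0 1 (w * (p * p)) = 0) : p = 0 := by
  have h1 := (intervalIntegral.integral_eq_zero_iff_of_le_of_nonneg_ae zero_le_one (f := fun x => (w * (p * p)).eval x)
    (by
      rw [Filter.EventuallyLE, ← Measure.restrict_congr_set Ioo_ae_eq_Ioc, ae_restrict_iff' measurableSet_Ioo]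
      refine Filter.Eventually.of_forall fun x hx => ?_
      simp only [Pi.zero_apply, eval_mul]
      exact mul_nonneg (hw x hx).le (mul_self_nonneg _))
    ((w * (p * p)).continuous.intervalIntegrable _ _)).1 h
  have h2 : EqOn (fun x => (w * (p * p)).eval x) 0 (Ioo 0 1) :=
    Measure.eqOn_open_of_ae_eq (ae_restrict_of_ae_restrict_of_subset Ioo_subset_Ioc_self h1) isOpen_Ioo
      (w * (p * p)).continuous.continuousOn continuousOn_const
  refine eq_zero_of_infinite_isRoot _ ((Ioo_infinite zero_lt_one).mono fun x hx => ?_)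
  have h3 := h2 hx
  simpa [(hw x hx).ne'] using h3

theorem sq_integ_le (p : ℝ[X]) : integ 0 1 p ^ 2 ≤ integ 0 1 (p * p) := by
  have h := integ_mul_self_nonneg (p - C (integ 0 1 p))
  have h1 : (p - C (integ 0 1 p)) * (p - C (integ 0 1 p)) =
      p * p - C (2 * integ 0 1 p) * p + C (integ 0 1 p ^ 2) * 1 := by
    simp only [C_mul, C_pow, map_ofNat]
    ring
  have h2 : integ 0 1 (1 : ℝ[X]) = 1 := by simp [integ_apply]
  rw [h1, map_add, map_sub, integ_C_mul, integ_C_mul, h2] at h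
  linarith

/-! ### A norm on polynomials of bounded degree -/

/-- The sum of the absolute values of the first `k + 1` coefficients. -/
def cnorm (k : ℕ) (p : ℝ[X]) : ℝ := ∑ n ∈ Finset.range (k + 1), |p.coeff n|

theorem cnorm_nonneg (k : ℕ) (p : ℝ[X]) : 0 ≤ cnorm k p := Finset.sum_nonneg fun _ _ => abs_nonneg _

theorem cnorm_add_le (k : ℕ) (p q : ℝ[X]) : cnorm k (p + q) ≤ cnorm k p + cnorm k q := by
  rw [cnorm, cnorm, cnorm, ← Finset.sum_add_distrib]
  exact Finset.sum_le_sum fun n _ => by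
    rw [coeff_add]
    exact abs_add_le _ _

theorem cnorm_C_mul (k : ℕ) (c : ℝ) (p : ℝ[X]) : cnorm k (C c * p) = |c| * cnorm k p := by
  simp [cnorm, Finset.mul_sum, abs_mul]

theorem cnorm_neg (k : ℕ) (p : ℝ[X]) : cnorm k (-p) = cnorm k p := by simp [cnorm]

theorem cnorm_zero (k : ℕ) : cnorm k 0 = 0 := by simp [cnorm]

theorem cnorm_sub_le (k : ℕ) (p q : ℝ[X]) : cnorm k (p - q) ≤ cnorm k p + cnorm k q := by
  rw [sub_eq_add_neg, ← cnorm_neg k q]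
  exact cnorm_add_le _ _ _

theorem cnorm_sum_le {ι : Type*} (k : ℕ) (S : Finset ι) (f : ι → ℝ[X]) :
    cnorm k (∑ i ∈ S, f i) ≤ ∑ i ∈ S, cnorm k (f i) := by
  classical
  induction S using Finset.induction_on with
  | empty => simp [cnorm_zero]
  | insert i S hi ih =>
    rw [Finset.sum_insert hi, Finset.sum_insert hi]
    exact (cnorm_add_le _ _ _).trans (add_le_add le_rfl ih)

theorem abs_coeff_le_cnorm {k n : ℕ} (hn : n ≤ k) (p : ℝ[X]) : |p.coeff n| ≤ cnorm k p :=
  Finset.single_le_sum (f := fun n => |p.coeff n|) (fun _ _ => abs_nonneg _)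
    (Finset.mem_range.2 (Nat.lt_succ_of_le hn))

theorem abs_eval_iterate_derivative_le {k : ℕ} {p : ℝ[X]} (hp : p.natDegree ≤ k) (l : ℕ) {y : ℝ}
    (hy : y ∈ Icc (0 : ℝ) 1) : |(derivative^[l] p).eval y| ≤ k.factorial * cnorm k p := by
  conv_lhs => rw [p.as_sum_range_C_mul_X_pow' (Nat.lt_succ_of_le hp)]
  rw [iterate_derivative_sum, eval_finsetSum, cnorm, Finset.mul_sum]
  refine (Finset.abs_sum_le_sum_abs _ _).trans (Finset.sum_le_sum fun n hn => ?_)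
  rw [iterate_derivative_C_mul, iterate_derivative_X_pow_eq_smul, eval_mul, eval_C, abs_mul, mul_comm]
  refine mul_le_mul_of_nonneg_right ?_ (abs_nonneg _)
  rw [eval_smul, eval_pow, eval_X, smul_eq_mul, abs_mul, abs_pow, abs_of_nonneg hy.1, Nat.abs_cast]
  have h1 : y ^ (n - l) ≤ 1 := pow_le_one₀ hy.1 hy.2
  have h2 : n.descFactorial l ≤ k.factorial := by
    refine le_trans ?_ (Nat.factorial_le (Nat.lt_succ_iff.1 (Finset.mem_range.1 hn)))
    rcases le_or_gt l n with h | h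
    · rw [← Nat.factorial_mul_descFactorial h]
      exact Nat.le_mul_of_pos_left _ (Nat.factorial_pos _)
    · rw [Nat.descFactorial_of_lt h]
      exact Nat.zero_le _
  calc (n.descFactorial l : ℝ) * y ^ (n - l) ≤ n.descFactorial l * 1 :=
        mul_le_mul_of_nonneg_left h1 (Nat.cast_nonneg _)
    _ ≤ k.factorial := by rw [mul_one]; exact_mod_cast h2

theorem abs_eval_le {k : ℕ} {p : ℝ[X]} (hp : p.natDegree ≤ k) {y : ℝ} (hy : y ∈ Icc (0 : ℝ) 1) :
    |p.eval y| ≤ cnorm k p := by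
  rw [eval_eq_sum_range' (Nat.lt_succ_of_le hp), cnorm]
  refine (Finset.abs_sum_le_sum_abs _ _).trans (Finset.sum_le_sum fun n _ => ?_)
  rw [abs_mul, abs_pow, abs_of_nonneg hy.1]
  exact mul_le_of_le_one_right (abs_nonneg _) (pow_le_one₀ hy.1 hy.2)

theorem integ_mul_self_le {k : ℕ} {p : ℝ[X]} (hp : p.natDegree ≤ k) : integ 0 1 (p * p) ≤ cnorm k p ^ 2 := by
  have h : integ 0 1 (p * p) ≤ ∫ _ in (0 : ℝ)..1, cnorm k p ^ 2 := by
    refine intervalIntegral.integral_mono_on zero_le_one ((p * p).continuous.intervalIntegrable _ _)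
      intervalIntegrable_const fun x hx => ?_
    rw [eval_mul, ← sq, ← sq_abs]
    exact pow_le_pow_left₀ (abs_nonneg _) (abs_eval_le hp hx) 2
  simpa using h

/-- The polynomial with given first coefficients. -/
def ofCoeffs (k : ℕ) : (Fin (k + 1) → ℝ) →ₗ[ℝ] ℝ[X] := ∑ j : Fin (k + 1), (monomial (j : ℕ)).comp (LinearMap.proj j)

theorem ofCoeffs_apply (k : ℕ) (c : Fin (k + 1) → ℝ) : ofCoeffs k c = ∑ j : Fin (k + 1), monomial (j : ℕ) (c j) := by
  simp [ofCoeffs]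

theorem natDegree_ofCoeffs_le (k : ℕ) (c : Fin (k + 1) → ℝ) : (ofCoeffs k c).natDegree ≤ k := by
  rw [ofCoeffs_apply]
  exact natDegree_sum_le_of_forall_le _ _ fun j _ =>
    (natDegree_monomial_le _).trans (Nat.lt_succ_iff.1 j.2)

theorem ofCoeffs_coeff {k : ℕ} {p : ℝ[X]} (hp : p.natDegree ≤ k) : ofCoeffs k (fun j => p.coeff j) = p := by
  rw [ofCoeffs_apply, Fin.sum_univ_eq_sum_range (fun n => monomial n (p.coeff n)) (k + 1)]
  exact (p.as_sum_range' (k + 1) (Nat.lt_succ_of_le hp)).symm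

theorem ofCoeffs_injective (k : ℕ) : Function.Injective (ofCoeffs k) := by
  rw [← LinearMap.ker_eq_bot, LinearMap.ker_eq_bot']
  intro c hc
  funext j
  have h := congrArg (fun p => p.coeff (j : ℕ)) hc
  simpa [ofCoeffs_apply, coeff_monomial, Fin.val_inj] using h

/-- Coefficient vectors form a finite-dimensional space, on which an injective linear map is bounded
below. -/
theorem exists_cnorm_le {ι : Type*} [Fintype ι] (k : ℕ) (Φ : ℝ[X] →ₗ[ℝ] (ι → ℝ))
    (hΦ : ∀ p : ℝ[X], p.natDegree ≤ k → Φ p = 0 → p = 0) :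
    ∃ K : ℝ, 0 < K ∧ ∀ p : ℝ[X], p.natDegree ≤ k → cnorm k p ≤ K * ‖Φ p‖ := by
  have hker : LinearMap.ker (Φ.comp (ofCoeffs k)) = ⊥ := by
    rw [LinearMap.ker_eq_bot']
    intro c hc
    apply ofCoeffs_injective k
    rw [map_zero]
    exact hΦ _ (natDegree_ofCoeffs_le k c) hc
  obtain ⟨K, hK0, hK⟩ := LinearMap.exists_antilipschitzWith _ hker
  refine ⟨(k + 1) * K, by positivity, fun p hp => ?_⟩
  have h1 := hK.le_mul_norm_sub (fun j : Fin (k + 1) => p.coeff j) 0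
  rw [map_zero, add_zero, add_zero, norm_neg, norm_neg, LinearMap.comp_apply, ofCoeffs_coeff hp] at h1
  rw [mul_assoc]
  calc cnorm k p ≤ ∑ _n ∈ Finset.range (k + 1), K * ‖Φ p‖ := by
        refine Finset.sum_le_sum fun n hn => le_trans ?_ h1
        exact norm_le_pi_norm (fun j : Fin (k + 1) => p.coeff j) ⟨n, Finset.mem_range.1 hn⟩
    _ = (k + 1) * (K * ‖Φ p‖) := by simp

theorem exists_natDegree_le_eq (k : ℕ) (Φ : ℝ[X] →ₗ[ℝ] (Fin (k + 1) → ℝ))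
    (hΦ : ∀ p : ℝ[X], p.natDegree ≤ k → Φ p = 0 → p = 0) (v : Fin (k + 1) → ℝ) :
    ∃ p : ℝ[X], p.natDegree ≤ k ∧ Φ p = v := by
  have hinj : Function.Injective (Φ.comp (ofCoeffs k)) := by
    rw [← LinearMap.ker_eq_bot, LinearMap.ker_eq_bot']
    intro c hc
    apply ofCoeffs_injective k
    rw [map_zero]
    exact hΦ _ (natDegree_ofCoeffs_le k c) hc
  obtain ⟨c, hc⟩ := LinearMap.injective_iff_surjective.1 hinj v
  exact ⟨_, natDegree_ofCoeffs_le k c, hc⟩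

theorem integ_mul_eq_sum {k : ℕ} (p : ℝ[X]) {q : ℝ[X]} (hq : q.natDegree ≤ k) :
    integ 0 1 (p * q) = ∑ n ∈ Finset.range (k + 1), q.coeff n * integ 0 1 (p * X ^ n) := by
  conv_lhs => rw [q.as_sum_range_C_mul_X_pow' (Nat.lt_succ_of_le hq)]
  rw [Finset.mul_sum, map_sum]
  exact Finset.sum_congr rfl fun n _ => by rw [mul_left_comm, integ_C_mul]

/-- A polynomial of degree at most k is determined by its moments against 1, …, X^k, and each moment
is at most the L² norm. -/
theorem exists_cnorm_sq_le (k : ℕ) :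
    ∃ K : ℝ, 0 < K ∧ ∀ p : ℝ[X], p.natDegree ≤ k → cnorm k p ^ 2 ≤ K * integ 0 1 (p * p) := by
  let Φ : ℝ[X] →ₗ[ℝ] (Fin (k + 1) → ℝ) :=
    LinearMap.pi fun m => (integ 0 1).comp (LinearMap.mulRight ℝ (X ^ (m : ℕ)))
  have hΦa : ∀ p m, Φ p m = integ 0 1 (p * X ^ (m : ℕ)) := fun p m => rfl
  obtain ⟨K, hK0, hK⟩ := exists_cnorm_le k Φ fun p hp h => by
    refine eq_zero_of_integ_mul_self (w := 1) (fun x _ => by simp) ?_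
    rw [one_mul, integ_mul_eq_sum p hp]
    refine Finset.sum_eq_zero fun n hn => ?_
    have := congrFun h ⟨n, Finset.mem_range.1 hn⟩
    rw [hΦa] at this
    simp [this]
  refine ⟨K ^ 2, by positivity, fun p hp => ?_⟩
  have h1 : ‖Φ p‖ ≤ √(integ 0 1 (p * p)) := by
    refine (pi_norm_le_iff_of_nonneg (Real.sqrt_nonneg _)).2 fun m => ?_
    rw [hΦa, Real.norm_eq_abs]
    refine Real.abs_le_sqrt ((sq_integ_le _).trans ?_)
    refine intervalIntegral.integral_mono_on zero_le_one (Polynomial.continuous _).continuousOn.intervalIntegrable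
      (Polynomial.continuous _).continuousOn.intervalIntegrable fun x hx => ?_
    simp only [eval_mul, eval_pow, eval_X]
    have h2 : x ^ (m : ℕ) * x ^ (m : ℕ) ≤ 1 :=
      mul_le_one₀ (pow_le_one₀ hx.1 hx.2) (pow_nonneg hx.1 _) (pow_le_one₀ hx.1 hx.2)
    nlinarith [mul_self_nonneg (p.eval x)]
  calc cnorm k p ^ 2 ≤ (K * √(integ 0 1 (p * p))) ^ 2 :=
        pow_le_pow_left₀ (cnorm_nonneg _ _) ((hK p hp).trans (mul_le_mul_of_nonneg_left h1 hK0.le)) 2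
    _ = K ^ 2 * integ 0 1 (p * p) := by rw [mul_pow, Real.sq_sqrt (integ_mul_self_nonneg p)]

/-- Stability of `L²` projections. -/
theorem exists_cnorm_le_of_orthogonal (k : ℕ) :
    ∃ K : ℝ, 0 < K ∧ ∀ (n : ℕ) (d e : ℝ[X]), d.natDegree ≤ k → e.natDegree ≤ k → (d - e).natDegree ≤ n →
      (∀ r : ℝ[X], r.natDegree ≤ n → integ 0 1 (d * r) = 0) → cnorm k d ≤ K * cnorm k e := by
  obtain ⟨K, hK0, hK⟩ := exists_cnorm_sq_le k
  refine ⟨√K, Real.sqrt_pos.2 hK0, fun n d e hd he hde h => ?_⟩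
  have h1 := h (d - e) hde
  have h2 := integ_mul_self_nonneg (d - e)
  -- As `d` is orthogonal to `d - e`, expanding ‖d - e‖² ≥ 0 gives ‖d‖ ≤ ‖e‖ in L²: an orthogonal
  -- projection does not increase the norm.
  have h3 : (d - e) * (d - e) = C 2 * (d * (d - e)) - d * d + e * e := by
    simp only [map_ofNat]
    ring
  rw [h3, map_add, map_sub, integ_C_mul, h1] at h2
  have h4 : cnorm k d ^ 2 ≤ K * cnorm k e ^ 2 :=
    (hK d hd).trans (mul_le_mul_of_nonneg_left (by linarith [integ_mul_self_le he]) hK0.le)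
  rw [← Real.sqrt_sq (cnorm_nonneg k d), ← Real.sqrt_sq (cnorm_nonneg k e), ← Real.sqrt_mul hK0.le]
  exact Real.sqrt_le_sqrt h4

end OFSV

namespace OFSV

/-! ### Legendre polynomials -/

/-- The real polynomial whose values are `legendre01 n`. -/
def legendrePoly (n : ℕ) : ℝ[X] := C ((-1) ^ n) * (shiftedLegendre n).map (Int.castRingHom ℝ)

theorem eval_legendrePoly (n : ℕ) (y : ℝ) : (legendrePoly n).eval y = legendre01 n y := by
  rw [legendrePoly, legendre01, eval_mul, eval_C, eval_map, aeval_def]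
  rfl

theorem natDegree_legendrePoly (n : ℕ) : (legendrePoly n).natDegree = n := by
  rw [legendrePoly, natDegree_C_mul (by simp), natDegree_map_eq_of_injective (RingHom.injective_int _),
    natDegree_shiftedLegendre]

theorem legendrePoly_ne_zero (n : ℕ) : legendrePoly n ≠ 0 := by
  have h : shiftedLegendre n ≠ 0 := fun h => by simpa [h] using degree_shiftedLegendre n
  rw [legendrePoly]
  refine mul_ne_zero (by simp) ?_
  rwa [Ne, Polynomial.map_eq_zero_iff (RingHom.injective_int _)]

theorem legendre01_one (n : ℕ) : legendre01 n 1 = 1 := by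
  have h : aeval (1 - 1 : ℝ) (shiftedLegendre n) = 1 := by
    rw [sub_self, aeval_def, eval₂_at_zero, coeff_shiftedLegendre]
    simp
  rw [legendre01, shiftedLegendre_eval_symm, h, mul_one, ← mul_pow]
  simp

theorem integ_iterate_derivative_mul {w q : ℝ[X]} (n : ℕ)
    (h0 : ∀ i < n, (derivative^[i] w).eval 0 = 0) (h1 : ∀ i < n, (derivative^[i] w).eval 1 = 0) :
    integ 0 1 (derivative^[n] w * q) = (-1) ^ n * integ 0 1 (w * derivative^[n] q) := by
  induction n generalizing q with
  | zero => simp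
  | succ n ih =>
    rw [Function.iterate_succ_apply', integ_derivative_mul, h0 n n.lt_succ_self, h1 n n.lt_succ_self,
      ih (fun i hi => h0 i (hi.trans n.lt_succ_self)) (fun i hi => h1 i (hi.trans n.lt_succ_self)),
      Function.iterate_succ_apply, pow_succ]
    ring

/-- By Rodrigues' formula the polynomial is a multiple of the n-th derivative of `X^n (1 - X)^n`.
Integrating by parts n times leaves no boundary terms, because this function vanishes to order n at
both ends, and moves all derivatives to `q`. -/
theorem integ_legendrePoly_mul {n : ℕ} {q : ℝ[X]} (hq : q.degree < n) : integ 0 1 (legendrePoly n * q) = 0 := by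
  set w : ℝ[X] := X ^ n * (1 - X) ^ n with hw
  have hw0 : w ≠ 0 := mul_ne_zero (pow_ne_zero _ X_ne_zero) (pow_ne_zero _ fun h => by
    simpa using congrArg (eval 0) h)
  have hvan : ∀ t : ℝ, (X - C t) ^ n ∣ w → ∀ i < n, (derivative^[i] w).eval t = 0 := fun t ht i hi =>
    isRoot_iterate_derivative_of_lt_rootMultiplicity (hi.trans_le ((le_rootMultiplicity_iff hw0).2 ht))
  have hR : (n.factorial : ℝ[X]) * (shiftedLegendre n).map (Int.castRingHom ℝ) = derivative^[n] w := by
    have h := congrArg (Polynomial.map (Int.castRingHom ℝ)) (factorial_mul_shiftedLegendre_eq n)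
    rw [← iterate_derivative_map] at h
    simpa [hw] using h
  have hI := integ_iterate_derivative_mul (w := w) (q := q) n
    (hvan 0 (by simp [hw])) (hvan 1 (by
      refine Dvd.dvd.mul_left (pow_dvd_pow_of_dvd ?_ n) _
      exact ⟨-1, by simp⟩))
  have hz : derivative^[n] q = 0 := by
    rcases eq_or_ne q 0 with rfl | h
    · simp
    · exact iterate_derivative_eq_zero ((natDegree_lt_iff_degree_lt h).2 hq)
  rw [hz, mul_zero, map_zero, mul_zero, ← hR, mul_assoc, ← C_eq_natCast, integ_C_mul] at hI
  rw [legendrePoly, mul_assoc, integ_C_mul]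
  have : (n.factorial : ℝ) ≠ 0 := by exact_mod_cast n.factorial_ne_zero
  rw [(mul_eq_zero.1 hI).resolve_left this, mul_zero]

/-! ### The quadrature on the reference cell -/

section Reference

variable {s : Scheme} {k : ℕ} {ρ : Fin (k + 2) → ℝ}

theorem IsReferencePoints.mem_Icc (hρ : IsReferencePoints s k ρ) (j : Fin (k + 2)) : ρ j ∈ Icc (0 : ℝ) 1 :=
  ⟨hρ.first ▸ hρ.strictMono.monotone (Fin.zero_le j), hρ.last ▸ hρ.strictMono.monotone (Fin.le_last j)⟩

theorem card_quadIndices_LSV (k : ℕ) : (quadIndices .LSV k).card = k := by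
  have : quadIndices .LSV k = (Finset.univ.erase 0).erase (Fin.last (k + 1)) := by
    ext j
    simp [quadIndices, and_comm]
  rw [this, Finset.card_erase_of_mem (by simp), Finset.card_erase_of_mem (by simp)]
  simp

theorem card_quadIndices_RRSV (k : ℕ) : (quadIndices .RRSV k).card = k + 1 := by
  have : quadIndices .RRSV k = Finset.univ.erase 0 := by
    ext j
    simp [quadIndices]
  rw [this, Finset.card_erase_of_mem (by simp)]
  simp

/-- The monic polynomial vanishing at the quadrature points is orthogonal to all polynomials of degree
less than `k`. -/
theorem integ_nodal_mul (hρ : IsReferencePoints s k ρ) {q : ℝ[X]} (hq : q.degree < k) :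
    integ 0 1 (Lagrange.nodal (quadIndices s k) ρ * q) = 0 := by
  -- A polynomial that vanishes at the nodes and has as many zeros as its degree is a multiple of
  -- the nodal polynomial. It is applied to L_k and to L_{k+1} - L_k; the latter also vanishes at 1,
  -- where all Legendre polynomials have the value 1.
  have key : ∀ P : ℝ[X], P.degree = (quadIndices s k).card → (∀ j ∈ quadIndices s k, P.eval (ρ j) = 0) →
      integ 0 1 (P * q) = 0 → integ 0 1 (Lagrange.nodal (quadIndices s k) ρ * q) = 0 := by
    intro P hP hz hI
    have hP0 : P ≠ 0 := fun h => by simp [h] at hP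
    have hlc : P.leadingCoeff ≠ 0 := leadingCoeff_ne_zero.2 hP0
    have h1 : P = C P.leadingCoeff * Lagrange.nodal (quadIndices s k) ρ := by
      have hd : (C P.leadingCoeff * Lagrange.nodal (quadIndices s k) ρ).degree = P.degree := by
        rw [degree_C_mul hlc, Lagrange.degree_nodal, hP]
      refine sub_eq_zero.1 (Polynomial.eq_zero_of_degree_lt_of_eval_index_eq_zero (s := quadIndices s k) (v := ρ)
        (hρ.strictMono.injective.injOn) ?_ fun j hj => ?_)
      · rw [← hP]
        refine degree_sub_lt_left hd.symm hP0 ?_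
        rw [leadingCoeff_mul, leadingCoeff_C, (Lagrange.nodal_monic (s := quadIndices s k) (v := ρ)).leadingCoeff, mul_one]
      · rw [eval_sub, hz j hj, eval_mul, Lagrange.eval_nodal_at_node hj, mul_zero, sub_zero]
    rw [h1, mul_assoc, integ_C_mul] at hI
    exact (mul_eq_zero.1 hI).resolve_left hlc
  cases s with
  | LSV =>
    refine key (legendrePoly k) ?_ (fun j hj => ?_) (integ_legendrePoly_mul hq)
    · rw [card_quadIndices_LSV, degree_eq_natDegree (legendrePoly_ne_zero k), natDegree_legendrePoly]
    · have hj' : j ≠ 0 ∧ j ≠ Fin.last (k + 1) := by simpa [quadIndices] using hj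
      rw [eval_legendrePoly]
      exact hρ.zeros j hj'.1 hj'.2
  | RRSV =>
    refine key (legendrePoly (k + 1) - legendrePoly k) ?_ (fun j hj => ?_) ?_
    · rw [card_quadIndices_RRSV, degree_sub_eq_left_of_degree_lt, degree_eq_natDegree (legendrePoly_ne_zero _),
        natDegree_legendrePoly]
      rw [degree_eq_natDegree (legendrePoly_ne_zero _), degree_eq_natDegree (legendrePoly_ne_zero _),
        natDegree_legendrePoly, natDegree_legendrePoly]
      exact_mod_cast k.lt_succ_self
    · have hj' : j ≠ 0 := by simpa [quadIndices] using hj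
      rw [eval_sub, eval_legendrePoly, eval_legendrePoly]
      rcases eq_or_ne j (Fin.last (k + 1)) with rfl | h
      · rw [hρ.last, legendre01_one, legendre01_one, sub_self]
      · exact hρ.zeros j hj' h
    · rw [sub_mul, map_sub, integ_legendrePoly_mul hq,
        integ_legendrePoly_mul (hq.trans (by exact_mod_cast k.lt_succ_self)), sub_self]

/-- The quadrature weights on the reference cell. -/
def refWeight (s : Scheme) (ρ : Fin (k + 2) → ℝ) (m : Fin (k + 2)) : ℝ :=
  integ 0 1 (Lagrange.basis (quadIndices s k) ρ m)

/-- The quadrature on the reference cell. -/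
def refQuad (s : Scheme) (ρ : Fin (k + 2) → ℝ) (p : ℝ[X]) : ℝ :=
  ∑ m ∈ quadIndices s k, refWeight s ρ m * p.eval (ρ m)

/-- The remainder modulo the nodal polynomial is the interpolant at the nodes, whose integral is the
quadrature. The quadrature error is thus the integral of the nodal polynomial times the quotient. -/
theorem integ_eq_refQuad_add (hρ : IsReferencePoints s k ρ) (p : ℝ[X]) :
    integ 0 1 p = refQuad s ρ p +
      integ 0 1 (Lagrange.nodal (quadIndices s k) ρ * (p /ₘ Lagrange.nodal (quadIndices s k) ρ)) := by
  set N := Lagrange.nodal (quadIndices s k) ρ with hN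
  have hmon : N.Monic := Lagrange.nodal_monic
  have h1 : p %ₘ N = Lagrange.interpolate (quadIndices s k) ρ fun m => p.eval (ρ m) := by
    refine Lagrange.eq_interpolate_of_eval_eq _ hρ.strictMono.injective.injOn ?_ fun m hm => ?_
    · rw [← Lagrange.degree_nodal (s := quadIndices s k) (v := ρ)]
      exact degree_modByMonic_lt _ hmon
    · have h := congrArg (eval (ρ m)) (modByMonic_add_div p N)
      rwa [eval_add, eval_mul, hN, Lagrange.eval_nodal_at_node hm, zero_mul, add_zero] at h
  have h2 : integ 0 1 (p %ₘ N) = refQuad s ρ p := by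
    rw [h1, Lagrange.interpolate_apply, map_sum]
    exact Finset.sum_congr rfl fun m _ => by rw [integ_C_mul, refWeight, mul_comm]
  conv_lhs => rw [← modByMonic_add_div p N]
  rw [map_add, h2]

theorem refQuad_eq_of_degree_lt (hρ : IsReferencePoints s k ρ) {p : ℝ[X]}
    (hp : p.degree < (quadIndices s k).card) : refQuad s ρ p = integ 0 1 p := by
  rw [integ_eq_refQuad_add hρ, divByMonic_eq_zero_iff Lagrange.nodal_monic |>.2
    (by rwa [Lagrange.degree_nodal]), mul_zero, map_zero, add_zero]

theorem natDegree_nodal_LSV : (Lagrange.nodal (quadIndices .LSV k) ρ).natDegree = k := by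
  rw [Lagrange.natDegree_nodal, card_quadIndices_LSV]

/-- Gauss quadrature with k nodes is exact up to degree 2k - 1, one less than the summation by parts
needs. In degree 2k the quotient has degree k, and by orthogonality only its leading coefficient
contributes to the error. -/
theorem refQuad_LSV (hρ : IsReferencePoints .LSV k ρ) {p : ℝ[X]} (hp : p.natDegree ≤ 2 * k) :
    refQuad .LSV ρ p = integ 0 1 p - p.coeff (2 * k) *
      integ 0 1 (Lagrange.nodal (quadIndices .LSV k) ρ * Lagrange.nodal (quadIndices .LSV k) ρ) := by
  set N := Lagrange.nodal (quadIndices .LSV k) ρ with hN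
  have hmon : N.Monic := Lagrange.nodal_monic
  have hdeg : N.natDegree = k := natDegree_nodal_LSV
  have hdeg' : N.degree = k := by rw [degree_eq_natDegree hmon.ne_zero, hdeg]
  set q := p /ₘ N with hq
  have hqd : q.natDegree ≤ k := by
    rw [hq, natDegree_divByMonic _ hmon, hdeg]
    omega
  have hqc : q.coeff k = p.coeff (2 * k) := by
    have h := congrArg (fun r => r.coeff (k + k)) (modByMonic_add_div p N)
    simp only [coeff_add] at h
    rw [coeff_mul_add_eq_of_natDegree_le hdeg.le hqd, coeff_eq_zero_of_degree_lt (n := k + k), zero_add] at h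
    · have h1 : N.coeff k = 1 := by rw [← hdeg]; exact hmon
      rw [h1, one_mul] at h
      rw [h, two_mul]
    · refine (degree_modByMonic_lt _ hmon).trans_le ?_
      rw [hdeg']
      exact_mod_cast Nat.le_add_left k k
  have hlow : (q - C (q.coeff k) * N).degree < k := by
    rw [degree_lt_iff_coeff_zero]
    intro m hm
    have h1 : N.coeff k = 1 := by rw [← hdeg]; exact hmon
    rcases hm.eq_or_lt with rfl | hm'
    · rw [coeff_sub, coeff_C_mul, h1, mul_one, sub_self]
    · rw [coeff_sub, coeff_C_mul, coeff_eq_zero_of_natDegree_lt (hqd.trans_lt hm'),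
        coeff_eq_zero_of_natDegree_lt (hdeg.trans_lt hm'), mul_zero, sub_zero]
  have h1 := integ_nodal_mul hρ hlow
  rw [← hN, mul_sub, map_sub, mul_left_comm, integ_C_mul, hqc] at h1
  have h2 := integ_eq_refQuad_add hρ p
  rw [← hN, ← hq] at h2
  linarith

/-- With k + 1 nodes the quotient has degree at most k - 1, so it is orthogonal to the nodal
polynomial. -/
theorem refQuad_RRSV (hk : 1 ≤ k) (hρ : IsReferencePoints .RRSV k ρ) {p : ℝ[X]} (hp : p.natDegree ≤ 2 * k) :
    refQuad .RRSV ρ p = integ 0 1 p := by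
  have h2 := integ_eq_refQuad_add hρ p
  rw [integ_nodal_mul hρ] at h2
  · linarith
  · refine degree_le_natDegree.trans_lt ?_
    rw [natDegree_divByMonic _ Lagrange.nodal_monic, Lagrange.natDegree_nodal, card_quadIndices_RRSV]
    exact_mod_cast (by omega : p.natDegree - (k + 1) < k)

end Reference

end OFSV

/-! ### Test functions on the reference cell and summation by parts. -/

namespace OFSV

section Reference

variable {s : Scheme} {k : ℕ} {ρ : Fin (k + 2) → ℝ}

/-- The values on the control volumes of the reference cell of the test function belonging to `v`. -/
def refStar (s : Scheme) (ρ : Fin (k + 2) → ℝ) (v : ℝ[X]) (j : Fin (k + 1)) : ℝ :=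
  v.eval 0 + ∑ m ∈ Finset.univ.filter (fun m : Fin (k + 2) => m ≠ 0 ∧ m.val ≤ j.val),
    refWeight s ρ m * (derivative v).eval (ρ m)

/-- The pairing of a function with the test function belonging to `v` on the reference cell. -/
def refPairing (s : Scheme) (ρ : Fin (k + 2) → ℝ) (f : ℝ → ℝ) (v : ℝ[X]) : ℝ :=
  ∑ j, refStar s ρ v j * ∫ y in (ρ j.castSucc)..(ρ j.succ), f y

theorem sum_filter_interior (f : Fin (k + 2) → ℝ) :
    ∑ m ∈ Finset.univ.filter (fun m : Fin (k + 2) => m ≠ 0 ∧ m ≠ Fin.last (k + 1)), f m =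
      ∑ i : Fin k, f i.castSucc.succ := by
  rw [Finset.sum_filter, Fin.sum_univ_succ, Fin.sum_univ_castSucc]
  simp [Fin.succ_ne_zero, ← Fin.succ_last, Fin.castSucc_ne_last, Fin.succ_inj]

/-- Abel summation. It trades the jumps of the test function, which are the terms `B m` at the
interior points, for the differences of `F`. -/
theorem sum_partialSum_mul_sub (c : ℝ) (B F : Fin (k + 2) → ℝ) :
    ∑ j : Fin (k + 1), (c + ∑ m ∈ Finset.univ.filter (fun m : Fin (k + 2) => m ≠ 0 ∧ m.val ≤ j.val), B m) *
      (F j.succ - F j.castSucc) =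
    (c + ∑ m ∈ Finset.univ.filter (fun m : Fin (k + 2) => m ≠ 0 ∧ m ≠ Fin.last (k + 1)), B m) * F (Fin.last (k + 1))
      - c * F 0 - ∑ m ∈ Finset.univ.filter (fun m : Fin (k + 2) => m ≠ 0 ∧ m ≠ Fin.last (k + 1)), B m * F m := by
  set W : Fin (k + 1) → ℝ := fun j => c + ∑ m ∈ Finset.univ.filter (fun m : Fin (k + 2) => m ≠ 0 ∧ m.val ≤ j.val), B m
    with hW
  have hW0 : W 0 = c := by
    have : Finset.univ.filter (fun m : Fin (k + 2) => m ≠ 0 ∧ m.val ≤ (0 : Fin (k + 1)).val) = ∅ := by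
      ext m
      simp only [Finset.mem_filter, Finset.mem_univ, true_and, Finset.notMem_empty, iff_false, not_and,
        Fin.val_zero, Nat.le_zero]
      exact fun h h' => h (Fin.ext h')
    simp only [hW, this, Finset.sum_empty, add_zero]
  have hWs : ∀ i : Fin k, W i.succ = W i.castSucc + B i.castSucc.succ := fun i => by
    have : Finset.univ.filter (fun m : Fin (k + 2) => m ≠ 0 ∧ m.val ≤ i.succ.val) =
        insert i.castSucc.succ (Finset.univ.filter (fun m : Fin (k + 2) => m ≠ 0 ∧ m.val ≤ i.castSucc.val)) := by
      ext m
      simp only [Finset.mem_filter, Finset.mem_univ, true_and, Finset.mem_insert, Fin.ext_iff, Fin.val_succ,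
        Fin.val_castSucc, Ne, Fin.val_zero]
      omega
    simp only [hW, this]
    rw [Finset.sum_insert (by simp)]
    ring
  have hWl : W (Fin.last k) =
      c + ∑ m ∈ Finset.univ.filter (fun m : Fin (k + 2) => m ≠ 0 ∧ m ≠ Fin.last (k + 1)), B m := by
    simp only [hW]
    congr 2
    ext m
    simp only [Finset.mem_filter, Finset.mem_univ, true_and, Fin.ext_iff, Fin.val_last, Ne, Fin.val_zero]
    have := m.2
    omega
  rw [sum_filter_interior (fun m => B m * F m), ← hWl]
  change ∑ j, W j * _ = _
  simp only [mul_sub]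
  rw [Finset.sum_sub_distrib, Fin.sum_univ_castSucc, Fin.sum_univ_succ (fun j => W j * F j.castSucc), hW0]
  simp only [hWs, Fin.succ_last, Fin.castSucc_zero]
  have h : ∑ i : Fin k, (W i.castSucc + B i.castSucc.succ) * F i.succ.castSucc =
      ∑ i : Fin k, W i.castSucc * F i.castSucc.succ + ∑ i : Fin k, B i.castSucc.succ * F i.castSucc.succ := by
    rw [← Finset.sum_add_distrib]
    exact Finset.sum_congr rfl fun i _ => by rw [Fin.succ_castSucc]; ring
  rw [h]
  ring

theorem degree_derivative_lt_of_natDegree_le (hk : 1 ≤ k) {v : ℝ[X]} (hv : v.natDegree ≤ k) :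
    (derivative v).natDegree ≤ k - 1 := (natDegree_derivative_le v).trans (by omega)

/-- Summation by parts on the reference cell. -/
theorem exists_sum_refStar_mul_sub (hk : 1 ≤ k) (hρ : IsReferencePoints s k ρ) :
    ∃ κ : ℝ, 0 ≤ κ ∧ ∀ (F v : ℝ[X]) (c : ℝ), F.natDegree ≤ k + 1 → v.natDegree ≤ k →
      ∑ j : Fin (k + 1), refStar s ρ v j *
        (F.eval (ρ j.succ) - if j = 0 then c else F.eval (ρ j.castSucc)) =
      F.eval 1 * v.eval 1 - c * v.eval 0 - integ 0 1 (F * derivative v) + κ * (F.coeff (k + 1) * v.coeff k) := by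
  have habel : ∀ (F v : ℝ[X]) (c : ℝ), ∑ j : Fin (k + 1), refStar s ρ v j *
        (F.eval (ρ j.succ) - if j = 0 then c else F.eval (ρ j.castSucc)) =
      (v.eval 0 + ∑ m ∈ Finset.univ.filter (fun m : Fin (k + 2) => m ≠ 0 ∧ m ≠ Fin.last (k + 1)),
        refWeight s ρ m * (derivative v).eval (ρ m)) * F.eval 1 - c * v.eval 0 -
      ∑ m ∈ Finset.univ.filter (fun m : Fin (k + 2) => m ≠ 0 ∧ m ≠ Fin.last (k + 1)),
        refWeight s ρ m * (F * derivative v).eval (ρ m) := fun F v c => by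
    have h := sum_partialSum_mul_sub (v.eval 0) (fun m => refWeight s ρ m * (derivative v).eval (ρ m))
      (fun m => if m = 0 then c else F.eval (ρ m))
    have h1 : ∀ j : Fin (k + 1), ((j.castSucc = 0) ↔ j = 0) := fun j => Fin.castSucc_eq_zero_iff
    simp only [Fin.succ_ne_zero, if_false, h1, if_true, (Fin.last_pos (n := k)).ne', hρ.last] at h
    unfold refStar
    rw [h]
    congr 1
    · ring
    · refine Finset.sum_congr rfl fun m hm => ?_
      rw [if_neg (Finset.mem_filter.1 hm).2.1, eval_mul]
      ring
  have hdeg : ∀ F v : ℝ[X], F.natDegree ≤ k + 1 → v.natDegree ≤ k →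
      (F * derivative v).natDegree ≤ 2 * k := fun F v hF hv =>
    natDegree_mul_le.trans (by have := degree_derivative_lt_of_natDegree_le hk hv; omega)
  cases s with
  | LSV =>
    set N := Lagrange.nodal (quadIndices .LSV k) ρ with hN
    -- The constant collects the Gauss quadrature error of `F v'` in degree 2k. The coefficient of
    -- degree 2k is that of `F` in degree k + 1 times k times that of `v` in degree k.
    refine ⟨k * integ 0 1 (N * N), mul_nonneg (Nat.cast_nonneg _) (integ_mul_self_nonneg N), fun F v c hF hv => ?_⟩
    have h1 : ∑ m ∈ Finset.univ.filter (fun m : Fin (k + 2) => m ≠ 0 ∧ m ≠ Fin.last (k + 1)),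
        refWeight .LSV ρ m * (derivative v).eval (ρ m) = v.eval 1 - v.eval 0 := by
      rw [← integ_derivative, ← refQuad_eq_of_degree_lt hρ]
      · rfl
      · rw [card_quadIndices_LSV]
        refine degree_le_natDegree.trans_lt ?_
        have := degree_derivative_lt_of_natDegree_le hk hv
        exact_mod_cast (by omega : (derivative v).natDegree < k)
    have h2 : ∑ m ∈ Finset.univ.filter (fun m : Fin (k + 2) => m ≠ 0 ∧ m ≠ Fin.last (k + 1)),
        refWeight .LSV ρ m * (F * derivative v).eval (ρ m) =
        integ 0 1 (F * derivative v) - F.coeff (k + 1) * (v.coeff k * k) * integ 0 1 (N * N) := by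
      have h3 := refQuad_LSV hρ (hdeg F v hF hv)
      have h4 : (F * derivative v).coeff (2 * k) = F.coeff (k + 1) * (v.coeff k * k) := by
        have h5 := coeff_mul_add_eq_of_natDegree_le hF (degree_derivative_lt_of_natDegree_le hk hv)
        rw [show k + 1 + (k - 1) = 2 * k by omega, coeff_derivative] at h5
        rw [h5, Nat.sub_add_cancel hk]
        have : (((k - 1 : ℕ) : ℝ) + 1) = k := by
          rw [Nat.cast_sub hk]
          simp
        rw [this]
      rw [h4] at h3
      exact h3
    rw [habel, h1, h2]
    ring
  | RRSV =>
    refine ⟨0, le_rfl, fun F v c hF hv => ?_⟩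
    have hlast : Fin.last (k + 1) ∉
        Finset.univ.filter (fun m : Fin (k + 2) => m ≠ 0 ∧ m ≠ Fin.last (k + 1)) := by simp
    have hins : quadIndices .RRSV k = insert (Fin.last (k + 1))
        (Finset.univ.filter (fun m : Fin (k + 2) => m ≠ 0 ∧ m ≠ Fin.last (k + 1))) := by
      ext m
      simp only [quadIndices, Finset.mem_filter, Finset.mem_univ, true_and, Finset.mem_insert]
      constructor
      · intro h
        by_cases h' : m = Fin.last (k + 1)
        · exact Or.inl h'
        · exact Or.inr ⟨h, h'⟩
      · rintro (h | h)
        · rw [h]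
          exact (Fin.last_pos (n := k)).ne'
        · exact h.1
    have h0 : ∀ p : ℝ[X], refQuad .RRSV ρ p = refWeight .RRSV ρ (Fin.last (k + 1)) * p.eval 1 +
        ∑ m ∈ Finset.univ.filter (fun m : Fin (k + 2) => m ≠ 0 ∧ m ≠ Fin.last (k + 1)),
          refWeight .RRSV ρ m * p.eval (ρ m) := fun p => by
      rw [refQuad, hins, Finset.sum_insert hlast, hρ.last]
    -- The test function jumps only at interior points, while the Radau rule also uses the end point
    -- 1. The missing weight enters v(1) - v(0) and the quadrature of `F v'` with the same factor
    -- F(1) v'(1) and cancels.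
    have h1 := h0 (derivative v)
    have h2 := h0 (F * derivative v)
    rw [refQuad_RRSV hk hρ ((degree_derivative_lt_of_natDegree_le hk hv).trans (by omega)), integ_derivative] at h1
    rw [refQuad_RRSV hk hρ (hdeg F v hF hv), eval_mul] at h2
    rw [habel]
    linear_combination (-F.eval 1) * h1 + h2

theorem refStar_add (v w : ℝ[X]) (j : Fin (k + 1)) : refStar s ρ (v + w) j = refStar s ρ v j + refStar s ρ w j := by
  simp only [refStar, derivative_add, eval_add, mul_add, Finset.sum_add_distrib]
  ring

theorem refStar_C_mul (c : ℝ) (v : ℝ[X]) (j : Fin (k + 1)) : refStar s ρ (C c * v) j = c * refStar s ρ v j := by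
  simp only [refStar, derivative_C_mul, eval_mul, eval_C, mul_add, Finset.mul_sum]
  congr 1
  exact Finset.sum_congr rfl fun m _ => by ring

theorem refPairing_add_right (f : ℝ → ℝ) (v w : ℝ[X]) :
    refPairing s ρ f (v + w) = refPairing s ρ f v + refPairing s ρ f w := by
  simp only [refPairing, refStar_add, add_mul, Finset.sum_add_distrib]

theorem refPairing_C_mul_right (f : ℝ → ℝ) (c : ℝ) (v : ℝ[X]) :
    refPairing s ρ f (C c * v) = c * refPairing s ρ f v := by
  simp only [refPairing, refStar_C_mul, Finset.mul_sum, mul_assoc]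

theorem refPairing_sum_right {ι : Type*} (S : Finset ι) (f : ℝ → ℝ) (v : ι → ℝ[X]) :
    refPairing s ρ f (∑ i ∈ S, v i) = ∑ i ∈ S, refPairing s ρ f (v i) := by
  have h0 : refPairing s ρ f 0 = 0 := by simpa using refPairing_C_mul_right (s := s) (ρ := ρ) f 0 0
  classical
  induction S using Finset.induction_on with
  | empty => simpa using h0
  | insert i S hi ih => rw [Finset.sum_insert hi, Finset.sum_insert hi, refPairing_add_right, ih]

theorem refPairing_add_left {f g : ℝ → ℝ} (hf : Continuous f) (hg : Continuous g) (v : ℝ[X]) :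
    refPairing s ρ (fun y => f y + g y) v = refPairing s ρ f v + refPairing s ρ g v := by
  simp only [refPairing, ← Finset.sum_add_distrib, ← mul_add]
  exact Finset.sum_congr rfl fun j _ => by
    rw [intervalIntegral.integral_add (hf.intervalIntegrable _ _) (hg.intervalIntegrable _ _)]

theorem refPairing_const_mul_left (c : ℝ) (f : ℝ → ℝ) (v : ℝ[X]) :
    refPairing s ρ (fun y => c * f y) v = c * refPairing s ρ f v := by
  simp only [refPairing, intervalIntegral.integral_const_mul, Finset.mul_sum]
  exact Finset.sum_congr rfl fun j _ => by ring

theorem refPairing_sub_left {f g : ℝ → ℝ} (hf : Continuous f) (hg : Continuous g) (v : ℝ[X]) :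
    refPairing s ρ (fun y => f y - g y) v = refPairing s ρ f v - refPairing s ρ g v := by
  simp only [refPairing, ← Finset.sum_sub_distrib, ← mul_sub]
  exact Finset.sum_congr rfl fun j _ => by
    rw [intervalIntegral.integral_sub (hf.intervalIntegrable _ _) (hg.intervalIntegrable _ _)]

theorem refPairing_C_right (hρ : IsReferencePoints s k ρ) {f : ℝ → ℝ} (hf : Continuous f) (c : ℝ) :
    refPairing s ρ f (C c) = c * ∫ y in (0 : ℝ)..1, f y := by
  have hp : ∀ x, HasDerivAt (fun x => ∫ y in (0 : ℝ)..x, f y) (f x) x := fun x =>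
    intervalIntegral.integral_hasDerivAt_right (hf.intervalIntegrable _ _)
      (hf.stronglyMeasurableAtFilter _ _) hf.continuousAt
  have h1 : ∀ α β : ℝ, ∫ y in α..β, f y = (∫ y in (0 : ℝ)..β, f y) - ∫ y in (0 : ℝ)..α, f y := fun α β =>
    (intervalIntegral.integral_interval_sub_left (hf.intervalIntegrable _ _) (hf.intervalIntegrable _ _)).symm
  have h2 := sum_partialSum_mul_sub c (fun _ : Fin (k + 2) => 0) (fun m => ∫ y in (0 : ℝ)..(ρ m), f y)
  simp only [Finset.sum_const_zero, add_zero, zero_mul, sub_zero, hρ.last, hρ.first,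
    intervalIntegral.integral_same, mul_zero] at h2
  rw [← h2, refPairing]
  exact Finset.sum_congr rfl fun j _ => by simp [refStar, h1 (ρ j.castSucc)]

/-- Both identities are instances of summation by parts: with `F` a primitive of `p` that vanishes
at 0, and with `F = p`, whose coefficient of degree k + 1 is zero. The pairing is thus a symmetric
positive form on polynomials of degree at most k, and the fluxes are those of the discontinuous
Galerkin method with exterior value `c`. -/
theorem exists_refPairing_eq (hk : 1 ≤ k) (hρ : IsReferencePoints s k ρ) :
    ∃ κ : ℝ, 0 ≤ κ ∧
      (∀ p v : ℝ[X], p.natDegree ≤ k → v.natDegree ≤ k →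
        refPairing s ρ (fun y => p.eval y) v = integ 0 1 (p * v) + κ * (p.coeff k * v.coeff k)) ∧
      ∀ (p v : ℝ[X]) (c : ℝ), p.natDegree ≤ k → v.natDegree ≤ k →
        ∑ j : Fin (k + 1), refStar s ρ v j * (p.eval (ρ j.succ) - if j = 0 then c else p.eval (ρ j.castSucc)) =
          p.eval 1 * v.eval 1 - c * v.eval 0 - integ 0 1 (p * derivative v) := by
  obtain ⟨κ, hκ, h⟩ := exists_sum_refStar_mul_sub hk hρ
  refine ⟨κ / (k + 1), by positivity, fun p v hp hv => ?_, fun p v c hp hv => ?_⟩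
  · set P : ℝ[X] := ∑ n ∈ Finset.range (k + 1), C (p.coeff n / (n + 1)) * X ^ (n + 1) with hP
    have hPd : derivative P = p := by
      rw [hP, derivative_sum]
      conv_rhs => rw [p.as_sum_range_C_mul_X_pow' (Nat.lt_succ_of_le hp)]
      refine Finset.sum_congr rfl fun n _ => ?_
      rw [derivative_C_mul, derivative_X_pow, ← mul_assoc, Nat.add_sub_cancel, ← C_mul]
      congr 2
      push_cast
      field_simp
    have hPn : P.natDegree ≤ k + 1 := natDegree_sum_le_of_forall_le _ _ fun n hn =>
      (natDegree_C_mul_X_pow_le _ _).trans (Finset.mem_range.1 hn)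
    have hP0 : P.eval 0 = 0 := by simp [hP, eval_finsetSum]
    have hPc : P.coeff (k + 1) = p.coeff k / (k + 1) := by
      have h1 := coeff_derivative P k
      rw [hPd] at h1
      rw [h1]
      field_simp
    have h1 := h P v 0 hPn hv
    have h2 : refPairing s ρ (fun y => p.eval y) v = ∑ j : Fin (k + 1), refStar s ρ v j *
        (P.eval (ρ j.succ) - if j = 0 then 0 else P.eval (ρ j.castSucc)) := by
      refine Finset.sum_congr rfl fun j _ => ?_
      have h3 := integ_derivative (ρ j.castSucc) (ρ j.succ) P
      rw [hPd, integ_apply] at h3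
      rw [h3]
      congr 2
      split_ifs with hj
      · rw [hj, Fin.castSucc_zero, hρ.first, hP0]
      · rfl
    have h4 := integ_derivative_mul 0 1 P v
    rw [hPd, hP0] at h4
    rw [h2, h1, hPc, h4]
    ring
  · have := h p v c (hp.trans k.le_succ) hv
    rw [coeff_eq_zero_of_natDegree_lt (Nat.lt_succ_of_le hp)] at this
    rw [this]
    ring

theorem exists_abs_refPairing_le (hρ : IsReferencePoints s k ρ) :
    ∃ K : ℝ, 0 < K ∧ ∀ (f : ℝ → ℝ) (S : ℝ) (v : ℝ[X]), v.natDegree ≤ k → (∀ y ∈ Icc (0 : ℝ) 1, |f y| ≤ S) →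
      |refPairing s ρ f v| ≤ K * S * cnorm k v := by
  set K₀ : ℝ := ∑ j : Fin (k + 1), (1 + ∑ m ∈ Finset.univ.filter (fun m : Fin (k + 2) => m ≠ 0 ∧ m.val ≤ j.val),
    |refWeight s ρ m| * k.factorial) with hK₀
  have hpos : ∀ j : Fin (k + 1), 0 ≤ ∑ m ∈ Finset.univ.filter (fun m : Fin (k + 2) => m ≠ 0 ∧ m.val ≤ j.val),
    |refWeight s ρ m| * k.factorial := fun j => Finset.sum_nonneg fun m _ => by positivity
  refine ⟨K₀, Finset.sum_pos (fun j _ => by linarith [hpos j]) ⟨0, Finset.mem_univ _⟩, fun f S v hv hf => ?_⟩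
  have hS : 0 ≤ S := (abs_nonneg _).trans (hf 0 (by simp))
  rw [refPairing, hK₀, Finset.sum_mul, Finset.sum_mul]
  refine (Finset.abs_sum_le_sum_abs _ _).trans (Finset.sum_le_sum fun j _ => ?_)
  have h1 : |refStar s ρ v j| ≤ (1 + ∑ m ∈ Finset.univ.filter (fun m : Fin (k + 2) => m ≠ 0 ∧ m.val ≤ j.val),
      |refWeight s ρ m| * k.factorial) * cnorm k v := by
    rw [add_mul, one_mul, Finset.sum_mul]
    refine (abs_add_le _ _).trans (add_le_add (abs_eval_le hv (by simp)) ?_)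
    refine (Finset.abs_sum_le_sum_abs _ _).trans (Finset.sum_le_sum fun m _ => ?_)
    rw [abs_mul, mul_assoc]
    exact mul_le_mul_of_nonneg_left (abs_eval_iterate_derivative_le hv 1 (hρ.mem_Icc m)) (abs_nonneg _)
  have h2 : |∫ y in (ρ j.castSucc)..(ρ j.succ), f y| ≤ S := by
    have hle : ρ j.castSucc ≤ ρ j.succ := hρ.strictMono.monotone (Fin.castSucc_le_succ j)
    have h3 := intervalIntegral.norm_integral_le_of_norm_le_const (f := f) (C := S) (a := ρ j.castSucc)
      (b := ρ j.succ) fun y hy => by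
        rw [uIoc_of_le hle] at hy
        exact hf y ⟨(hρ.mem_Icc _).1.trans hy.1.le, hy.2.trans (hρ.mem_Icc _).2⟩
    have h4 : |ρ j.succ - ρ j.castSucc| ≤ 1 := by
      rw [abs_of_nonneg (by linarith)]
      linarith [(hρ.mem_Icc j.succ).2, (hρ.mem_Icc j.castSucc).1]
    calc _ ≤ S * |ρ j.succ - ρ j.castSucc| := h3
      _ ≤ S * 1 := mul_le_mul_of_nonneg_left h4 hS
      _ = S := mul_one S
  rw [abs_mul]
  calc _ ≤ ((1 + ∑ m ∈ Finset.univ.filter (fun m : Fin (k + 2) => m ≠ 0 ∧ m.val ≤ j.val),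
      |refWeight s ρ m| * k.factorial) * cnorm k v) * S :=
        mul_le_mul h1 h2 (abs_nonneg _) (mul_nonneg (by linarith [hpos j]) (cnorm_nonneg _ _))
    _ = _ := by ring

end Reference

end OFSV

/-! ### Taylor expansion, interpolation errors and correction functions on the reference cell. -/

namespace OFSV

/-- Taylor's formula with a perturbed leading coefficient. -/
theorem abs_sub_taylor_le (n : ℕ) {Φ : ℝ → ℝ} (hΦ : ContDiff ℝ n Φ) (x s Q ε : ℝ)
    (h : ∀ y ∈ uIcc x (x + s), |iteratedDeriv n Φ y - Q| ≤ ε) :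
    |Φ (x + s) - ∑ m ∈ Finset.range n, iteratedDeriv m Φ x * s ^ m / m.factorial - Q * s ^ n / n.factorial| ≤
      ε * |s| ^ n := by
  induction n generalizing Φ s with
  | zero => simpa using h (x + s) right_mem_uIcc
  | succ n ih =>
    have hΦ' : ContDiff ℝ n (deriv Φ) := ((contDiff_succ_iff_deriv (n := n)).1 (by exact_mod_cast hΦ)).2.2
    have hdiff : Differentiable ℝ Φ := hΦ.differentiable (by simp)
    have hε : 0 ≤ ε := (abs_nonneg _).trans (h x left_mem_uIcc)
    set R : ℝ → ℝ := fun r => Φ (x + r) - ∑ m ∈ Finset.range (n + 1), iteratedDeriv m Φ x * r ^ m / m.factorial -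
      Q * r ^ (n + 1) / (n + 1).factorial with hR
    set R' : ℝ → ℝ := fun r => deriv Φ (x + r) -
      ∑ m ∈ Finset.range n, iteratedDeriv m (deriv Φ) x * r ^ m / m.factorial - Q * r ^ n / n.factorial with hR'
    have hder : ∀ r, HasDerivAt R (R' r) r := by
      intro r
      have h1 : HasDerivAt (fun r => Φ (x + r)) (deriv Φ (x + r)) r := by
        exact (hdiff (x + r)).hasDerivAt.comp_const_add x r
      have hmon : ∀ (q : ℝ) (m : ℕ), HasDerivAt (fun r => q * r ^ (m + 1) / (m + 1).factorial)
          (q * r ^ m / m.factorial) r := fun q m => by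
        have h2 := ((hasDerivAt_pow (m + 1) r).const_mul q).div_const ((m + 1).factorial : ℝ)
        refine h2.congr_deriv ?_
        rw [Nat.factorial_succ, Nat.add_sub_cancel]
        push_cast
        have : (m.factorial : ℝ) ≠ 0 := by exact_mod_cast m.factorial_ne_zero
        field_simp
      have h2 : HasDerivAt (fun r => ∑ m ∈ Finset.range (n + 1), iteratedDeriv m Φ x * r ^ m / m.factorial)
          (∑ m ∈ Finset.range n, iteratedDeriv m (deriv Φ) x * r ^ m / m.factorial) r := by
        simp only [Finset.sum_range_succ' _ n, pow_zero]
        refine HasDerivAt.add_const _ (HasDerivAt.fun_sum fun m _ => ?_)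
        rw [← iteratedDeriv_succ']
        exact hmon _ m
      exact (h1.sub h2).sub (hmon Q n)
    have hbound : ∀ r ∈ uIcc 0 s, ‖R' r‖ ≤ ε * |s| ^ n := by
      intro r hr
      have hr' : |r| ≤ |s| := by simpa using abs_sub_left_of_mem_uIcc hr
      refine (ih hΦ' r fun y hy => ?_).trans
        (mul_le_mul_of_nonneg_left (pow_le_pow_left₀ (abs_nonneg _) hr' n) hε)
      rw [← iteratedDeriv_succ']
      refine h y ?_
      rcases Set.mem_uIcc.1 hr with h1 | h1 <;> rcases Set.mem_uIcc.1 hy with h2 | h2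
      · exact Set.mem_uIcc.2 (Or.inl ⟨h2.1, by linarith⟩)
      · exact Set.mem_uIcc.2 (Or.inl ⟨by linarith, by linarith⟩)
      · exact Set.mem_uIcc.2 (Or.inr ⟨by linarith, by linarith⟩)
      · exact Set.mem_uIcc.2 (Or.inr ⟨by linarith, by linarith⟩)
    have hmv := (convex_uIcc 0 s).norm_image_sub_le_of_norm_hasDerivWithin_le
      (fun r _ => (hder r).hasDerivWithinAt) hbound left_mem_uIcc right_mem_uIcc
    have h0 : R 0 = 0 := by
      simp [hR, Finset.sum_range_succ']
    rw [h0, sub_zero, sub_zero, Real.norm_eq_abs, Real.norm_eq_abs, mul_assoc, ← pow_succ] at hmv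
    exact hmv

section Reference

variable {s : Scheme} {k : ℕ} {ρ : Fin (k + 2) → ℝ}

/-- Interpolation on the reference cell. -/
def refInterp (ρ : Fin (k + 2) → ℝ) (f : ℝ → ℝ) : ℝ[X] :=
  Lagrange.interpolate Finset.univ (fun j : Fin (k + 1) => ρ j.succ) (fun j : Fin (k + 1) => f (ρ j.succ))

theorem IsReferencePoints.injOn_succ (hρ : IsReferencePoints s k ρ) :
    Set.InjOn (fun j : Fin (k + 1) => ρ j.succ) (Finset.univ : Finset (Fin (k + 1))) :=
  (hρ.strictMono.injective.comp (Fin.succ_injective _)).injOn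

theorem natDegree_refInterp_le (hρ : IsReferencePoints s k ρ) (f : ℝ → ℝ) : (refInterp ρ f).natDegree ≤ k := by
  refine natDegree_le_of_degree_le ((Lagrange.degree_interpolate_le _ hρ.injOn_succ).trans ?_)
  simp

theorem eval_refInterp (hρ : IsReferencePoints s k ρ) (f : ℝ → ℝ) (j : Fin (k + 1)) :
    (refInterp ρ f).eval (ρ j.succ) = f (ρ j.succ) :=
  Lagrange.eval_interpolate_at_node (v := fun j : Fin (k + 1) => ρ j.succ) (r := fun j : Fin (k + 1) => f (ρ j.succ))
    hρ.injOn_succ (Finset.mem_univ j)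

theorem eval_refInterp_one (hρ : IsReferencePoints s k ρ) (f : ℝ → ℝ) : (refInterp ρ f).eval 1 = f 1 := by
  have := eval_refInterp hρ f (Fin.last k)
  rwa [Fin.succ_last, hρ.last] at this

theorem eq_refInterp (hρ : IsReferencePoints s k ρ) {p : ℝ[X]} (hp : p.natDegree ≤ k) {f : ℝ → ℝ}
    (h : ∀ j : Fin (k + 1), p.eval (ρ j.succ) = f (ρ j.succ)) : p = refInterp ρ f := by
  refine Lagrange.eq_interpolate_of_eval_eq _ hρ.injOn_succ ?_ fun j _ => h j
  rw [Finset.card_univ, Fintype.card_fin]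
  exact degree_le_natDegree.trans_lt (by exact_mod_cast Nat.lt_succ_of_le hp)

theorem refInterp_eq_sum (f : ℝ → ℝ) : refInterp ρ f = ∑ j : Fin (k + 1), C (f (ρ j.succ)) *
    Lagrange.basis Finset.univ (fun j : Fin (k + 1) => ρ j.succ) j := by
  rw [refInterp, Lagrange.interpolate_apply]

/-- Interpolation reproduces `p` and is bounded by the values at the nodes; the constant plays the
part of a Lebesgue constant for the coefficient norm. -/
theorem exists_cnorm_refInterp_sub_le (hρ : IsReferencePoints s k ρ) :
    ∃ K : ℝ, 0 < K ∧ ∀ (f : ℝ → ℝ) (p : ℝ[X]) (ε : ℝ), p.natDegree ≤ k →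
      (∀ y ∈ Icc (0 : ℝ) 1, |f y - p.eval y| ≤ ε) → cnorm k (refInterp ρ f - p) ≤ K * ε := by
  set ℓ : Fin (k + 1) → ℝ[X] := Lagrange.basis Finset.univ (fun j : Fin (k + 1) => ρ j.succ) with hℓ
  have h0 : 0 ≤ ∑ j, cnorm k (ℓ j) := Finset.sum_nonneg fun _ _ => cnorm_nonneg _ _
  refine ⟨1 + ∑ j, cnorm k (ℓ j), by linarith, fun f p ε hp h => ?_⟩
  have hε : 0 ≤ ε := (abs_nonneg _).trans (h 0 (by simp))
  have h1 : refInterp ρ f - p = ∑ j : Fin (k + 1), C (f (ρ j.succ) - p.eval (ρ j.succ)) * ℓ j := by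
    conv_lhs => rw [eq_refInterp hρ hp (f := fun y => p.eval y) fun j => rfl]
    rw [refInterp_eq_sum, refInterp_eq_sum, ← Finset.sum_sub_distrib]
    exact Finset.sum_congr rfl fun j _ => by rw [C_sub, sub_mul]
  rw [h1]
  refine (cnorm_sum_le _ _ _).trans ?_
  calc _ ≤ ∑ j, ε * cnorm k (ℓ j) := Finset.sum_le_sum fun j _ => by
        rw [cnorm_C_mul]
        exact mul_le_mul_of_nonneg_right (h _ (hρ.mem_Icc _)) (cnorm_nonneg _ _)
    _ ≤ _ := by rw [← Finset.mul_sum]; linarith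

/-- The error of interpolation of the monomial of degree `k + 1` on the reference cell. -/
def refError (ρ : Fin (k + 2) → ℝ) : ℝ[X] := refInterp ρ (fun y => y ^ (k + 1)) - X ^ (k + 1)

theorem refError_eq_neg (hρ : IsReferencePoints s k ρ) {P : ℝ[X]} (hP : P.Monic) (hd : P.natDegree = k + 1)
    (hz : ∀ j : Fin (k + 1), P.eval (ρ j.succ) = 0) : refError ρ = -P := by
  have h1 : (X ^ (k + 1) - P).natDegree ≤ k := by
    have h2 : (X ^ (k + 1) - P : ℝ[X]).degree < (X ^ (k + 1) : ℝ[X]).degree := by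
      refine degree_sub_lt_left ?_ (pow_ne_zero _ X_ne_zero) ?_
      · rw [degree_X_pow, degree_eq_natDegree hP.ne_zero, hd]
      · rw [leadingCoeff_X_pow, hP.leadingCoeff]
    rw [degree_X_pow] at h2
    exact natDegree_le_of_degree_le (Order.le_of_lt_succ h2)
  have h2 := eq_refInterp hρ h1 (f := fun y => y ^ (k + 1)) fun j => by simp [hz j]
  rw [refError, ← h2]
  ring

/-- Up to sign `refError` is the monic polynomial vanishing at all k + 1 interpolation points. For
Radau points this is the nodal polynomial of the quadrature, orthogonal to constants. For Gauss
points it has the additional factor X - 1 of degree one, and orthogonality to degrees below k then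
needs k ≥ 2. The vanishing mean makes the correction equation solvable and removes the leading error
from cell averages. -/
theorem integ_refError (hρ : IsReferencePoints s k ρ) (hk : 1 ≤ k) (hkL : s = Scheme.LSV → 2 ≤ k) :
    integ 0 1 (refError ρ) = 0 := by
  have hmon : (Lagrange.nodal (quadIndices s k) ρ).Monic := Lagrange.nodal_monic
  cases s with
  | LSV =>
    rw [refError_eq_neg hρ (P := Lagrange.nodal (quadIndices .LSV k) ρ * (X - C 1)) (hmon.mul (monic_X_sub_C 1)),
      map_neg, integ_nodal_mul hρ, neg_zero]
    · rw [degree_X_sub_C]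
      exact_mod_cast hkL rfl
    · rw [hmon.natDegree_mul (monic_X_sub_C 1), natDegree_nodal_LSV, natDegree_X_sub_C]
    · intro j
      rw [eval_mul]
      rcases eq_or_ne j (Fin.last k) with rfl | h
      · rw [Fin.succ_last, hρ.last]
        simp
      · rw [Lagrange.eval_nodal_at_node, zero_mul]
        simp only [quadIndices, Finset.mem_filter, Finset.mem_univ, true_and]
        refine ⟨Fin.succ_ne_zero j, fun h' => h ?_⟩
        rwa [← Fin.succ_last, Fin.succ_inj] at h'
  | RRSV =>
    rw [refError_eq_neg hρ hmon, map_neg, ← mul_one (Lagrange.nodal (quadIndices .RRSV k) ρ), integ_nodal_mul hρ,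
      neg_zero]
    · rw [degree_one]
      exact_mod_cast hk
    · rw [Lagrange.natDegree_nodal, card_quadIndices_RRSV]
    · intro j
      exact Lagrange.eval_nodal_at_node (by simp [quadIndices, Fin.succ_ne_zero])

/-- Leading term of the interpolation error on a cell `[x, x + h]`. -/
theorem exists_refInterp_expansion (hρ : IsReferencePoints s k ρ) :
    ∃ K : ℝ, 0 < K ∧ ∀ (Φ : ℝ → ℝ) (x h Q ε : ℝ), ContDiff ℝ (k + 1 : ℕ) Φ → 0 ≤ h →
      (∀ z ∈ Icc x (x + h), |iteratedDeriv (k + 1) Φ z - Q| ≤ ε) → ∀ y ∈ Icc (0 : ℝ) 1,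
      |(refInterp ρ fun y => Φ (x + h * y)).eval y - Φ (x + h * y) -
        h ^ (k + 1) * Q / (k + 1).factorial * (refError ρ).eval y| ≤ K * (h ^ (k + 1) * ε) := by
  obtain ⟨K, hK0, hK⟩ := exists_cnorm_refInterp_sub_le hρ
  refine ⟨K + 1, by linarith, fun Φ x h Q ε hΦ hh hosc y hy => ?_⟩
  have hε : 0 ≤ ε := (abs_nonneg _).trans (hosc x ⟨le_rfl, by linarith⟩)
  set c := h ^ (k + 1) * Q / (k + 1).factorial with hc
  set p : ℝ[X] := ∑ m ∈ Finset.range (k + 1), C (iteratedDeriv m Φ x * h ^ m / m.factorial) * X ^ m with hp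
  have hpd : p.natDegree ≤ k := natDegree_sum_le_of_forall_le _ _ fun n hn =>
    (natDegree_C_mul_X_pow_le _ _).trans (Nat.lt_succ_iff.1 (Finset.mem_range.1 hn))
  have hrem : ∀ y ∈ Icc (0 : ℝ) 1, |Φ (x + h * y) - p.eval y - c * y ^ (k + 1)| ≤ h ^ (k + 1) * ε := by
    intro y hy
    have hhy : 0 ≤ h * y := mul_nonneg hh hy.1
    have hhy' : h * y ≤ h := mul_le_of_le_one_right hh hy.2
    have h1 := abs_sub_taylor_le (k + 1) hΦ x (h * y) Q ε fun z hz => by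
      rw [uIcc_of_le (by linarith)] at hz
      exact hosc z ⟨hz.1, hz.2.trans (by linarith)⟩
    have h2 : p.eval y = ∑ m ∈ Finset.range (k + 1), iteratedDeriv m Φ x * (h * y) ^ m / m.factorial := by
      rw [hp, eval_finsetSum]
      refine Finset.sum_congr rfl fun m _ => ?_
      simp only [eval_mul, eval_C, eval_pow, eval_X, mul_pow]
      ring
    have h3 : c * y ^ (k + 1) = Q * (h * y) ^ (k + 1) / (k + 1).factorial := by
      rw [hc, mul_pow]
      ring
    rw [h2, h3]
    refine h1.trans ?_
    rw [mul_comm, abs_of_nonneg hhy]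
    exact mul_le_mul_of_nonneg_right (pow_le_pow_left₀ hhy hhy' _) hε
  -- The Taylor polynomial is reproduced by interpolation and the term of degree k + 1 produces `c`
  -- times `refError`. What remains is the interpolation error of the Taylor remainder.
  set q : ℝ[X] := p + C c * refInterp ρ (fun y => y ^ (k + 1)) with hq
  have hqd : q.natDegree ≤ k := (natDegree_add_le _ _).trans (max_le hpd
    ((natDegree_C_mul_le _ _).trans (natDegree_refInterp_le hρ _)))
  have hsub : refInterp ρ (fun y => Φ (x + h * y)) - q =
      refInterp ρ (fun y => Φ (x + h * y) - p.eval y - c * y ^ (k + 1)) := by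
    refine eq_refInterp hρ ((natDegree_sub_le _ _).trans (max_le (natDegree_refInterp_le hρ _) hqd)) fun j => ?_
    rw [eval_sub, hq, eval_add, eval_mul, eval_C, eval_refInterp hρ, eval_refInterp hρ]
    ring
  have h1 := hK (fun y => Φ (x + h * y) - p.eval y - c * y ^ (k + 1)) 0 (h ^ (k + 1) * ε) (by simp) fun y hy => by
    simpa using hrem y hy
  rw [sub_zero, ← hsub] at h1
  have h2 := (abs_eval_le ((natDegree_sub_le _ _).trans (max_le (natDegree_refInterp_le hρ _) hqd)) hy).trans h1
  have h3 := hrem y hy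
  have h4 : (refInterp ρ fun y => Φ (x + h * y)).eval y - Φ (x + h * y) - c * (refError ρ).eval y =
      (refInterp ρ (fun y => Φ (x + h * y)) - q).eval y - (Φ (x + h * y) - p.eval y - c * y ^ (k + 1)) := by
    rw [refError, hq]
    simp only [eval_sub, eval_add, eval_mul, eval_C, eval_pow, eval_X]
    ring
  rw [h4]
  refine (abs_sub _ _).trans ?_
  linarith

/-- Derivatives of the interpolant at a point of the reference cell. -/
theorem exists_abs_iterate_derivative_refInterp_le (hρ : IsReferencePoints s k ρ) :
    ∃ K : ℝ, 0 < K ∧ ∀ (Φ : ℝ → ℝ) (x h ε : ℝ), ContDiff ℝ (k + 1 : ℕ) Φ → 0 ≤ h →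
      (∀ z ∈ Icc x (x + h), |iteratedDeriv (k + 1) Φ z| ≤ ε) → ∀ y₀ ∈ Icc (0 : ℝ) 1, ∀ l ≤ k,
      |(derivative^[l] (refInterp ρ fun y => Φ (x + h * y))).eval y₀ - h ^ l * iteratedDeriv l Φ (x + h * y₀)| ≤
        K * (h ^ (k + 1) * ε) := by
  obtain ⟨K, hK0, hK⟩ := exists_cnorm_refInterp_sub_le hρ
  refine ⟨k.factorial * K, by positivity, fun Φ x h ε hΦ hh hosc y₀ hy₀ l hl => ?_⟩
  have hε : 0 ≤ ε := (abs_nonneg _).trans (hosc x ⟨le_rfl, by linarith⟩)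
  -- The expansion is taken at the evaluation point `y₀` itself, so that the l-th derivative of `p`
  -- there is exactly h^l times that of `Φ`.
  set p : ℝ[X] := ∑ m ∈ Finset.range (k + 1),
    C (iteratedDeriv m Φ (x + h * y₀) * h ^ m / m.factorial) * (X - C y₀) ^ m with hp
  have hpd : p.natDegree ≤ k := natDegree_sum_le_of_forall_le _ _ fun n hn => by
    refine (natDegree_C_mul_le _ _).trans ?_
    rw [(monic_X_sub_C y₀).natDegree_pow, natDegree_X_sub_C, mul_one]
    exact Nat.lt_succ_iff.1 (Finset.mem_range.1 hn)
  have hrem : ∀ y ∈ Icc (0 : ℝ) 1, |Φ (x + h * y) - p.eval y| ≤ h ^ (k + 1) * ε := by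
    intro y hy
    have h1 := abs_sub_taylor_le (k + 1) hΦ (x + h * y₀) (h * (y - y₀)) 0 ε fun z hz => by
      rw [sub_zero]
      refine hosc z ?_
      have e1 : h * y ≤ h := mul_le_of_le_one_right hh hy.2
      have e2 : h * y₀ ≤ h := mul_le_of_le_one_right hh hy₀.2
      have e3 : 0 ≤ h * y := mul_nonneg hh hy.1
      have e4 : 0 ≤ h * y₀ := mul_nonneg hh hy₀.1
      rcases Set.mem_uIcc.1 hz with h2 | h2 <;> constructor <;> nlinarith [h2.1, h2.2]
    have h2 : p.eval y = ∑ m ∈ Finset.range (k + 1),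
        iteratedDeriv m Φ (x + h * y₀) * (h * (y - y₀)) ^ m / m.factorial := by
      rw [hp, eval_finsetSum]
      refine Finset.sum_congr rfl fun m _ => ?_
      simp only [eval_mul, eval_C, eval_pow, eval_X, eval_sub, mul_pow]
      ring
    have h3 : x + h * y₀ + h * (y - y₀) = x + h * y := by ring
    rw [h3, zero_mul, zero_div, sub_zero, ← h2] at h1
    refine h1.trans ?_
    rw [mul_comm]
    refine mul_le_mul_of_nonneg_right (pow_le_pow_left₀ (abs_nonneg _) ?_ _) hε
    rw [abs_mul, abs_of_nonneg hh]
    refine mul_le_of_le_one_right hh (abs_sub_le_iff.2 ⟨?_, ?_⟩) <;> linarith [hy.1, hy.2, hy₀.1, hy₀.2]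
  have h1 := hK _ p _ hpd hrem
  have h2 : (derivative^[l] p).eval y₀ = h ^ l * iteratedDeriv l Φ (x + h * y₀) := by
    rw [hp, iterate_derivative_sum, eval_finsetSum, Finset.sum_eq_single l]
    · rw [iterate_derivative_C_mul, iterate_derivative_X_sub_pow_self, eval_mul, eval_C]
      have : (l.factorial : ℝ) ≠ 0 := by exact_mod_cast l.factorial_ne_zero
      rw [eval_natCast]
      field_simp
    · intro m _ hml
      rw [iterate_derivative_C_mul, iterate_derivative_X_sub_pow, eval_mul]
      rcases lt_or_gt_of_ne hml with h3 | h3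
      · simp [Nat.descFactorial_of_lt h3]
      · simp [Nat.sub_ne_zero_of_lt h3]
    · intro h3
      exact absurd (Finset.mem_range.2 (Nat.lt_succ_of_le hl)) h3
  rw [← h2, ← eval_sub, ← iterate_derivative_sub, mul_assoc]
  exact (abs_eval_iterate_derivative_le ((natDegree_sub_le _ _).trans
    (max_le (natDegree_refInterp_le hρ _) hpd)) l hy₀).trans
    (mul_le_mul_of_nonneg_left h1 (Nat.cast_nonneg _))

/-- The interpolant is linear up to terms of second order. -/
theorem exists_cnorm_refInterp_sub_linear_le (hρ : IsReferencePoints s k ρ) (hk : 1 ≤ k) :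
    ∃ K : ℝ, 0 < K ∧ ∀ (Φ : ℝ → ℝ) (x h ε : ℝ), ContDiff ℝ (2 : ℕ) Φ → 0 ≤ h →
      (∀ z ∈ Icc x (x + h), |iteratedDeriv 2 Φ z| ≤ ε) →
      cnorm k (refInterp ρ (fun y => Φ (x + h * y)) - (C (Φ x) + C (h * deriv Φ x) * X)) ≤ K * (h ^ 2 * ε) := by
  obtain ⟨K, hK0, hK⟩ := exists_cnorm_refInterp_sub_le hρ
  refine ⟨K, hK0, fun Φ x h ε hΦ hh hosc => ?_⟩
  have hε : 0 ≤ ε := (abs_nonneg _).trans (hosc x ⟨le_rfl, by linarith⟩)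
  refine hK _ _ _ ?_ fun y hy => ?_
  · refine (natDegree_add_le _ _).trans (max_le (by simp) ((natDegree_C_mul_le _ _).trans ?_))
    simpa using hk
  · have hhy : 0 ≤ h * y := mul_nonneg hh hy.1
    have hhy' : h * y ≤ h := mul_le_of_le_one_right hh hy.2
    have h1 := abs_sub_taylor_le 2 hΦ x (h * y) 0 ε fun z hz => by
      rw [uIcc_of_le (by linarith)] at hz
      rw [sub_zero]
      exact hosc z ⟨hz.1, hz.2.trans (by linarith)⟩
    have h2 : Φ (x + h * y) - eval y (C (Φ x) + C (h * deriv Φ x) * X) =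
        Φ (x + h * y) - ∑ m ∈ Finset.range 2, iteratedDeriv m Φ x * (h * y) ^ m / m.factorial -
          0 * (h * y) ^ 2 / Nat.factorial 2 := by
      simp [Finset.sum_range_succ, iteratedDeriv_one]
      ring
    rw [h2]
    refine h1.trans ?_
    rw [mul_comm, abs_of_nonneg hhy]
    exact mul_le_mul_of_nonneg_right (pow_le_pow_left₀ hhy hhy' _) hε

/-! ### Correction functions on the reference cell -/

/-- The moments of degree less than `k` and the value at the right end point. -/
def correctionData (k : ℕ) : ℝ[X] →ₗ[ℝ] (Fin (k + 1) → ℝ) :=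
  LinearMap.pi fun m => if m.val < k then (integ 0 1).comp (LinearMap.mulRight ℝ (X ^ (m : ℕ))) else leval 1

theorem correctionData_apply (k : ℕ) (p : ℝ[X]) (m : Fin (k + 1)) :
    correctionData k p m = if m.val < k then integ 0 1 (p * X ^ (m : ℕ)) else p.eval 1 := by
  simp only [correctionData, LinearMap.pi_apply]
  split_ifs <;> rfl

/-- Since p(1) = 0, p = (X - 1) r with r of degree at most k - 1. As p is orthogonal to r, the
integral of (1 - X) r² vanishes. -/
theorem eq_zero_of_correctionData (hk : 1 ≤ k) {p : ℝ[X]} (hp : p.natDegree ≤ k) (h : correctionData k p = 0) :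
    p = 0 := by
  have h1 : p.eval 1 = 0 := by
    have := congrFun h (Fin.last k)
    simpa [correctionData_apply] using this
  obtain ⟨r, hr⟩ := dvd_iff_isRoot.2 h1
  by_cases hr0 : r = 0
  · rw [hr, hr0, mul_zero]
  have hrd : r.natDegree ≤ k - 1 := by
    rw [hr, (monic_X_sub_C (1 : ℝ)).natDegree_mul' hr0, natDegree_X_sub_C] at hp
    omega
  have h2 : integ 0 1 (p * r) = 0 := by
    rw [integ_mul_eq_sum p hrd]
    refine Finset.sum_eq_zero fun n hn => ?_
    have hn' : n < k := by
      have := Finset.mem_range.1 hn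
      omega
    have := congrFun h ⟨n, hn'.trans k.lt_succ_self⟩
    rw [correctionData_apply, if_pos hn'] at this
    simp only [Pi.zero_apply] at this
    rw [this, mul_zero]
  exfalso
  apply hr0
  refine eq_zero_of_integ_mul_self (w := 1 - X) (fun x hx => by simpa using hx.2) ?_
  have h3 : (1 - X) * (r * r) = -(p * r) := by
    rw [hr, C_1]
    ring
  rw [h3, map_neg, h2, neg_zero]

theorem exists_cnorm_le_of_moments (hk : 1 ≤ k) :
    ∃ K : ℝ, 0 < K ∧ ∀ (p : ℝ[X]) (S : ℝ), p.natDegree ≤ k → p.eval 1 = 0 → 0 ≤ S →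
      (∀ m < k, |integ 0 1 (p * X ^ m)| ≤ S) → cnorm k p ≤ K * S := by
  obtain ⟨K, hK0, hK⟩ := exists_cnorm_le k (correctionData k) fun p hp h => eq_zero_of_correctionData hk hp h
  refine ⟨K, hK0, fun p S hp h1 hS h => (hK p hp).trans (mul_le_mul_of_nonneg_left ?_ hK0.le)⟩
  refine (pi_norm_le_iff_of_nonneg hS).2 fun m => ?_
  rw [correctionData_apply]
  split_ifs with hm
  · exact h m hm
  · rw [h1, norm_zero]
    exact hS

/-- The derivatives of the admissible `v` are all polynomials of degree less than k, so the equation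
prescribes the first k moments of `Z`, and the value at 1 is the remaining datum. Constant `v` make
the left side zero; there the mean of `f` has to vanish. -/
theorem exists_correction (hk : 1 ≤ k) (hρ : IsReferencePoints s k ρ) {f : ℝ → ℝ} (hf : Continuous f)
    (h0 : ∫ y in (0 : ℝ)..1, f y = 0) :
    ∃ Z : ℝ[X], Z.natDegree ≤ k ∧ Z.eval 1 = 0 ∧
      ∀ v : ℝ[X], v.natDegree ≤ k → integ 0 1 (Z * derivative v) = refPairing s ρ f v := by
  obtain ⟨Z, hZ, hZe⟩ := exists_natDegree_le_eq k (correctionData k)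
    (fun p hp h => eq_zero_of_correctionData hk hp h)
    fun m => if m.val < k then refPairing s ρ f (C (1 / ((m : ℝ) + 1)) * X ^ (m.val + 1)) else 0
  refine ⟨Z, hZ, ?_, fun v hv => ?_⟩
  · have := congrFun hZe (Fin.last k)
    simpa [correctionData_apply] using this
  · have h1 : ∀ n < k, integ 0 1 (Z * X ^ n) = refPairing s ρ f (C (1 / ((n : ℝ) + 1)) * X ^ (n + 1)) := fun n hn => by
      have := congrFun hZe ⟨n, hn.trans k.lt_succ_self⟩
      rw [correctionData_apply, if_pos hn] at this
      rw [this, if_pos hn]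
    conv_lhs => rw [v.as_sum_range_C_mul_X_pow' (Nat.lt_succ_of_le hv)]
    conv_rhs => rw [v.as_sum_range_C_mul_X_pow' (Nat.lt_succ_of_le hv)]
    rw [derivative_sum, Finset.mul_sum, map_sum, refPairing_sum_right, Finset.sum_range_succ',
      Finset.sum_range_succ']
    have h2 : refPairing s ρ f (C (v.coeff 0) * X ^ 0) = 0 := by
      rw [pow_zero, mul_one, refPairing_C_right hρ hf, h0, mul_zero]
    rw [h2]
    simp only [pow_zero, mul_one, derivative_C, mul_zero, map_zero, add_zero]
    refine Finset.sum_congr rfl fun n hn => ?_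
    have h3 : (n : ℝ) + 1 ≠ 0 := by positivity
    rw [derivative_C_mul, derivative_X_pow, Nat.add_sub_cancel, mul_left_comm, mul_left_comm Z, integ_C_mul,
      integ_C_mul, h1 n (Finset.mem_range.1 hn), refPairing_C_mul_right, refPairing_C_mul_right]
    push_cast
    field_simp

end Reference

end OFSV

/-! ### Geometry of the mesh and cyclic neighbours. -/

namespace OFSV

namespace Mesh

variable {a b : ℝ} (M : Mesh a b)

theorem len_pos (i : Fin M.N) : 0 < M.len i := sub_pos.2 (M.strictMono (Fin.castSucc_lt_succ))

theorem left_add_len (i : Fin M.N) : M.left i + M.len i = M.right i := by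
  rw [len]
  ring

theorem a_le_left (i : Fin M.N) : a ≤ M.left i := by
  exact M.node_first.ge.trans (M.strictMono.monotone (Fin.zero_le _))

theorem right_le_b (i : Fin M.N) : M.right i ≤ b := by
  exact (M.strictMono.monotone (Fin.le_last _)).trans M.node_last.le

theorem mem_Icc_of_mem_unit (i : Fin M.N) {y : ℝ} (hy : y ∈ Icc (0 : ℝ) 1) :
    M.left i + M.len i * y ∈ Icc (M.left i) (M.right i) := by
  have h := M.len_pos i
  have h1 := M.left_add_len i
  constructor
  · linarith [mul_nonneg h.le hy.1]
  · linarith [mul_le_of_le_one_right h.le hy.2]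

theorem mem_Icc_of_mem_cell (i : Fin M.N) {x : ℝ} (hx : x ∈ Icc (M.left i) (M.right i)) : x ∈ Icc a b :=
  ⟨(M.a_le_left i).trans hx.1, hx.2.trans (M.right_le_b i)⟩

theorem len_le_size (i : Fin M.N) : M.len i ≤ M.size := le_ciSup (Set.finite_range M.len).bddAbove i

theorem N_pos (hab : a < b) : 0 < M.N := by
  by_contra h
  have h0 : M.N = 0 := by omega
  have h1 : (0 : Fin (M.N + 1)) = Fin.last M.N := Fin.ext (by simp [h0])
  have h2 := M.node_first
  rw [h1, M.node_last] at h2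
  exact hab.ne' h2

theorem size_pos (hab : a < b) : 0 < M.size :=
  (M.len_pos ⟨0, M.N_pos hab⟩).trans_le (M.len_le_size _)

theorem sum_sub_eq (f : ℝ → ℝ) : ∑ i, (f (M.right i) - f (M.left i)) = f b - f a := by
  have h := Fin.sum_univ_castSucc (fun j : Fin (M.N + 1) => f (M.node j))
  rw [Fin.sum_univ_succ, M.node_first, M.node_last] at h
  rw [Finset.sum_sub_distrib]
  simp only [right, left]
  linarith

theorem sum_len : ∑ i, M.len i = b - a := M.sum_sub_eq id

theorem left_eq_a {i : Fin M.N} (hi : i.val = 0) : M.left i = a := by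
  refine Eq.trans (congrArg M.node ?_) M.node_first
  exact Fin.ext (by simp [hi])

theorem right_eq_b {i : Fin M.N} (hi : i.val + 1 = M.N) : M.right i = b := by
  refine Eq.trans (congrArg M.node ?_) M.node_last
  exact Fin.ext (by simp [hi])

theorem val_next {i : Fin M.N} (hi : i.val + 1 ≠ M.N) : (M.next i).val = i.val + 1 := by
  obtain ⟨N, node, h1, h2, h3⟩ := M
  cases N with
  | zero => exact i.elim0
  | succ n =>
    simp only [next] at *
    exact coe_finRotate_of_ne_last fun h => hi (by simp [h])

theorem val_next_last {i : Fin M.N} (hi : i.val + 1 = M.N) : (M.next i).val = 0 := by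
  obtain ⟨N, node, h1, h2, h3⟩ := M
  cases N with
  | zero => exact i.elim0
  | succ n =>
    simp only [next] at *
    have : i = Fin.last n := Fin.ext (by simpa using hi)
    rw [this, finRotate_last]
    rfl

theorem next_prev (i : Fin M.N) : M.next (M.prev i) = i := (finRotate M.N).apply_symm_apply i

theorem right_prev {i : Fin M.N} (hi : i.val ≠ 0) : M.right (M.prev i) = M.left i := by
  have h1 : (M.prev i).val + 1 ≠ M.N := fun h => by
    have := M.val_next_last h
    rw [next_prev] at this
    exact hi this
  have h2 := M.val_next h1
  rw [next_prev] at h2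
  rw [right, left]
  congr 1
  exact Fin.ext (by simp [h2])

theorem right_prev_first {i : Fin M.N} (hi : i.val = 0) : M.right (M.prev i) = b := by
  refine M.right_eq_b ?_
  by_contra h
  have h2 := M.val_next h
  rw [next_prev, hi] at h2
  omega

theorem left_next {i : Fin M.N} (hi : i.val + 1 ≠ M.N) : M.left (M.next i) = M.right i := by
  rw [right, left]
  congr 1
  exact Fin.ext (by simp [M.val_next hi])

theorem left_next_last {i : Fin M.N} (hi : i.val + 1 = M.N) : M.left (M.next i) = a :=
  M.left_eq_a (M.val_next_last hi)

theorem sum_prev (f : Fin M.N → ℝ) : ∑ i, f (M.prev i) = ∑ i, f i := Equiv.sum_comp (finRotate M.N).symm f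

theorem sum_next (f : Fin M.N → ℝ) : ∑ i, f (M.next i) = ∑ i, f i := Equiv.sum_comp (finRotate M.N) f

end Mesh

/-! ### Transplantation to the reference cell -/

variable {a b : ℝ} {k : ℕ} (M : Mesh a b)

/-- The polynomial of a cell in the coordinate of the reference cell. -/
def pull (i : Fin M.N) (p : ℝ[X]) : ℝ[X] := p.comp (C (M.left i) + C (M.len i) * X)

/-- The inverse of `pull`. -/
def push (i : Fin M.N) (p : ℝ[X]) : ℝ[X] := p.comp (C (1 / M.len i) * (X - C (M.left i)))

theorem eval_pull (i : Fin M.N) (p : ℝ[X]) (y : ℝ) : (pull M i p).eval y = p.eval (M.left i + M.len i * y) := by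
  simp [pull, eval_comp]

theorem pull_push (i : Fin M.N) (p : ℝ[X]) : pull M i (push M i p) = p := by
  refine Polynomial.funext fun y => ?_
  have h := (M.len_pos i).ne'
  rw [eval_pull, push, eval_comp]
  congr 1
  simp only [eval_mul, eval_C, eval_sub, eval_X]
  field_simp
  ring

theorem natDegree_pull_le (i : Fin M.N) {p : ℝ[X]} (hp : p.natDegree ≤ k) : (pull M i p).natDegree ≤ k := by
  refine natDegree_comp_le.trans ((Nat.mul_le_mul hp ?_).trans_eq (mul_one k))
  refine (natDegree_add_le _ _).trans (max_le (by simp) ?_)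
  exact (natDegree_C_mul_le _ _).trans (by simp)

theorem natDegree_push_le (i : Fin M.N) {p : ℝ[X]} (hp : p.natDegree ≤ k) : (push M i p).natDegree ≤ k := by
  refine natDegree_comp_le.trans ((Nat.mul_le_mul hp ?_).trans_eq (mul_one k))
  exact (natDegree_C_mul_le _ _).trans (by simp)

theorem pull_sub (i : Fin M.N) (p q : ℝ[X]) : pull M i (p - q) = pull M i p - pull M i q := sub_comp

theorem iterate_derivative_pull (i : Fin M.N) (l : ℕ) (p : ℝ[X]) :
    derivative^[l] (pull M i p) = C (M.len i ^ l) * pull M i (derivative^[l] p) := by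
  induction l with
  | zero => simp
  | succ l ih =>
    rw [Function.iterate_succ_apply', ih, derivative_C_mul, pull, derivative_comp, Function.iterate_succ_apply',
      pull]
    simp only [derivative_add, derivative_C, derivative_C_mul, derivative_X, zero_add, mul_one]
    rw [← mul_assoc, ← C_mul, pow_succ]

theorem eval_iterate_derivative_pull (i : Fin M.N) (l : ℕ) (p : ℝ[X]) (y : ℝ) :
    (derivative^[l] (pull M i p)).eval y = M.len i ^ l * (derivative^[l] p).eval (M.left i + M.len i * y) := by
  rw [iterate_derivative_pull, eval_mul, eval_C, eval_pull]

theorem integral_cell (i : Fin M.N) (f : ℝ → ℝ) (α β : ℝ) :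
    ∫ x in (M.left i + M.len i * α)..(M.left i + M.len i * β), f x =
      M.len i * ∫ y in α..β, f (M.left i + M.len i * y) :=
  (intervalIntegral.mul_integral_comp_add_mul (f := f) (M.len i) (M.left i)).symm

theorem integral_left_right (i : Fin M.N) (f : ℝ → ℝ) :
    ∫ x in (M.left i)..(M.right i), f x = M.len i * ∫ y in (0 : ℝ)..1, f (M.left i + M.len i * y) := by
  rw [← integral_cell, mul_zero, add_zero, mul_one, M.left_add_len]

section Cell

variable {s : Scheme} {ρ : Fin (k + 2) → ℝ}

theorem quadWeight_eq (s : Scheme) (i : Fin M.N) (m : Fin (k + 2)) :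
    quadWeight M ρ s i m = M.len i * refWeight s ρ m := by
  rw [quadWeight, integral_left_right, refWeight, integ_apply]
  congr 2
  funext y
  rw [Lagrange.basis, Lagrange.basis, eval_prod, eval_prod]
  refine Finset.prod_congr rfl fun j _ => ?_
  simp only [Lagrange.basisDivisor, eval_mul, eval_C, eval_sub, eval_X, pt]
  have h := (M.len_pos i).ne'
  rw [show M.left i + M.len i * ρ m - (M.left i + M.len i * ρ j) = M.len i * (ρ m - ρ j) by ring, mul_inv]
  field_simp
  ring

theorem star_eq (i : Fin M.N) (v : ℝ[X]) : star M ρ s i v = refStar s ρ (pull M i v) := by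
  funext j
  rw [star, refStar, eval_pull, mul_zero, add_zero]
  congr 1
  refine Finset.sum_congr rfl fun m _ => ?_
  have h := eval_iterate_derivative_pull M i 1 v (ρ m)
  rw [Function.iterate_one, pow_one] at h
  rw [quadWeight_eq, h, pt]
  ring

theorem cellPairing_star (i : Fin M.N) (f : ℝ → ℝ) (v : ℝ[X]) :
    cellPairing M ρ i f (star M ρ s i v) =
      M.len i * refPairing s ρ (fun y => f (M.left i + M.len i * y)) (pull M i v) := by
  rw [cellPairing, refPairing, star_eq, Finset.mul_sum]
  refine Finset.sum_congr rfl fun j _ => ?_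
  rw [cvIntegral, pt, pt, integral_cell]
  ring

theorem pull_interp (hρ : IsReferencePoints s k ρ) (i : Fin M.N) (v : ℝ → ℝ) :
    pull M i (interp M ρ v i) = refInterp ρ fun y => v (M.left i + M.len i * y) := by
  have hinj : Set.InjOn (fun j : Fin (k + 1) => pt M ρ i j.succ) (Finset.univ : Finset (Fin (k + 1))) := by
    intro j _ j' _ h
    have h1 : M.len i * ρ j.succ = M.len i * ρ j'.succ := by simpa [pt] using h
    exact Fin.succ_injective _ (hρ.strictMono.injective (mul_left_cancel₀ (M.len_pos i).ne' h1))
  refine eq_refInterp hρ (natDegree_pull_le M i ?_) fun j => ?_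
  · refine natDegree_le_of_degree_le ((Lagrange.degree_interpolate_le _ hinj).trans ?_)
    simp
  · rw [eval_pull]
    exact Lagrange.eval_interpolate_at_node (v := fun j : Fin (k + 1) => pt M ρ i j.succ)
      (r := fun j : Fin (k + 1) => v (pt M ρ i j.succ)) hinj (Finset.mem_univ j)

/-- The part of a polynomial removed by the `L²` projection, on the reference cell. -/
def projError (i : Fin M.N) (n : ℕ) (p : ℝ[X]) : ℝ[X] :=
  pull M i (p - l2Proj (M.left i) (M.right i) n p)

theorem left_lt_right (i : Fin M.N) : M.left i < M.right i := sub_pos.1 (M.len_pos i)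

theorem natDegree_projError_le (i : Fin M.N) {n : ℕ} (hn : n ≤ k) {p : ℝ[X]} (hp : p.natDegree ≤ k) :
    (projError M i n p).natDegree ≤ k :=
  natDegree_pull_le M i ((natDegree_sub_le _ _).trans
    (max_le hp ((l2Proj_spec (left_lt_right M i) n p).1.trans hn)))

theorem natDegree_pull_sub_projError_le (i : Fin M.N) (n : ℕ) (p : ℝ[X]) :
    (pull M i p - projError M i n p).natDegree ≤ n := by
  rw [projError, pull_sub, sub_sub_cancel]
  exact natDegree_pull_le M i (l2Proj_spec (left_lt_right M i) n p).1

theorem integ_projError_mul (i : Fin M.N) (n : ℕ) (p : ℝ[X]) {r : ℝ[X]} (hr : r.natDegree ≤ n) :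
    integ 0 1 (projError M i n p * r) = 0 := by
  have h := (l2Proj_spec (left_lt_right M i) n p).2 (push M i r) (natDegree_push_le M i hr)
  rw [integral_left_right] at h
  have h1 := (mul_eq_zero.1 h).resolve_left (M.len_pos i).ne'
  rw [integ_apply, ← h1]
  congr 1
  funext y
  rw [eval_mul, projError, eval_pull, ← eval_pull M i (push M i r), pull_push]

/-- The factor 1/h_i of the damping cancels the Jacobian of the change of variables. Relative to the
time derivative, which keeps its factor h_i, the damping is therefore larger by 1/h_i. -/
theorem dampingForm_star (σ : ℕ → ℝ) (i : Fin M.N) (q v : ℝ[X]) :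
    dampingForm M ρ σ i q (star M ρ s i v) = ∑ l ∈ Finset.range (k + 1),
      σ l * refPairing s ρ (fun y => (projError M i (l - 1) q).eval y) (pull M i v) := by
  rw [dampingForm]
  refine Finset.sum_congr rfl fun l _ => ?_
  have h := (M.len_pos i).ne'
  simp only [cellPairing_star, projError, eval_pull]
  field_simp

end Cell

end OFSV

namespace OFSV

/-! ### Regularized square roots -/

/-- A regularized weighted Euclidean norm. -/
def regSqrt (r x y δ : ℝ) : ℝ := √(r * (x ^ 2 + y ^ 2) + δ ^ 2)

theorem regSqrt_nonneg (r x y δ : ℝ) : 0 ≤ regSqrt r x y δ := Real.sqrt_nonneg _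

theorem mul_abs_le_regSqrt {r : ℝ} (hr : 0 ≤ r) (hr1 : r ≤ 1) (x y δ : ℝ) :
    r * |x| ≤ regSqrt r x y δ ∧ r * |y| ≤ regSqrt r x y δ ∧ |δ| ≤ regSqrt r x y δ := by
  have h1 : r ^ 2 ≤ r := by nlinarith
  have key : ∀ z : ℝ, (r * |z|) ^ 2 ≤ r * z ^ 2 := fun z => by
    rw [mul_pow, sq_abs]
    exact mul_le_mul_of_nonneg_right h1 (sq_nonneg z)
  refine ⟨Real.le_sqrt_of_sq_le ?_, Real.le_sqrt_of_sq_le ?_, Real.le_sqrt_of_sq_le ?_⟩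
  · have := key x
    nlinarith [mul_nonneg hr (sq_nonneg y), sq_nonneg δ]
  · have := key y
    nlinarith [mul_nonneg hr (sq_nonneg x), sq_nonneg δ]
  · rw [sq_abs]
    nlinarith [mul_nonneg hr (sq_nonneg x), mul_nonneg hr (sq_nonneg y)]

/-- Triangle inequality for a weighted Euclidean norm whose weights are at most one. The square of
the left side is expanded around the primed point, and the mixed terms are bounded by
`mul_abs_le_regSqrt`. -/
theorem regSqrt_le_add {r : ℝ} (hr : 0 ≤ r) (hr1 : r ≤ 1) (x y δ x' y' δ' : ℝ) :
    regSqrt r x y δ ≤ regSqrt r x' y' δ' + (|x - x'| + |y - y'| + |δ - δ'|) := by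
  obtain ⟨h1, h2, h3⟩ := mul_abs_le_regSqrt hr hr1 x' y' δ'
  set B := regSqrt r x' y' δ' with hB
  have hB0 : 0 ≤ B := regSqrt_nonneg _ _ _ _
  have hBsq : B ^ 2 = r * (x' ^ 2 + y' ^ 2) + δ' ^ 2 := Real.sq_sqrt (by positivity)
  have hpos : 0 ≤ |x - x'| + |y - y'| + |δ - δ'| := by positivity
  refine Real.sqrt_le_iff.2 ⟨by linarith, ?_⟩
  have cross : ∀ z z' q : ℝ, 0 ≤ q → q * |z'| ≤ B → q * (z' * (z - z')) ≤ B * |z - z'| := fun z z' q hq h =>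
    calc q * (z' * (z - z')) ≤ q * (|z'| * |z - z'|) := by
          refine mul_le_mul_of_nonneg_left ?_ hq
          rw [← abs_mul]
          exact le_abs_self _
      _ = q * |z'| * |z - z'| := by ring
      _ ≤ B * |z - z'| := mul_le_mul_of_nonneg_right h (abs_nonneg _)
  have c1 := cross x x' r hr h1
  have c2 := cross y y' r hr h2
  have c3 := cross δ δ' 1 zero_le_one (by rwa [one_mul])
  have d1 : r * (x - x') ^ 2 ≤ |x - x'| ^ 2 := by
    rw [sq_abs]
    exact mul_le_of_le_one_left (sq_nonneg _) hr1
  have d2 : r * (y - y') ^ 2 ≤ |y - y'| ^ 2 := by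
    rw [sq_abs]
    exact mul_le_of_le_one_left (sq_nonneg _) hr1
  have d3 : (δ - δ') ^ 2 = |δ - δ'| ^ 2 := (sq_abs _).symm
  have e : r * (x ^ 2 + y ^ 2) + δ ^ 2 = B ^ 2 + 2 * (r * (x' * (x - x'))) + 2 * (r * (y' * (y - y'))) +
      2 * (1 * (δ' * (δ - δ'))) + r * (x - x') ^ 2 + r * (y - y') ^ 2 + (δ - δ') ^ 2 := by
    rw [hBsq]
    ring
  rw [e]
  nlinarith [mul_nonneg (abs_nonneg (x - x')) (abs_nonneg (y - y')),
    mul_nonneg (abs_nonneg (x - x')) (abs_nonneg (δ - δ')), mul_nonneg (abs_nonneg (y - y')) (abs_nonneg (δ - δ'))]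

theorem abs_regSqrt_sub_le {r : ℝ} (hr : 0 ≤ r) (hr1 : r ≤ 1) (x y δ x' y' δ' : ℝ) :
    |regSqrt r x y δ - regSqrt r x' y' δ'| ≤ |x - x'| + |y - y'| + |δ - δ'| := by
  have h1 := regSqrt_le_add hr hr1 x y δ x' y' δ'
  have h2 := regSqrt_le_add hr hr1 x' y' δ' x y δ
  rw [abs_sub_comm x', abs_sub_comm y', abs_sub_comm δ'] at h2
  exact abs_sub_le_iff.2 ⟨by linarith, by linarith⟩

theorem regSqrt_le {r : ℝ} (hr : 0 ≤ r) (hr1 : r ≤ 1) (x y δ : ℝ) : regSqrt r x y δ ≤ |x| + |y| + |δ| := by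
  simpa [regSqrt] using regSqrt_le_add hr hr1 x y δ 0 0 0

/-- The positive `δ` gives differentiability even where both jumps vanish, while the bound on the
derivative does not depend on `δ`. -/
theorem exists_hasDerivAt_regSqrt {r δ : ℝ} (hr : 0 ≤ r) (hr1 : r ≤ 1) (hδ : 0 < δ) {x y : ℝ → ℝ} {x' y' t : ℝ}
    (hx : HasDerivAt x x' t) (hy : HasDerivAt y y' t) :
    ∃ d, HasDerivAt (fun t => regSqrt r (x t) (y t) δ) d t ∧ |d| ≤ |x'| + |y'| := by
  obtain ⟨h1, h2, h3⟩ := mul_abs_le_regSqrt hr hr1 (x t) (y t) δ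
  have hS : 0 < regSqrt r (x t) (y t) δ := (abs_pos.2 hδ.ne').trans_le h3
  have hne : r * (x t ^ 2 + y t ^ 2) + δ ^ 2 ≠ 0 := by positivity
  have hd := ((((hx.pow 2).add (hy.pow 2)).const_mul r).add_const (δ ^ 2)).sqrt hne
  refine ⟨_, hd, ?_⟩
  change |_ / (2 * regSqrt r (x t) (y t) δ)| ≤ _
  rw [abs_div, abs_of_pos (by positivity : 0 < 2 * regSqrt r (x t) (y t) δ), div_le_iff₀ (by positivity)]
  have e : r * (((2 : ℕ) : ℝ) * x t ^ (2 - 1) * x' + ((2 : ℕ) : ℝ) * y t ^ (2 - 1) * y') =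
      2 * (r * (x t * x') + r * (y t * y')) := by
    push_cast
    ring
  rw [e, abs_mul, abs_two]
  have f : ∀ z z' : ℝ, r * |z| ≤ regSqrt r (x t) (y t) δ → |r * (z * z')| ≤ regSqrt r (x t) (y t) δ * |z'| :=
    fun z z' h => by
      rw [abs_mul, abs_mul, abs_of_nonneg hr, ← mul_assoc]
      exact mul_le_mul_of_nonneg_right h (abs_nonneg _)
  have f1 := f _ x' h1
  have f2 := f _ y' h2
  have f3 := abs_add_le (r * (x t * x')) (r * (y t * y'))
  nlinarith

end OFSV

namespace OFSV

/-! ### Jumps -/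

section Jumps

variable {a b c : ℝ} {k : ℕ} (M : Mesh a b) {s : Scheme} {ρ : Fin (k + 2) → ℝ}

/-- The value at the left end of a cell of a derivative. -/
def leftDeriv (p : Fin M.N → ℝ[X]) (i : Fin M.N) (l : ℕ) : ℝ := (derivative^[l] (p i)).eval (M.left i)

/-- The value at the right end of a cell of a derivative. -/
def rightDeriv (p : Fin M.N → ℝ[X]) (i : Fin M.N) (l : ℕ) : ℝ := (derivative^[l] (p i)).eval (M.right i)

theorem size_pow_div_le (hM : M.ShapeRegular c) (i : Fin M.N) {l : ℕ} (hl : l ≤ k) :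
    M.size ^ l / M.len i ^ l ≤ c ^ k := by
  have h := M.len_pos i
  have h1 : M.size / M.len i ≤ c := (div_le_iff₀ h).2 (hM i)
  have h2 : 1 ≤ M.size / M.len i := (one_le_div h).2 (M.len_le_size i)
  rw [← div_pow]
  exact (pow_le_pow_left₀ (by linarith) h1 l).trans (pow_le_pow_right₀ (h2.trans h1) hl)

theorem size_pow_mul_abs_eval_le (hM : M.ShapeRegular c) (i : Fin M.N) {l : ℕ} (hl : l ≤ k) {p : ℝ[X]} {y z B : ℝ}
    (hB : |(derivative^[l] (pull M i p)).eval y - M.len i ^ l * z| ≤ B) :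
    M.size ^ l * |(derivative^[l] p).eval (M.left i + M.len i * y) - z| ≤ c ^ k * B := by
  have h := pow_pos (M.len_pos i) l
  rw [eval_iterate_derivative_pull, ← mul_sub, abs_mul, abs_of_pos h] at hB
  calc M.size ^ l * |(derivative^[l] p).eval (M.left i + M.len i * y) - z|
      = M.size ^ l / M.len i ^ l * (M.len i ^ l * |(derivative^[l] p).eval (M.left i + M.len i * y) - z|) := by
        field_simp
    _ ≤ c ^ k * B := mul_le_mul (size_pow_div_le M hM i hl) hB (by positivity)
        (le_trans (div_nonneg (pow_nonneg ((M.len_pos i).le.trans (M.len_le_size i)) l) h.le)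
          (size_pow_div_le M hM i hl))

theorem abs_jumpLeft_sub_le (bc : Boundary) (t : ℝ) (p q : Fin M.N → ℝ[X]) (i : Fin M.N) (l : ℕ) :
    |jumpLeft M bc t p i l - jumpLeft M bc t q i l| ≤
      |leftDeriv M p i l - leftDeriv M q i l| + |rightDeriv M p (M.prev i) l - rightDeriv M q (M.prev i) l| := by
  have key : ∀ x y x' y' : ℝ, |x - y - (x' - y')| ≤ |x - x'| + |y - y'| := fun x y x' y' => by
    rw [show x - y - (x' - y') = (x - x') - (y - y') by ring]
    exact abs_sub _ _
  cases bc with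
  | periodic => exact key _ _ _ _
  | inflow g =>
    simp only [jumpLeft]
    split_ifs with h1 h2
    · subst h2
      refine (key _ _ _ _).trans (add_le_add le_rfl ?_)
      simp
    · simp only [sub_self, abs_zero]
      positivity
    · exact key _ _ _ _

theorem abs_jumpRight_sub_le (bc : Boundary) (p q : Fin M.N → ℝ[X]) (i : Fin M.N) (l : ℕ) :
    |jumpRight M bc p i l - jumpRight M bc q i l| ≤
      |leftDeriv M p (M.next i) l - leftDeriv M q (M.next i) l| + |rightDeriv M p i l - rightDeriv M q i l| := by
  have key : ∀ x y x' y' : ℝ, |x - y - (x' - y')| ≤ |x - x'| + |y - y'| := fun x y x' y' => by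
    rw [show x - y - (x' - y') = (x - x') - (y - y') by ring]
    exact abs_sub _ _
  cases bc with
  | periodic => exact key _ _ _ _
  | inflow g =>
    simp only [jumpRight]
    split_ifs with h1
    · simp only [sub_self, abs_zero]
      positivity
    · exact key _ _ _ _

theorem size_pow_mul_abs_leftDeriv_sub_le (hM : M.ShapeRegular c) {p q : Fin M.N → ℝ[X]} {i : Fin M.N}
    (h : (p i - q i).natDegree ≤ k) {l : ℕ} (hl : l ≤ k) :
    M.size ^ l * |leftDeriv M p i l - leftDeriv M q i l| ≤
      c ^ k * (k.factorial * cnorm k (pull M i (p i - q i))) := by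
  have h1 := size_pow_mul_abs_eval_le M hM i hl (p := p i - q i) (y := 0) (z := 0)
    (by simpa using abs_eval_iterate_derivative_le (natDegree_pull_le M i h) l (y := 0) (by simp))
  simpa [leftDeriv, iterate_derivative_sub] using h1

theorem size_pow_mul_abs_rightDeriv_sub_le (hM : M.ShapeRegular c) {p q : Fin M.N → ℝ[X]} {i : Fin M.N}
    (h : (p i - q i).natDegree ≤ k) {l : ℕ} (hl : l ≤ k) :
    M.size ^ l * |rightDeriv M p i l - rightDeriv M q i l| ≤
      c ^ k * (k.factorial * cnorm k (pull M i (p i - q i))) := by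
  have h1 := size_pow_mul_abs_eval_le M hM i hl (p := p i - q i) (y := 1) (z := 0)
    (by simpa using abs_eval_iterate_derivative_le (natDegree_pull_le M i h) l (y := 1) (by simp))
  rw [mul_one, M.left_add_len] at h1
  simpa [rightDeriv, iterate_derivative_sub] using h1

/-- The boundary condition satisfied by the wave `Φ (x - t)`. -/
def waveBoundary (a : ℝ) (bc : Boundary) (Φ : ℝ → ℝ) : Boundary :=
  match bc with
  | .periodic => .periodic
  | .inflow _ => .inflow fun t => Φ (a - t)

/-- The interpolant of the wave `Φ (x - t)`. -/
def waveInterp (ρ : Fin (k + 2) → ℝ) (Φ : ℝ → ℝ) (t : ℝ) (i : Fin M.N) : ℝ[X] :=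
  interp M ρ (fun x => Φ (x - t)) i

theorem pull_waveInterp (hρ : IsReferencePoints s k ρ) (Φ : ℝ → ℝ) (t : ℝ) (i : Fin M.N) :
    pull M i (waveInterp M ρ Φ t i) = refInterp ρ fun y => Φ (M.left i - t + M.len i * y) := by
  rw [waveInterp, pull_interp M hρ]
  congr 1
  funext y
  congr 1
  ring

/-- Periodicity of the wave `Φ (x - t)` and its derivatives at time `t`, for periodic boundary conditions. -/
def WavePeriodic (a b : ℝ) (k : ℕ) (bc : Boundary) (Φ : ℝ → ℝ) (t : ℝ) : Prop :=
  bc = .periodic → ∀ l ≤ k, iteratedDeriv l Φ (a - t) = iteratedDeriv l Φ (b - t)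

/-- The wave has the same derivative on both sides of the node, by periodicity where the mesh closes
up, so the jump is a difference of two one-sided interpolation errors. At an inflow end the exterior
value is that of the wave and only one error remains. -/
theorem abs_jumpLeft_waveInterp_le {bc : Boundary} {Φ : ℝ → ℝ} {t : ℝ} (hper : WavePeriodic a b k bc Φ t)
    (i : Fin M.N) {l : ℕ} (hl : l ≤ k) :
    |jumpLeft M (waveBoundary a bc Φ) t (waveInterp M ρ Φ t) i l| ≤
      |leftDeriv M (waveInterp M ρ Φ t) i l - iteratedDeriv l Φ (M.left i - t)| +
      |rightDeriv M (waveInterp M ρ Φ t) (M.prev i) l - iteratedDeriv l Φ (M.right (M.prev i) - t)| := by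
  have key : ∀ x y w : ℝ, |x - y| ≤ |x - w| + |y - w| := fun x y w => by
    rw [show x - y = (x - w) - (y - w) by ring]
    exact abs_sub _ _
  have hint : i.val ≠ 0 → |leftDeriv M (waveInterp M ρ Φ t) i l - rightDeriv M (waveInterp M ρ Φ t) (M.prev i) l| ≤
      |leftDeriv M (waveInterp M ρ Φ t) i l - iteratedDeriv l Φ (M.left i - t)| +
      |rightDeriv M (waveInterp M ρ Φ t) (M.prev i) l - iteratedDeriv l Φ (M.right (M.prev i) - t)| := fun hi => by
    rw [M.right_prev hi]
    exact key _ _ _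
  cases bc with
  | periodic =>
    by_cases hi : i.val = 0
    · have h1 := hper rfl l hl
      rw [M.right_prev_first hi, ← h1, M.left_eq_a hi]
      exact key _ _ _
    · exact hint hi
  | inflow g =>
    simp only [jumpLeft, waveBoundary]
    split_ifs with h1 h2
    · subst h2
      rw [M.left_eq_a h1]
      simp only [leftDeriv, Function.iterate_zero, id_eq, iteratedDeriv_zero, M.left_eq_a h1]
      exact le_add_of_nonneg_right (abs_nonneg _)
    · rw [abs_zero]
      positivity
    · exact hint h1

theorem abs_jumpRight_waveInterp_le {bc : Boundary} {Φ : ℝ → ℝ} {t : ℝ} (hper : WavePeriodic a b k bc Φ t)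
    (i : Fin M.N) {l : ℕ} (hl : l ≤ k) :
    |jumpRight M (waveBoundary a bc Φ) (waveInterp M ρ Φ t) i l| ≤
      |leftDeriv M (waveInterp M ρ Φ t) (M.next i) l - iteratedDeriv l Φ (M.left (M.next i) - t)| +
      |rightDeriv M (waveInterp M ρ Φ t) i l - iteratedDeriv l Φ (M.right i - t)| := by
  have key : ∀ x y w : ℝ, |x - y| ≤ |x - w| + |y - w| := fun x y w => by
    rw [show x - y = (x - w) - (y - w) by ring]
    exact abs_sub _ _
  have hint : i.val + 1 ≠ M.N →
      |leftDeriv M (waveInterp M ρ Φ t) (M.next i) l - rightDeriv M (waveInterp M ρ Φ t) i l| ≤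
      |leftDeriv M (waveInterp M ρ Φ t) (M.next i) l - iteratedDeriv l Φ (M.left (M.next i) - t)| +
      |rightDeriv M (waveInterp M ρ Φ t) i l - iteratedDeriv l Φ (M.right i - t)| := fun hi => by
    rw [M.left_next hi]
    exact key _ _ _
  cases bc with
  | periodic =>
    by_cases hi : i.val + 1 = M.N
    · have h1 := hper rfl l hl
      rw [M.left_next_last hi, h1, M.right_eq_b hi]
      exact key _ _ _
    · exact hint hi
  | inflow g =>
    simp only [jumpRight, waveBoundary]
    split_ifs with h1
    · rw [abs_zero]
      positivity
    · exact hint h1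

/-- The jumps of the interpolant of a wave are of order `k + 1`. -/
theorem exists_size_pow_mul_jump_le (c : ℝ) (hρ : IsReferencePoints s k ρ) :
    ∃ K : ℝ, 0 ≤ K ∧ ∀ (M : Mesh a b) (bc : Boundary) (Φ : ℝ → ℝ) (t ε : ℝ) (i : Fin M.N), M.ShapeRegular c →
      ContDiff ℝ (k + 1 : ℕ) Φ → WavePeriodic a b k bc Φ t →
      (∀ z ∈ Icc (a - t) (b - t), |iteratedDeriv (k + 1) Φ z| ≤ ε) → ∀ l ≤ k,
      |M.size ^ l * jumpLeft M (waveBoundary a bc Φ) t (waveInterp M ρ Φ t) i l| ≤ K * (M.size ^ (k + 1) * ε) ∧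
      |M.size ^ l * jumpRight M (waveBoundary a bc Φ) (waveInterp M ρ Φ t) i l| ≤ K * (M.size ^ (k + 1) * ε) := by
  obtain ⟨K, hK0, hK⟩ := exists_abs_iterate_derivative_refInterp_le hρ
  refine ⟨2 * (|c| ^ k * K), by positivity, fun M bc Φ t ε i hM hΦ hper hε l hl => ?_⟩
  -- The constant must be fixed before the mesh, hence the absolute value in it. Shape regularity of
  -- any single cell then forces `c` to be positive.
  have hc : 0 < c := by
    by_contra h
    have h1 := hM i
    have h2 := M.len_le_size i
    have h3 := M.len_pos i
    nlinarith
  rw [abs_of_pos hc]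
  have hsz : 0 ≤ M.size := (M.len_pos i).le.trans (M.len_le_size i)
  have hε0 : 0 ≤ ε := (abs_nonneg _).trans (hε (M.left i - t)
    ⟨by linarith [M.a_le_left i], by linarith [M.right_le_b i, left_lt_right M i]⟩)
  have hcell : ∀ (i : Fin M.N) (y : ℝ), y ∈ Icc (0 : ℝ) 1 →
      M.size ^ l * |(derivative^[l] (waveInterp M ρ Φ t i)).eval (M.left i + M.len i * y) -
        iteratedDeriv l Φ (M.left i - t + M.len i * y)| ≤ c ^ k * K * (M.size ^ (k + 1) * ε) := by
    intro i y hy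
    have h1 := hK Φ (M.left i - t) (M.len i) ε hΦ (M.len_pos i).le (fun z hz => hε z
      ⟨by linarith [hz.1, M.a_le_left i], by linarith [hz.2, M.right_le_b i, M.left_add_len i]⟩) y hy l hl
    rw [← pull_waveInterp M hρ] at h1
    refine (size_pow_mul_abs_eval_le M hM i hl h1).trans ?_
    rw [mul_assoc]
    refine mul_le_mul_of_nonneg_left (mul_le_mul_of_nonneg_left (mul_le_mul_of_nonneg_right
      (pow_le_pow_left₀ (M.len_pos i).le (M.len_le_size i) _) hε0) hK0.le) (by positivity)
  have hL : ∀ i, M.size ^ l * |leftDeriv M (waveInterp M ρ Φ t) i l - iteratedDeriv l Φ (M.left i - t)| ≤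
      c ^ k * K * (M.size ^ (k + 1) * ε) := fun i => by
    simpa [leftDeriv] using hcell i 0 (by simp)
  have hR : ∀ i, M.size ^ l * |rightDeriv M (waveInterp M ρ Φ t) i l - iteratedDeriv l Φ (M.right i - t)| ≤
      c ^ k * K * (M.size ^ (k + 1) * ε) := fun i => by
    have h1 := hcell i 1 (by simp)
    rw [mul_one, M.left_add_len, show M.left i - t + M.len i = M.right i - t by
      linarith [M.left_add_len i]] at h1
    exact h1
  have hpow : 0 ≤ M.size ^ l := pow_nonneg hsz l
  constructor
  · rw [abs_mul, abs_of_nonneg hpow]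
    refine (mul_le_mul_of_nonneg_left (abs_jumpLeft_waveInterp_le M hper i hl) hpow).trans ?_
    rw [mul_add]
    linarith [hL i, hR (M.prev i)]
  · rw [abs_mul, abs_of_nonneg hpow]
    refine (mul_le_mul_of_nonneg_left (abs_jumpRight_waveInterp_le M hper i hl) hpow).trans ?_
    rw [mul_add]
    linarith [hL (M.next i), hR i]

theorem eval_iterate_derivative_waveInterp (Φ : ℝ → ℝ) (t : ℝ) (i : Fin M.N) (l : ℕ) (z : ℝ) :
    (derivative^[l] (waveInterp M ρ Φ t i)).eval z = ∑ j : Fin (k + 1), Φ (pt M ρ i j.succ - t) *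
      (derivative^[l] (Lagrange.basis Finset.univ (fun j : Fin (k + 1) => pt M ρ i j.succ) j)).eval z := by
  rw [waveInterp, interp, Lagrange.interpolate_apply, iterate_derivative_sum, eval_finsetSum]
  refine Finset.sum_congr rfl fun j _ => ?_
  rw [iterate_derivative_C_mul, eval_mul, eval_C]

theorem hasDerivAt_wave {Φ : ℝ → ℝ} (hΦ : Differentiable ℝ Φ) (x t : ℝ) :
    HasDerivAt (fun t => Φ (x - t)) (-deriv Φ (x - t)) t :=
  (hΦ (x - t)).hasDerivAt.comp_const_sub x t

theorem hasDerivAt_eval_waveInterp {Φ : ℝ → ℝ} (hΦ : Differentiable ℝ Φ) (t : ℝ) (i : Fin M.N) (l : ℕ) (z : ℝ) :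
    HasDerivAt (fun t => (derivative^[l] (waveInterp M ρ Φ t i)).eval z)
      (-(derivative^[l] (waveInterp M ρ (deriv Φ) t i)).eval z) t := by
  simp only [eval_iterate_derivative_waveInterp]
  rw [← Finset.sum_neg_distrib]
  refine HasDerivAt.fun_sum fun j _ => ?_
  rw [← neg_mul]
  exact (hasDerivAt_wave hΦ _ t).mul_const _

/-- With the inflow value replaced by the trace of the wave, differentiation in time replaces the
wave by minus its derivative. The bound for jumps, applied to `deriv Φ`, thus also bounds their time
derivatives. -/
theorem hasDerivAt_jumpLeft {Φ : ℝ → ℝ} (hΦ : Differentiable ℝ Φ) (bc : Boundary) (t : ℝ) (i : Fin M.N) (l : ℕ) :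
    HasDerivAt (fun t => jumpLeft M (waveBoundary a bc Φ) t (waveInterp M ρ Φ t) i l)
      (-jumpLeft M (waveBoundary a bc (deriv Φ)) t (waveInterp M ρ (deriv Φ) t) i l) t := by
  have h := ((hasDerivAt_eval_waveInterp M (ρ := ρ) hΦ t i l (M.left i)).sub
    (hasDerivAt_eval_waveInterp M (ρ := ρ) hΦ t (M.prev i) l (M.right (M.prev i)))).congr_deriv
    (neg_sub_neg _ _ |>.trans (neg_sub _ _).symm)
  cases bc with
  | periodic => exact h
  | inflow g =>
    simp only [jumpLeft, waveBoundary]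
    split_ifs with h1 h2
    · exact ((hasDerivAt_eval_waveInterp M (ρ := ρ) hΦ t i 0 (M.left i)).sub (hasDerivAt_wave hΦ a t)).congr_deriv
        (neg_sub_neg _ _ |>.trans (neg_sub _ _).symm)
    · simpa using hasDerivAt_const t (0 : ℝ)
    · exact h

theorem hasDerivAt_jumpRight {Φ : ℝ → ℝ} (hΦ : Differentiable ℝ Φ) (bc : Boundary) (t : ℝ) (i : Fin M.N) (l : ℕ) :
    HasDerivAt (fun t => jumpRight M (waveBoundary a bc Φ) (waveInterp M ρ Φ t) i l)
      (-jumpRight M (waveBoundary a bc (deriv Φ)) (waveInterp M ρ (deriv Φ) t) i l) t := by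
  have h := ((hasDerivAt_eval_waveInterp M (ρ := ρ) hΦ t (M.next i) l (M.left (M.next i))).sub
    (hasDerivAt_eval_waveInterp M (ρ := ρ) hΦ t i l (M.right i))).congr_deriv
    (neg_sub_neg _ _ |>.trans (neg_sub _ _).symm)
  cases bc with
  | periodic => exact h
  | inflow g =>
    simp only [jumpRight, waveBoundary]
    split_ifs with h1
    · simpa using hasDerivAt_const t (0 : ℝ)
    · exact h

/-! ### Damping coefficients -/

/-- The numerical factor of the damping coefficients. -/
def dampingFactor (k l : ℕ) : ℝ := 2 * (2 * (l : ℝ) + 1) / (2 * (k : ℝ) - 1) / (l.factorial : ℝ)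

theorem dampingFactor_nonneg (hk : 1 ≤ k) (l : ℕ) : 0 ≤ dampingFactor k l := by
  have : (1 : ℝ) ≤ k := by exact_mod_cast hk
  have h : 0 ≤ 2 * (k : ℝ) - 1 := by linarith
  unfold dampingFactor
  positivity

theorem dampingFactor_le (hk : 1 ≤ k) {l : ℕ} (hl : l ≤ k) : dampingFactor k l ≤ 2 * (2 * (k : ℝ) + 1) := by
  have h1 : (1 : ℝ) ≤ k := by exact_mod_cast hk
  have h2 : (l : ℝ) ≤ k := by exact_mod_cast hl
  have h3 : (1 : ℝ) ≤ l.factorial := by exact_mod_cast Nat.one_le_iff_ne_zero.2 l.factorial_ne_zero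
  unfold dampingFactor
  have h4 : 0 ≤ 2 * (2 * (l : ℝ) + 1) := by positivity
  refine (div_le_self (div_nonneg h4 (by linarith)) h3).trans ((div_le_self h4 (by linarith)).trans (by linarith))

/-- With the powers of the mesh size inside the root, the true coefficients are the case `δ = 0` of
the regularized ones. -/
theorem damping_eq (M : Mesh a b) (hsz : 0 ≤ M.size) (Ne : ℕ) (bc : Boundary) (t : ℝ) (p : Fin M.N → ℝ[X])
    (i : Fin M.N) (l : ℕ) :
    damping M k Ne bc t p i l = dampingFactor k l *
      regSqrt (1 / Ne) (M.size ^ l * jumpLeft M bc t p i l) (M.size ^ l * jumpRight M bc p i l) 0 := by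
  have h : 1 / (Ne : ℝ) * ((M.size ^ l * jumpLeft M bc t p i l) ^ 2 + (M.size ^ l * jumpRight M bc p i l) ^ 2) + 0 ^ 2
      = (M.size ^ l) ^ 2 * (1 / (Ne : ℝ) * (jumpLeft M bc t p i l ^ 2 + jumpRight M bc p i l ^ 2)) := by ring
  rw [damping, regSqrt, h, Real.sqrt_mul (sq_nonneg _), Real.sqrt_sq (pow_nonneg hsz l), dampingFactor]
  ring

/-- The regularized damping coefficients of the interpolant of the wave `Φ (x - t)`. -/
def waveDamping (M : Mesh a b) (ρ : Fin (k + 2) → ℝ) (Ne : ℕ) (bc : Boundary) (Φ : ℝ → ℝ) (t : ℝ) (i : Fin M.N)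
    (l : ℕ) : ℝ :=
  dampingFactor k l * regSqrt (1 / Ne) (M.size ^ l * jumpLeft M (waveBoundary a bc Φ) t (waveInterp M ρ Φ t) i l)
    (M.size ^ l * jumpRight M (waveBoundary a bc Φ) (waveInterp M ρ Φ t) i l) (M.size ^ (k + 2))

theorem one_div_natCast_mem {Ne : ℕ} (hNe : 1 ≤ Ne) : 0 ≤ 1 / (Ne : ℝ) ∧ 1 / (Ne : ℝ) ≤ 1 := by
  have : (1 : ℝ) ≤ Ne := by exact_mod_cast hNe
  exact ⟨by positivity, (div_le_one (by linarith)).2 this⟩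

theorem jumpLeft_waveBoundary {T : ℝ} {bc : Boundary} {u : ℝ → ℝ → ℝ} (hbc : bc.Holds a b T u) {V : ℝ → ℝ}
    {t : ℝ} (ht : t ∈ Icc 0 T) (hu : u a t = V (a - t)) (p : Fin M.N → ℝ[X]) (i : Fin M.N) (l : ℕ) :
    jumpLeft M bc t p i l = jumpLeft M (waveBoundary a bc V) t p i l := by
  cases bc with
  | periodic => rfl
  | inflow g => simp only [jumpLeft, waveBoundary, ← hu, hbc t ht]

theorem jumpRight_waveBoundary (bc : Boundary) (V : ℝ → ℝ) (p : Fin M.N → ℝ[X]) (i : Fin M.N) (l : ℕ) :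
    jumpRight M bc p i l = jumpRight M (waveBoundary a bc V) p i l := by
  cases bc <;> rfl

/-- The damping coefficients depend on the discrete function in a Lipschitz continuous way. -/
theorem exists_abs_damping_sub_le (k : ℕ) (hk : 1 ≤ k) (c : ℝ) :
    ∃ K : ℝ, 0 ≤ K ∧ ∀ (M : Mesh a b) (ρ : Fin (k + 2) → ℝ) (Ne : ℕ) (bc : Boundary) (V : ℝ → ℝ) (t : ℝ)
      (p : Fin M.N → ℝ[X]) (i : Fin M.N), M.ShapeRegular c → 1 ≤ Ne →
      (∀ l, jumpLeft M bc t p i l = jumpLeft M (waveBoundary a bc V) t p i l) →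
      (∀ i, (p i - waveInterp M ρ V t i).natDegree ≤ k) → ∀ l ≤ k,
      |damping M k Ne bc t p i l - waveDamping M ρ Ne bc V t i l| ≤
        K * (cnorm k (pull M i (p i - waveInterp M ρ V t i)) +
          cnorm k (pull M (M.prev i) (p (M.prev i) - waveInterp M ρ V t (M.prev i))) +
          cnorm k (pull M (M.next i) (p (M.next i) - waveInterp M ρ V t (M.next i))) + M.size ^ (k + 2)) := by
  have hKpos : 0 ≤ 2 * (|c| ^ k * k.factorial) + 1 := by positivity
  refine ⟨2 * (2 * (k : ℝ) + 1) * (2 * (|c| ^ k * k.factorial) + 1), by positivity,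
    fun M ρ Ne bc V t p i hM hNe hbc hdeg l hl => ?_⟩
  have hc : 0 < c := by
    by_contra h
    have h1 := hM i
    have h2 := M.len_le_size i
    have h3 := M.len_pos i
    nlinarith
  rw [abs_of_pos hc] at hKpos ⊢
  have hsz : 0 ≤ M.size := (M.len_pos i).le.trans (M.len_le_size i)
  have hpow : 0 ≤ M.size ^ l := pow_nonneg hsz l
  obtain ⟨hr, hr1⟩ := one_div_natCast_mem hNe
  rw [damping_eq M hsz, waveDamping, ← mul_sub, abs_mul, abs_of_nonneg (dampingFactor_nonneg hk l), mul_assoc]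
  refine mul_le_mul (dampingFactor_le hk hl) ?_ (abs_nonneg _) (by positivity)
  -- The coefficients of the scheme have `δ = 0` and those of the wave `δ = H^(k+2)`; this
  -- difference is the last term of the bound.
  refine (abs_regSqrt_sub_le hr hr1 _ _ _ _ _ _).trans ?_
  set I := waveInterp M ρ V t with hI
  rw [hbc, jumpRight_waveBoundary M bc V, ← mul_sub, ← mul_sub, abs_mul, abs_mul, abs_of_nonneg hpow, zero_sub, abs_neg,
    abs_of_nonneg (pow_nonneg hsz (k + 2))]
  have e1 := mul_le_mul_of_nonneg_left (abs_jumpLeft_sub_le M (waveBoundary a bc V) t p I i l) hpow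
  have e2 := mul_le_mul_of_nonneg_left (abs_jumpRight_sub_le M (waveBoundary a bc V) p I i l) hpow
  rw [mul_add] at e1 e2
  have f1 := size_pow_mul_abs_leftDeriv_sub_le M hM (hdeg i) hl
  have f2 := size_pow_mul_abs_rightDeriv_sub_le M hM (hdeg i) hl
  have f3 := size_pow_mul_abs_rightDeriv_sub_le M hM (hdeg (M.prev i)) hl
  have f4 := size_pow_mul_abs_leftDeriv_sub_le M hM (hdeg (M.next i)) hl
  have n1 := cnorm_nonneg k (pull M i (p i - I i))
  have n2 := cnorm_nonneg k (pull M (M.prev i) (p (M.prev i) - I (M.prev i)))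
  have n3 := cnorm_nonneg k (pull M (M.next i) (p (M.next i) - I (M.next i)))
  have n4 := pow_nonneg hsz (k + 2)
  have n5 : 0 ≤ c ^ k * k.factorial := by positivity
  have g1 := mul_nonneg n5 n2
  have g2 := mul_nonneg n5 n3
  have g3 := mul_nonneg n5 n4
  rw [← mul_assoc] at f1 f2 f3 f4
  have expand : (2 * (c ^ k * k.factorial) + 1) * (cnorm k (pull M i (p i - I i)) +
      cnorm k (pull M (M.prev i) (p (M.prev i) - I (M.prev i))) +
      cnorm k (pull M (M.next i) (p (M.next i) - I (M.next i))) + M.size ^ (k + 2)) =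
      2 * (c ^ k * k.factorial * cnorm k (pull M i (p i - I i))) +
      2 * (c ^ k * k.factorial * cnorm k (pull M (M.prev i) (p (M.prev i) - I (M.prev i)))) +
      2 * (c ^ k * k.factorial * cnorm k (pull M (M.next i) (p (M.next i) - I (M.next i)))) +
      2 * (c ^ k * k.factorial * M.size ^ (k + 2)) + (cnorm k (pull M i (p i - I i)) +
      cnorm k (pull M (M.prev i) (p (M.prev i) - I (M.prev i))) +
      cnorm k (pull M (M.next i) (p (M.next i) - I (M.next i))) + M.size ^ (k + 2)) := by ring
  rw [expand]
  linarith

/-- Size and time derivative of the regularized damping coefficients of a wave. -/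
theorem exists_waveDamping_bound (hk : 1 ≤ k) (c B : ℝ) (hρ : IsReferencePoints s k ρ) :
    ∃ K : ℝ, 0 ≤ K ∧ ∀ (M : Mesh a b) (Ne : ℕ) (bc : Boundary) (V : ℝ → ℝ) (t : ℝ) (i : Fin M.N),
      M.ShapeRegular c → M.size ≤ 1 → 1 ≤ Ne → ContDiff ℝ (k + 2 : ℕ) V → WavePeriodic a b k bc V t →
      WavePeriodic a b k bc (deriv V) t → (∀ z ∈ Icc (a - t) (b - t), |iteratedDeriv (k + 1) V z| ≤ B) →
      (∀ z ∈ Icc (a - t) (b - t), |iteratedDeriv (k + 2) V z| ≤ B) → ∀ l ≤ k,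
      0 ≤ waveDamping M ρ Ne bc V t i l ∧ waveDamping M ρ Ne bc V t i l ≤ K * M.size ^ (k + 1) ∧
      ∃ d, HasDerivAt (fun t => waveDamping M ρ Ne bc V t i l) d t ∧ |d| ≤ K * M.size ^ (k + 1) := by
  obtain ⟨K, hK0, hK⟩ := exists_size_pow_mul_jump_le (a := a) (b := b) c hρ
  refine ⟨2 * (2 * (k : ℝ) + 1) * (2 * (K * |B|) + 1), by positivity,
    fun M Ne bc V t i hM hsz1 hNe hV hp hp' hB hB' l hl => ?_⟩
  have hB0 : 0 ≤ B := (abs_nonneg _).trans (hB (M.left i - t)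
    ⟨by linarith [M.a_le_left i], by linarith [M.right_le_b i, left_lt_right M i]⟩)
  rw [abs_of_nonneg hB0]
  have hsz : 0 < M.size := (M.len_pos i).trans_le (M.len_le_size i)
  obtain ⟨hr, hr1⟩ := one_div_natCast_mem hNe
  have hV1 : ContDiff ℝ (k + 1 : ℕ) V := hV.of_le (by exact_mod_cast Nat.le_succ _)
  have hV' : ContDiff ℝ (k + 1 : ℕ) (deriv V) := ((contDiff_succ_iff_deriv (n := (k + 1 : ℕ))).1 (by
    exact_mod_cast hV)).2.2
  have hVd : Differentiable ℝ V := hV.differentiable (by simp)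
  obtain ⟨j1, j2⟩ := hK M bc V t B i hM hV1 hp hB l hl
  obtain ⟨j3, j4⟩ := hK M bc (deriv V) t B i hM hV' hp' (fun z hz => by
    rw [← iteratedDeriv_succ']
    exact hB' z hz) l hl
  have hδ : 0 < M.size ^ (k + 2) := pow_pos hsz _
  have hδ1 : M.size ^ (k + 2) ≤ M.size ^ (k + 1) := pow_le_pow_of_le_one hsz.le hsz1 (Nat.le_succ _)
  refine ⟨mul_nonneg (dampingFactor_nonneg hk l) (regSqrt_nonneg _ _ _ _), ?_, ?_⟩
  · rw [waveDamping, mul_assoc]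
    refine mul_le_mul (dampingFactor_le hk hl) ?_ (regSqrt_nonneg _ _ _ _) (by positivity)
    refine (regSqrt_le hr hr1 _ _ _).trans ?_
    rw [abs_of_pos hδ]
    linarith
  · obtain ⟨d, hd, hdb⟩ := exists_hasDerivAt_regSqrt hr hr1 hδ
      ((hasDerivAt_jumpLeft M (ρ := ρ) hVd bc t i l).const_mul (M.size ^ l))
      ((hasDerivAt_jumpRight M (ρ := ρ) hVd bc t i l).const_mul (M.size ^ l))
    refine ⟨_, hd.const_mul (dampingFactor k l), ?_⟩
    rw [abs_mul, abs_of_nonneg (dampingFactor_nonneg hk l), mul_assoc]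
    refine mul_le_mul (dampingFactor_le hk hl) (hdb.trans ?_) (abs_nonneg _) (by positivity)
    rw [mul_neg, mul_neg, abs_neg, abs_neg]
    have : 0 ≤ M.size ^ (k + 1) := by positivity
    linarith

end Jumps

end OFSV

/-! ### Residual of the corrected interpolant on one cell. -/

namespace OFSV

section Residual

variable {s : Scheme} {k : ℕ} {ρ : Fin (k + 2) → ℝ}

/-- The linear polynomial with vanishing mean on the reference cell. -/
def centered : ℝ[X] := X - C (1 / 2)

theorem integ_centered : integ 0 1 centered = 0 := by
  simp [integ_apply, centered, intervalIntegral.integral_sub]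

theorem natDegree_centered_le (hk : 1 ≤ k) : centered.natDegree ≤ k := by
  rw [centered, natDegree_X_sub_C]
  exact hk

theorem refPairing_poly_add (p q v : ℝ[X]) :
    refPairing s ρ (fun y => (p + q).eval y) v =
      refPairing s ρ (fun y => p.eval y) v + refPairing s ρ (fun y => q.eval y) v := by
  simp only [eval_add]
  exact refPairing_add_left p.continuous q.continuous v

theorem refPairing_poly_C_mul (c : ℝ) (p v : ℝ[X]) :
    refPairing s ρ (fun y => (C c * p).eval y) v = c * refPairing s ρ (fun y => p.eval y) v := by
  simp only [eval_mul, eval_C]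
  exact refPairing_const_mul_left c _ v

/-- The damping is dissipative. -/
theorem refPairing_projError_nonneg {κ : ℝ} (hκ : 0 ≤ κ)
    (hpair : ∀ p v : ℝ[X], p.natDegree ≤ k → v.natDegree ≤ k →
      refPairing s ρ (fun y => p.eval y) v = integ 0 1 (p * v) + κ * (p.coeff k * v.coeff k))
    {d v : ℝ[X]} {n : ℕ} (hn : n < k) (hd : d.natDegree ≤ k) (hv : v.natDegree ≤ k) (hvd : (v - d).natDegree ≤ n)
    (horth : ∀ r : ℝ[X], r.natDegree ≤ n → integ 0 1 (d * r) = 0) :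
    0 ≤ refPairing s ρ (fun y => d.eval y) v := by
  -- The part `v - d` kept by the projection has degree below k, so `d` and `v` share their top
  -- coefficient and the rank-one term of the pairing is a square.
  have h1 : d.coeff k = v.coeff k := by
    have := coeff_eq_zero_of_natDegree_lt (hvd.trans_lt hn)
    rw [coeff_sub] at this
    linarith
  have h2 : d * v = d * d + d * (v - d) := by ring
  rw [hpair d v hd hv, h2, map_add, horth _ hvd, add_zero, h1]
  exact add_nonneg (integ_mul_self_nonneg d) (mul_nonneg hκ (mul_self_nonneg _))

theorem exists_projection (n : ℕ) (p : ℝ[X]) : ∃ d : ℝ[X], (p - d).natDegree ≤ n ∧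
    ∀ r : ℝ[X], r.natDegree ≤ n → integ 0 1 (d * r) = 0 := by
  obtain ⟨q, hq, h⟩ := exists_l2Proj (zero_lt_one' ℝ) n p
  refine ⟨p - q, by simpa using hq, fun r hr => ?_⟩
  have := h r hr
  simpa [integ_apply] using this

set_option maxHeartbeats 1000000 in
/-- Lower bound for the residual of the corrected interpolant of a smooth wave on one cell. -/
theorem exists_cell_residual_bound (hk : 1 ≤ k) (hρ : IsReferencePoints s k ρ) {Z W : ℝ[X]}
    (hZ : Z.natDegree ≤ k) (hW : W.natDegree ≤ k)
    (hZe : ∀ v : ℝ[X], v.natDegree ≤ k →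
      integ 0 1 (Z * derivative v) = refPairing s ρ (fun y => (refError ρ).eval y) v)
    (hWe : ∀ v : ℝ[X], v.natDegree ≤ k →
      integ 0 1 (W * derivative v) = refPairing s ρ (fun y => centered.eval y) v) :
    ∃ K : ℝ, 0 ≤ K ∧ ∀ (V : ℝ → ℝ) (x h q ε B δ S : ℝ) (σ τ : ℕ → ℝ) (P ξ ω : ℝ[X]) (d : ℕ → ℝ[X]),
      0 < h → h ≤ 1 → ContDiff ℝ (k + 2 : ℕ) V →
      (∀ z ∈ Icc x (x + h), |iteratedDeriv 2 V z| ≤ B) → |deriv V x| ≤ B → |q| ≤ B →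
      (∀ z ∈ Icc x (x + h), |iteratedDeriv (k + 2) V z - q| ≤ ε) →
      (∀ l ≤ k, 0 ≤ σ l) → (∀ l ≤ k, |σ l - τ l| ≤ δ) → (∀ l ≤ k, |τ l| ≤ S) →
      ω = C (h ^ (k + 2) * q / (k + 1).factorial) * Z +
        C (-(h * deriv V x * ∑ l ∈ Finset.range (k + 1), if l ≤ 1 then τ l else 0)) * W →
      ξ.natDegree ≤ k → P = refInterp ρ (fun y => V (x + h * y)) - ω + ξ →
      (∀ l ≤ k, (d l).natDegree ≤ k ∧ (P - d l).natDegree ≤ l - 1 ∧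
        ∀ r : ℝ[X], r.natDegree ≤ l - 1 → integ 0 1 (d l * r) = 0) →
      -(K * cnorm k ξ * (h ^ (k + 2) * ε + h * δ * B + (S + δ) * (h ^ 2 * B + h * S * B))) ≤
        -(h * refPairing s ρ (fun y => (refInterp ρ fun y => deriv V (x + h * y)).eval y - deriv V (x + h * y)) ξ) +
        integ 0 1 (ω * derivative ξ) +
        ∑ l ∈ Finset.range (k + 1), σ l * refPairing s ρ (fun y => (d l).eval y) ξ := by
  obtain ⟨κ, hκ, hpair, -⟩ := exists_refPairing_eq hk hρ
  obtain ⟨K₁, hK₁, hb⟩ := exists_abs_refPairing_le (s := s) hρ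
  obtain ⟨K₂, hK₂, hexp⟩ := exists_refInterp_expansion hρ
  obtain ⟨K₃, hK₃, hlin⟩ := exists_cnorm_refInterp_sub_linear_le hρ hk
  obtain ⟨K₄, hK₄, hproj⟩ := exists_cnorm_le_of_orthogonal k
  have hz := cnorm_nonneg k Z
  have hw := cnorm_nonneg k W
  set cC := cnorm k centered with hcC
  have hcC0 : 0 ≤ cC := cnorm_nonneg _ _
  set A₁ := K₁ * K₂ with hA₁
  set A₂ := (k + 1) * (K₁ * cC) with hA₂
  set A₃ := (k + 1) * (K₁ * (K₄ * (K₃ + cnorm k Z + (k + 1) * cnorm k W))) with hA₃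
  have hA₁0 : 0 ≤ A₁ := by positivity
  have hA₂0 : 0 ≤ A₂ := by positivity
  have hA₃0 : 0 ≤ A₃ := by positivity
  refine ⟨A₁ + A₂ + A₃, by positivity, ?_⟩
  intro V x h q ε B δ S σ τ P ξ ω d hh hh1 hV hV2 hV1 hq hosc hσ hστ hτ hω hξ hP hd
  have hB : 0 ≤ B := (abs_nonneg _).trans hV1
  have hε : 0 ≤ ε := (abs_nonneg _).trans (hosc x ⟨le_rfl, by linarith⟩)
  have hδ : 0 ≤ δ := (abs_nonneg _).trans (hστ 0 (Nat.zero_le _))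
  have hS : 0 ≤ S := (abs_nonneg _).trans (hτ 0 (Nat.zero_le _))
  have hs := cnorm_nonneg k ξ
  set n := cnorm k ξ with hn
  have hVd : ContDiff ℝ (k + 1 : ℕ) (deriv V) := ((contDiff_succ_iff_deriv (n := (k + 1 : ℕ))).1 (by
    exact_mod_cast hV)).2.2
  set D := deriv V x with hD
  set Ψ := refPairing s ρ (fun y => (refError ρ).eval y) ξ with hΨ
  set Ψ' := refPairing s ρ (fun y => centered.eval y) ξ with hΨ'
  set τ₀ := ∑ l ∈ Finset.range (k + 1), (if l ≤ 1 then τ l else 0) with hτ₀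
  set α := h ^ (k + 2) * q / (k + 1).factorial with hα
  set I := refInterp ρ (fun y => V (x + h * y)) with hI
  -- the time derivative
  have p1 : |h * refPairing s ρ (fun y => (refInterp ρ fun y => deriv V (x + h * y)).eval y - deriv V (x + h * y)) ξ
      - α * Ψ| ≤ A₁ * n * (h ^ (k + 2) * ε) := by
    have e1 := hb (fun y => (refInterp ρ fun y => deriv V (x + h * y)).eval y - deriv V (x + h * y) -
      h ^ (k + 1) * q / (k + 1).factorial * (refError ρ).eval y) (K₂ * (h ^ (k + 1) * ε)) ξ hξ
      (hexp (deriv V) x h q ε hVd hh.le fun z hz => by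
        rw [← iteratedDeriv_succ']
        exact hosc z hz)
    rw [refPairing_sub_left, refPairing_const_mul_left] at e1
    · have e2 : h * refPairing s ρ (fun y => (refInterp ρ fun y => deriv V (x + h * y)).eval y - deriv V (x + h * y)) ξ
        - α * Ψ = h * (refPairing s ρ (fun y => (refInterp ρ fun y => deriv V (x + h * y)).eval y -
          deriv V (x + h * y)) ξ - h ^ (k + 1) * q / (k + 1).factorial * Ψ) := by
        rw [hα]
        ring
      rw [e2, abs_mul, abs_of_pos hh]
      calc _ ≤ h * (K₁ * (K₂ * (h ^ (k + 1) * ε)) * n) := mul_le_mul_of_nonneg_left e1 hh.le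
        _ = _ := by rw [hA₁]; ring
    · exact (Polynomial.continuous _).sub (hVd.continuous.comp (by fun_prop))
    · exact continuous_const.mul (Polynomial.continuous _)
  -- the correction
  have p2 : integ 0 1 (ω * derivative ξ) = α * Ψ - h * D * τ₀ * Ψ' := by
    rw [hω, add_mul, map_add, mul_assoc, mul_assoc, integ_C_mul, integ_C_mul, hZe ξ hξ, hWe ξ hξ]
    ring
  have hΨ'b : |Ψ'| ≤ K₁ * cC * n := hb _ _ ξ hξ fun y hy => abs_eval_le (natDegree_centered_le hk) hy
  have hωd : ω.natDegree ≤ k := by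
    rw [hω]
    exact (natDegree_add_le _ _).trans (max_le ((natDegree_C_mul_le _ _).trans hZ) ((natDegree_C_mul_le _ _).trans hW))
  have hτ₀b : |τ₀| ≤ (k + 1) * S := by
    refine (Finset.abs_sum_le_sum_abs _ _).trans ?_
    calc _ ≤ ∑ _l ∈ Finset.range (k + 1), S := Finset.sum_le_sum fun l hl => by
          split_ifs
          · exact hτ l (Nat.lt_succ_iff.1 (Finset.mem_range.1 hl))
          · rwa [abs_zero]
      _ = (k + 1) * S := by simp
  have hωn : cnorm k ω ≤ (cnorm k Z + (k + 1) * cnorm k W) * (h ^ 2 * B + h * S * B) := by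
    rw [hω]
    refine (cnorm_add_le _ _ _).trans ?_
    rw [cnorm_C_mul, cnorm_C_mul]
    have f1 : |α| ≤ h ^ 2 * B := by
      rw [hα, abs_div, abs_mul, abs_of_pos (pow_pos hh _), Nat.abs_cast]
      refine (div_le_self (by positivity) (by exact_mod_cast Nat.one_le_iff_ne_zero.2 (Nat.factorial_ne_zero _))).trans ?_
      exact mul_le_mul (pow_le_pow_of_le_one hh.le hh1 (by omega)) hq (abs_nonneg _) (by positivity)
    have f2 : |(-(h * D * τ₀))| ≤ (k + 1) * (h * S * B) := by
      rw [abs_neg, abs_mul, abs_mul, abs_of_pos hh]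
      calc h * |D| * |τ₀| ≤ h * B * ((k + 1) * S) :=
            mul_le_mul (mul_le_mul_of_nonneg_left hV1 hh.le) hτ₀b (abs_nonneg _) (by positivity)
        _ = _ := by ring
    have f3 := mul_le_mul_of_nonneg_right f1 hz
    have f4 := mul_le_mul_of_nonneg_right f2 hw
    have f5 : 0 ≤ h * S * B := by positivity
    have f6 : 0 ≤ h ^ 2 * B := by positivity
    nlinarith [mul_nonneg hz f5, mul_nonneg (mul_nonneg (by positivity : (0 : ℝ) ≤ (k : ℝ) + 1) hw) f6]
  -- the damping
  have p3 : ∀ l ∈ Finset.range (k + 1),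
      (if l ≤ 1 then τ l else 0) * (h * D * Ψ') - h * δ * B * (K₁ * cC * n) -
        (S + δ) * (K₁ * (K₄ * (K₃ * (h ^ 2 * B) + cnorm k ω)) * n) ≤
      σ l * refPairing s ρ (fun y => (d l).eval y) ξ := by
    intro l hl
    have hlk : l ≤ k := Nat.lt_succ_iff.1 (Finset.mem_range.1 hl)
    obtain ⟨hdd, hPd, horth⟩ := hd l hlk
    -- The projection error splits into that of the corrected interpolant, called `e`, and that of
    -- `ξ`, which is `d l - e`. The second one, paired with `ξ`, is nonnegative and is dropped; only
    -- `e` needs an estimate.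
    obtain ⟨e, hed, heo⟩ := exists_projection (l - 1) (I - ω)
    have hn1 : l - 1 < k := by omega
    have hIω : (I - ω).natDegree ≤ k := (natDegree_sub_le _ _).trans (max_le (natDegree_refInterp_le hρ _) hωd)
    have hedeg : e.natDegree ≤ k := by
      have : e = (I - ω) - ((I - ω) - e) := by ring
      rw [this]
      exact (natDegree_sub_le _ _).trans (max_le hIω (hed.trans hn1.le))
    have hdiss : 0 ≤ refPairing s ρ (fun y => (d l - e).eval y) ξ := by
      refine refPairing_projError_nonneg hκ hpair hn1 ((natDegree_sub_le _ _).trans (max_le hdd hedeg)) hξ ?_ ?_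
      · have : ξ - (d l - e) = (P - d l) - ((I - ω) - e) := by rw [hP]; ring
        rw [this]
        exact (natDegree_sub_le _ _).trans (max_le hPd hed)
      · intro r hr
        rw [sub_mul, map_sub, horth r hr, heo r hr, sub_zero]
    have hsplit : refPairing s ρ (fun y => (d l).eval y) ξ =
        refPairing s ρ (fun y => e.eval y) ξ + refPairing s ρ (fun y => (d l - e).eval y) ξ := by
      rw [← refPairing_poly_add, add_sub_cancel]
    -- For l = 0 and l = 1 the projection is onto constants, as `l - 1` is zero in both cases, and
    -- it leaves `h * D` times `centered` from the linear part. For l ≥ 2 linear functions are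
    -- removed entirely.
    set θ : ℝ := if l ≤ 1 then h * D else 0 with hθ
    set e₂ := e - C θ * centered with he₂
    set lin : ℝ[X] := C (V x) + C (h * D) * X with hlinp
    -- `e₂` is the projection error of `I - lin - ω`, and a projection error is bounded by the
    -- function itself.
    have he₂n : cnorm k e₂ ≤ K₄ * (K₃ * (h ^ 2 * B) + cnorm k ω) := by
      have hlind : lin.natDegree ≤ k := (natDegree_add_le _ _).trans (max_le (by simp)
        ((natDegree_C_mul_le _ _).trans (by simpa using hk)))
      have g1 : cnorm k (I - lin - ω) ≤ K₃ * (h ^ 2 * B) + cnorm k ω :=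
        (cnorm_sub_le _ _ _).trans (add_le_add (hlin V x h B (hV.of_le (by exact_mod_cast (by omega : 2 ≤ k + 2)))
          hh.le hV2) le_rfl)
      refine (hproj (l - 1) e₂ (I - lin - ω) ?_ ?_ ?_ ?_).trans (mul_le_mul_of_nonneg_left g1 hK₄.le)
      · exact (natDegree_sub_le _ _).trans (max_le hedeg ((natDegree_C_mul_le _ _).trans (natDegree_centered_le hk)))
      · exact (natDegree_sub_le _ _).trans (max_le ((natDegree_sub_le _ _).trans
          (max_le (natDegree_refInterp_le hρ _) hlind)) hωd)
      · by_cases hl1 : l ≤ 1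
        · have : e₂ - (I - lin - ω) = C (V x + h * D * (1 / 2)) - ((I - ω) - e) := by
            rw [he₂, hθ, if_pos hl1, hlinp, centered, C_add, C_mul (a := h * D)]
            ring
          rw [this]
          exact (natDegree_sub_le _ _).trans (max_le ((natDegree_C _).le.trans (Nat.zero_le _)) hed)
        · have : e₂ - (I - lin - ω) = lin - ((I - ω) - e) := by
            rw [he₂, hθ, if_neg hl1, C_0]
            ring
          rw [this]
          refine (natDegree_sub_le _ _).trans (max_le ?_ hed)
          exact (natDegree_add_le _ _).trans (max_le (by simp)
            ((natDegree_C_mul_le _ _).trans (by rw [natDegree_X]; omega)))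
      · intro r hr
        rw [he₂, sub_mul, map_sub, heo r hr, mul_assoc, integ_C_mul, zero_sub, neg_eq_zero]
        by_cases hl1 : l ≤ 1
        · obtain ⟨r₀, rfl⟩ := natDegree_eq_zero.1 (Nat.le_zero.1 (hr.trans (by omega)))
          rw [mul_comm centered, integ_C_mul, integ_centered, mul_zero, mul_zero]
        · rw [hθ, if_neg hl1, zero_mul]
    have he₂d : e₂.natDegree ≤ k := (natDegree_sub_le _ _).trans
      (max_le hedeg ((natDegree_C_mul_le _ _).trans (natDegree_centered_le hk)))
    have hpe : refPairing s ρ (fun y => e.eval y) ξ = θ * Ψ' + refPairing s ρ (fun y => e₂.eval y) ξ := by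
      rw [hΨ', ← refPairing_poly_C_mul, ← refPairing_poly_add, he₂, add_sub_cancel]
    have hpe₂ : |refPairing s ρ (fun y => e₂.eval y) ξ| ≤ K₁ * (K₄ * (K₃ * (h ^ 2 * B) + cnorm k ω)) * n :=
      (hb _ _ ξ hξ fun y hy => abs_eval_le he₂d hy).trans
        (mul_le_mul_of_nonneg_right (mul_le_mul_of_nonneg_left he₂n hK₁.le) hs)
    have hσl : σ l ≤ S + δ := by
      have a1 := abs_le.1 (hστ l hlk)
      have a2 := abs_le.1 (hτ l hlk)
      linarith
    set E := K₁ * (K₄ * (K₃ * (h ^ 2 * B) + cnorm k ω)) * n with hE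
    have hE0 : 0 ≤ E := (abs_nonneg _).trans hpe₂
    have b1 : -((S + δ) * E) ≤ σ l * refPairing s ρ (fun y => e₂.eval y) ξ := by
      have c1 : σ l * -E ≤ σ l * refPairing s ρ (fun y => e₂.eval y) ξ :=
        mul_le_mul_of_nonneg_left (abs_le.1 hpe₂).1 (hσ l hlk)
      have c2 := mul_le_mul_of_nonneg_right hσl hE0
      linarith
    -- The correction is built with `τ`, not with the coefficients `σ` of the discrete solution.
    -- Exchanging them in the leading term costs `δ` times a factor of order `h`.
    have b2 : (if l ≤ 1 then τ l else 0) * (h * D * Ψ') - h * δ * B * (K₁ * cC * n) ≤ σ l * (θ * Ψ') := by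
      have c0 : 0 ≤ h * δ * B * (K₁ * cC * n) := by positivity
      by_cases hl1 : l ≤ 1
      · rw [if_pos hl1, hθ, if_pos hl1]
        have c1 : |(τ l - σ l) * (h * D * Ψ')| ≤ h * δ * B * (K₁ * cC * n) := by
          rw [abs_mul, abs_mul, abs_mul, abs_of_pos hh, abs_sub_comm]
          calc |σ l - τ l| * (h * |D| * |Ψ'|) ≤ δ * (h * B * (K₁ * cC * n)) :=
                mul_le_mul (hστ l hlk) (mul_le_mul (mul_le_mul_of_nonneg_left hV1 hh.le) hΨ'b (abs_nonneg _)
                  (by positivity)) (by positivity) hδ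
            _ = _ := by ring
        have c2 := (abs_le.1 c1).2
        linarith
      · rw [if_neg hl1, hθ, if_neg hl1]
        simpa using c0
    have b3 := mul_nonneg (hσ l hlk) hdiss
    rw [hsplit, hpe, mul_add, mul_add]
    linarith
  have p4 := Finset.sum_le_sum p3
  rw [Finset.sum_sub_distrib, Finset.sum_sub_distrib, ← Finset.sum_mul, Finset.sum_const, Finset.sum_const,
    Finset.card_range, nsmul_eq_mul, nsmul_eq_mul, ← hτ₀] at p4
  push_cast at p4
  set Y := h ^ 2 * B + h * S * B with hY
  have hY0 : 0 ≤ Y := by positivity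
  have p5 : ((k : ℝ) + 1) * ((S + δ) * (K₁ * (K₄ * (K₃ * (h ^ 2 * B) + cnorm k ω)) * n)) ≤ A₃ * n * ((S + δ) * Y) := by
    have c1 : K₃ * (h ^ 2 * B) + cnorm k ω ≤ (K₃ + cnorm k Z + (k + 1) * cnorm k W) * Y := by
      have : h ^ 2 * B ≤ Y := by
        have : 0 ≤ h * S * B := by positivity
        linarith
      have := mul_le_mul_of_nonneg_left this hK₃.le
      linarith
    have c2 : 0 ≤ ((k : ℝ) + 1) * (S + δ) * K₁ * K₄ * n := by positivity
    have c3 := mul_le_mul_of_nonneg_left c1 c2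
    rw [hA₃]
    linarith
  have p6 : ((k : ℝ) + 1) * (h * δ * B * (K₁ * cC * n)) = A₂ * n * (h * δ * B) := by
    rw [hA₂]
    ring
  have p7 := (abs_le.1 p1).2
  -- Now the leading terms cancel: `α * Ψ` from the time derivative of the interpolation error, and
  -- `h * D * τ₀ * Ψ'` from the damping, each against its part of the correction.
  rw [p2]
  have q1 : 0 ≤ A₁ * n * (h * δ * B + (S + δ) * Y) := by positivity
  have q2 : 0 ≤ A₂ * n * (h ^ (k + 2) * ε + (S + δ) * Y) := by positivity
  have q3 : 0 ≤ A₃ * n * (h ^ (k + 2) * ε + h * δ * B) := by positivity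
  have expand : (A₁ + A₂ + A₃) * n * (h ^ (k + 2) * ε + h * δ * B + (S + δ) * Y) =
      A₁ * n * (h ^ (k + 2) * ε) + A₂ * n * (h * δ * B) + A₃ * n * ((S + δ) * Y) +
      A₁ * n * (h * δ * B + (S + δ) * Y) + A₂ * n * (h ^ (k + 2) * ε + (S + δ) * Y) +
      A₃ * n * (h ^ (k + 2) * ε + h * δ * B) := by ring
  rw [expand]
  linarith

end Residual

end OFSV

namespace OFSV

/-! ### Curves of polynomials -/

section Curves

variable {k : ℕ} {S : Set ℝ} {t : ℝ}

/-- The coefficients of the curve `p` of polynomials are differentiable, with derivatives the coefficients of `p'`. -/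
def HasCoeffDerivWithinAt (p : ℝ → ℝ[X]) (p' : ℝ[X]) (S : Set ℝ) (t : ℝ) : Prop :=
  ∀ n, HasDerivWithinAt (fun r => (p r).coeff n) (p'.coeff n) S t

theorem HasCoeffDerivWithinAt.add {p q : ℝ → ℝ[X]} {p' q' : ℝ[X]} (hp : HasCoeffDerivWithinAt p p' S t)
    (hq : HasCoeffDerivWithinAt q q' S t) : HasCoeffDerivWithinAt (fun r => p r + q r) (p' + q') S t := fun n => by
  simpa only [coeff_add] using (hp n).fun_add (hq n)

theorem HasCoeffDerivWithinAt.sub {p q : ℝ → ℝ[X]} {p' q' : ℝ[X]} (hp : HasCoeffDerivWithinAt p p' S t)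
    (hq : HasCoeffDerivWithinAt q q' S t) : HasCoeffDerivWithinAt (fun r => p r - q r) (p' - q') S t := fun n => by
  simpa only [coeff_sub] using (hp n).fun_sub (hq n)

theorem hasCoeffDerivWithinAt_C_mul {f : ℝ → ℝ} {f' : ℝ} (hf : HasDerivWithinAt f f' S t) (p : ℝ[X]) :
    HasCoeffDerivWithinAt (fun r => C (f r) * p) (C f' * p) S t := fun n => by
  simpa only [coeff_C_mul] using hf.mul_const (p.coeff n)

theorem hasCoeffDerivWithinAt_sum {ι : Type*} {A : Finset ι} {p : ι → ℝ → ℝ[X]} {p' : ι → ℝ[X]}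
    (h : ∀ i ∈ A, HasCoeffDerivWithinAt (p i) (p' i) S t) :
    HasCoeffDerivWithinAt (fun r => ∑ i ∈ A, p i r) (∑ i ∈ A, p' i) S t := fun n => by
  simp only [finsetSum_coeff]
  exact HasDerivWithinAt.fun_sum fun i hi => h i hi n

theorem linear_apply_eq_sum {E : Type*} [AddCommGroup E] [Module ℝ E] (L : ℝ[X] →ₗ[ℝ] E) {p : ℝ[X]}
    (hp : p.natDegree ≤ k) : L p = ∑ n ∈ Finset.range (k + 1), p.coeff n • L (X ^ n) := by
  conv_lhs => rw [p.as_sum_range' (k + 1) (by omega)]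
  rw [map_sum]
  refine Finset.sum_congr rfl fun n _ => ?_
  rw [← map_smul, smul_X_eq_monomial]

/-- A bounded degree makes each linear functional a fixed finite combination of coefficients;
evaluation, transplantation and moments are all differentiated this way. -/
theorem HasCoeffDerivWithinAt.linear {p : ℝ → ℝ[X]} {p' : ℝ[X]} (h : HasCoeffDerivWithinAt p p' S t) (ht : t ∈ S)
    (hp : ∀ r ∈ S, (p r).natDegree ≤ k) (hp' : p'.natDegree ≤ k) (L : ℝ[X] →ₗ[ℝ] ℝ) :
    HasDerivWithinAt (fun r => L (p r)) (L p') S t := by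
  rw [linear_apply_eq_sum L hp']
  have h1 : HasDerivWithinAt (fun r => ∑ n ∈ Finset.range (k + 1), (p r).coeff n • L (X ^ n))
      (∑ n ∈ Finset.range (k + 1), p'.coeff n • L (X ^ n)) S t :=
    HasDerivWithinAt.fun_sum fun n _ => (h n).mul_const _
  exact h1.congr (fun r hr => linear_apply_eq_sum L (hp r hr)) (linear_apply_eq_sum L (hp t ht))

theorem HasCoeffDerivWithinAt.eval {p : ℝ → ℝ[X]} {p' : ℝ[X]} (h : HasCoeffDerivWithinAt p p' S t) (ht : t ∈ S)
    (hp : ∀ r ∈ S, (p r).natDegree ≤ k) (hp' : p'.natDegree ≤ k) (x : ℝ) :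
    HasDerivWithinAt (fun r => (p r).eval x) (p'.eval x) S t :=
  h.linear ht hp hp' (leval x)

theorem HasCoeffDerivWithinAt.pull {a b : ℝ} (M : Mesh a b) (i : Fin M.N) {p : ℝ → ℝ[X]} {p' : ℝ[X]}
    (h : HasCoeffDerivWithinAt p p' S t) (ht : t ∈ S) (hp : ∀ r ∈ S, (p r).natDegree ≤ k) (hp' : p'.natDegree ≤ k) :
    HasCoeffDerivWithinAt (fun r => pull M i (p r)) (pull M i p') S t := fun n =>
  h.linear ht hp hp' ((lcoeff ℝ n).comp (aeval (C (M.left i) + C (M.len i) * X : ℝ[X])).toLinearMap)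

/-- The bilinear form induced on polynomials by the pairing with the test space. -/
def energyForm (κ : ℝ) (k : ℕ) (p q : ℝ[X]) : ℝ := integ 0 1 (p * q) + κ * (p.coeff k * q.coeff k)

theorem HasCoeffDerivWithinAt.energyForm {p : ℝ → ℝ[X]} {p' : ℝ[X]} (h : HasCoeffDerivWithinAt p p' S t) (ht : t ∈ S)
    (hp : ∀ r ∈ S, (p r).natDegree ≤ k) (hp' : p'.natDegree ≤ k) (κ : ℝ) :
    HasDerivWithinAt (fun r => energyForm κ k (p r) (p r)) (2 * energyForm κ k p' (p t)) S t := by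
  have h1 : HasDerivWithinAt (fun r => ∑ n ∈ Finset.range (k + 1), (p r).coeff n * integ 0 1 (p r * X ^ n))
      (∑ n ∈ Finset.range (k + 1), (p'.coeff n * integ 0 1 (p t * X ^ n) + (p t).coeff n * integ 0 1 (p' * X ^ n)))
      S t := HasDerivWithinAt.fun_sum fun n _ =>
    (h n).mul (h.linear ht hp hp' ((integ 0 1).comp (LinearMap.mulRight ℝ (X ^ n))))
  have h2 : HasDerivWithinAt (fun r => integ 0 1 (p r * p r)) (2 * integ 0 1 (p' * p t)) S t := by
    refine (h1.congr (fun r hr => integ_mul_eq_sum (p r) (hp r hr)) (integ_mul_eq_sum (p t) (hp t ht))).congr_deriv ?_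
    rw [Finset.sum_add_distrib, ← integ_mul_eq_sum _ hp', ← integ_mul_eq_sum _ (hp t ht), mul_comm (p t) p']
    ring
  refine (h2.add (((h k).mul (h k)).const_mul κ)).congr_deriv ?_
  rw [OFSV.energyForm]
  ring

theorem energyForm_self_nonneg {κ : ℝ} (hκ : 0 ≤ κ) (p : ℝ[X]) : 0 ≤ energyForm κ k p p :=
  add_nonneg (integ_mul_self_nonneg p) (mul_nonneg hκ (mul_self_nonneg _))

theorem energyForm_self_le {κ : ℝ} (hκ : 0 ≤ κ) {p : ℝ[X]} (hp : p.natDegree ≤ k) :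
    energyForm κ k p p ≤ (1 + κ) * cnorm k p ^ 2 := by
  have h1 := abs_coeff_le_cnorm le_rfl (k := k) p
  have h2 : p.coeff k * p.coeff k ≤ cnorm k p ^ 2 := by
    rw [← pow_two, ← sq_abs]
    exact pow_le_pow_left₀ (abs_nonneg _) h1 2
  have h3 := mul_le_mul_of_nonneg_left h2 hκ
  have h4 := integ_mul_self_le hp
  rw [energyForm]
  linarith

end Curves

/-! ### The wave and its correction function -/

/-- A wave `V (x - t)` on `[a,b] × [0,T]` with square integrable derivative of `iteratedDeriv (k + 2) V`, expressed by
the modulus of continuity given by the increasing function `F`. -/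
structure WaveProfile (a b T B : ℝ) (k : ℕ) (bc : Boundary) (V F : ℝ → ℝ) : Prop where
  contDiff : ContDiff ℝ (k + 2 : ℕ) V
  monotone : Monotone F
  osc : ∀ z y, z ≤ y →
    (iteratedDeriv (k + 2) V y - iteratedDeriv (k + 2) V z) ^ 2 ≤ (y - z) * (F y - F z)
  bound : ∀ j ≤ k + 2, ∀ z ∈ Icc (a - T) b, |iteratedDeriv j V z| ≤ B
  periodic : ∀ t ∈ Icc 0 T, WavePeriodic a b (k + 1) bc V t

section Wave

variable {a b c T B : ℝ} {k : ℕ} {bc : Boundary} {V F : ℝ → ℝ} {s : Scheme} {ρ : Fin (k + 2) → ℝ}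

theorem Mesh.shift_mem (M : Mesh a b) (i : Fin M.N) {t z : ℝ} (ht : t ∈ Icc 0 T)
    (hz : z ∈ Icc (M.left i - t) (M.right i - t)) : z ∈ Icc (a - T) b :=
  ⟨by linarith [M.a_le_left i, ht.2, hz.1], by linarith [M.right_le_b i, ht.1, hz.2]⟩

/-- Mean value over a cell of `iteratedDeriv (k + 2) V`. -/
def waveSlope (M : Mesh a b) (k : ℕ) (V : ℝ → ℝ) (t : ℝ) (i : Fin M.N) : ℝ :=
  (iteratedDeriv (k + 1) V (M.right i - t) - iteratedDeriv (k + 1) V (M.left i - t)) / M.len i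

/-- Bound for the oscillation over a cell of `iteratedDeriv (k + 2) V`. -/
def waveOsc (M : Mesh a b) (F : ℝ → ℝ) (t : ℝ) (i : Fin M.N) : ℝ :=
  √(M.len i * (F (M.right i - t) - F (M.left i - t)))

theorem WaveProfile.osc_nonneg (hV : WaveProfile a b T B k bc V F) (M : Mesh a b) (t : ℝ) (i : Fin M.N) :
    0 ≤ M.len i * (F (M.right i - t) - F (M.left i - t)) :=
  mul_nonneg (M.len_pos i).le (sub_nonneg.2 (hV.monotone (by linarith [left_lt_right M i])))

theorem WaveProfile.abs_sub_le (hV : WaveProfile a b T B k bc V F) (M : Mesh a b) (t : ℝ) (i : Fin M.N) {z y : ℝ}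
    (hz : z ∈ Icc (M.left i - t) (M.right i - t)) (hy : y ∈ Icc (M.left i - t) (M.right i - t)) :
    |iteratedDeriv (k + 2) V y - iteratedDeriv (k + 2) V z| ≤ waveOsc M F t i := by
  wlog hzy : z ≤ y generalizing z y
  · rw [abs_sub_comm]
    exact this hy hz (le_of_not_ge hzy)
  refine Real.abs_le_sqrt ((hV.osc z y hzy).trans ?_)
  have h1 := hV.monotone hz.1
  have h2 := hV.monotone hy.2
  have h3 := hV.monotone hzy
  refine mul_le_mul ?_ (by linarith) (by linarith) (M.len_pos i).le
  have := M.left_add_len i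
  linarith [hz.1, hy.2]

theorem WaveProfile.hasDerivAt_iteratedDeriv (hV : WaveProfile a b T B k bc V F) (x : ℝ) :
    HasDerivAt (iteratedDeriv (k + 1) V) (iteratedDeriv (k + 2) V x) x := by
  have h := (hV.contDiff.differentiable_iteratedDeriv (k + 1) (by exact_mod_cast Nat.lt_succ_self _) x).hasDerivAt
  rwa [← iteratedDeriv_succ] at h

theorem WaveProfile.exists_waveSlope_eq (hV : WaveProfile a b T B k bc V F) (M : Mesh a b) (t : ℝ) (i : Fin M.N) :
    ∃ z ∈ Icc (M.left i - t) (M.right i - t), iteratedDeriv (k + 2) V z = waveSlope M k V t i := by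
  have h1 : M.left i - t < M.right i - t := by linarith [left_lt_right M i]
  obtain ⟨z, hz, h⟩ := exists_hasDerivAt_eq_slope (iteratedDeriv (k + 1) V) (iteratedDeriv (k + 2) V) h1
    (fun x _ => (hV.hasDerivAt_iteratedDeriv x).continuousAt.continuousWithinAt)
    (fun x _ => hV.hasDerivAt_iteratedDeriv x)
  refine ⟨z, Ioo_subset_Icc_self hz, ?_⟩
  rw [h, waveSlope, Mesh.len]
  congr 1
  ring

theorem WaveProfile.abs_waveSlope_le (hV : WaveProfile a b T B k bc V F) (M : Mesh a b) {t : ℝ} (ht : t ∈ Icc 0 T)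
    (i : Fin M.N) : |waveSlope M k V t i| ≤ B := by
  obtain ⟨z, hz, h⟩ := hV.exists_waveSlope_eq M t i
  rw [← h]
  exact hV.bound _ le_rfl z (M.shift_mem i ht hz)

theorem WaveProfile.abs_sub_waveSlope_le (hV : WaveProfile a b T B k bc V F) (M : Mesh a b) (t : ℝ) (i : Fin M.N)
    {y : ℝ} (hy : y ∈ Icc (M.left i - t) (M.right i - t)) :
    |iteratedDeriv (k + 2) V y - waveSlope M k V t i| ≤ waveOsc M F t i := by
  obtain ⟨z, hz, h⟩ := hV.exists_waveSlope_eq M t i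
  rw [← h]
  exact hV.abs_sub_le M t i hz hy

/-- This is why the correction uses a cell mean: a point value of the derivative of order k + 2 need
not be differentiable in time, but its mean is a difference quotient of the derivative of order k +
1. The time derivative of the mean is an oscillation divided by the cell length. -/
theorem WaveProfile.exists_hasDerivAt_waveSlope (hV : WaveProfile a b T B k bc V F) (M : Mesh a b) (t : ℝ)
    (i : Fin M.N) : ∃ d, HasDerivAt (fun t => waveSlope M k V t i) d t ∧ M.len i * |d| ≤ waveOsc M F t i := by
  have h : ∀ x, HasDerivAt (fun t => iteratedDeriv (k + 1) V (x - t)) (-iteratedDeriv (k + 2) V (x - t)) t :=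
    fun x => (hV.hasDerivAt_iteratedDeriv (x - t)).comp_const_sub x t
  refine ⟨_, ((h _).sub (h _)).div_const _, ?_⟩
  have h1 := M.len_pos i
  have h2 : M.left i - t ≤ M.right i - t := by linarith [left_lt_right M i]
  rw [abs_div, abs_of_pos h1, mul_div_cancel₀ _ h1.ne', neg_sub_neg]
  exact hV.abs_sub_le M t i (right_mem_Icc.2 h2) (left_mem_Icc.2 h2)

/-- The sum of the damping coefficients that act on linear functions. -/
def linearDamping (M : Mesh a b) (ρ : Fin (k + 2) → ℝ) (Ne : ℕ) (bc : Boundary) (V : ℝ → ℝ) (t : ℝ) (i : Fin M.N) : ℝ :=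
  ∑ l ∈ Finset.range (k + 1), if l ≤ 1 then waveDamping M ρ Ne bc V t i l else 0

/-- The correction function on the reference cell; `Z` and `W` are the correction functions belonging to the
interpolation error and to linear functions. -/
def waveCorrection (M : Mesh a b) (ρ : Fin (k + 2) → ℝ) (Ne : ℕ) (bc : Boundary) (V : ℝ → ℝ) (Z W : ℝ[X]) (t : ℝ)
    (i : Fin M.N) : ℝ[X] :=
  C (M.len i ^ (k + 2) * waveSlope M k V t i / (k + 1).factorial) * Z +
    C (-(M.len i * deriv V (M.left i - t) * linearDamping M ρ Ne bc V t i)) * W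

theorem natDegree_waveCorrection_le (M : Mesh a b) (ρ : Fin (k + 2) → ℝ) (Ne : ℕ) (bc : Boundary) (V : ℝ → ℝ)
    {Z W : ℝ[X]} (hZ : Z.natDegree ≤ k) (hW : W.natDegree ≤ k) (t : ℝ) (i : Fin M.N) :
    (waveCorrection M ρ Ne bc V Z W t i).natDegree ≤ k :=
  (natDegree_add_le _ _).trans (max_le ((natDegree_C_mul_le _ _).trans hZ) ((natDegree_C_mul_le _ _).trans hW))

theorem eval_waveCorrection_one (M : Mesh a b) (ρ : Fin (k + 2) → ℝ) (Ne : ℕ) (bc : Boundary) (V : ℝ → ℝ)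
    {Z W : ℝ[X]} (hZ : Z.eval 1 = 0) (hW : W.eval 1 = 0) (t : ℝ) (i : Fin M.N) :
    (waveCorrection M ρ Ne bc V Z W t i).eval 1 = 0 := by
  simp [waveCorrection, hZ, hW]

theorem one_le_factorial_cast (n : ℕ) : (1 : ℝ) ≤ n.factorial := by
  exact_mod_cast Nat.one_le_iff_ne_zero.2 n.factorial_ne_zero

/-- Size of the damping coefficients of a wave. -/
theorem exists_waveProfile_damping_bound (hk : 1 ≤ k) (a b c T B : ℝ) (hρ : IsReferencePoints s k ρ) :
    ∃ K : ℝ, 0 ≤ K ∧ ∀ (M : Mesh a b) (Ne : ℕ) (bc : Boundary) (V F : ℝ → ℝ), M.ShapeRegular c → M.size ≤ 1 →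
      1 ≤ Ne → WaveProfile a b T B k bc V F → ∀ t ∈ Icc 0 T, ∀ i, ∀ l ≤ k,
      0 ≤ waveDamping M ρ Ne bc V t i l ∧ waveDamping M ρ Ne bc V t i l ≤ K * M.size ^ (k + 1) ∧
      ∃ d, HasDerivAt (fun t => waveDamping M ρ Ne bc V t i l) d t ∧ |d| ≤ K * M.size ^ (k + 1) := by
  obtain ⟨K, hK0, hK⟩ := exists_waveDamping_bound (a := a) (b := b) hk c B hρ
  refine ⟨K, hK0, fun M Ne bc V F hM hsz hNe hV t ht i l hl => ?_⟩
  have hmem : ∀ z ∈ Icc (a - t) (b - t), z ∈ Icc (a - T) b := fun z hz =>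
    ⟨by linarith [hz.1, ht.2], by linarith [hz.2, ht.1]⟩
  exact hK M Ne bc V t i hM hsz hNe hV.contDiff (fun h l hl => hV.periodic t ht h l (by omega))
    (fun h l hl => by
      rw [← iteratedDeriv_succ']
      exact hV.periodic t ht h (l + 1) (by omega))
    (fun z hz => hV.bound _ (by omega) z (hmem z hz)) (fun z hz => hV.bound _ le_rfl z (hmem z hz)) l hl

/-- Size of the correction function and of its time derivative. -/
theorem exists_waveCorrection_bound (hk : 1 ≤ k) (a b c T B : ℝ) (hρ : IsReferencePoints s k ρ) {Z W : ℝ[X]}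
    (hZ : Z.natDegree ≤ k) (hW : W.natDegree ≤ k) :
    ∃ K : ℝ, 0 ≤ K ∧ ∀ (M : Mesh a b) (Ne : ℕ) (bc : Boundary) (V F : ℝ → ℝ), M.ShapeRegular c → M.size ≤ 1 →
      1 ≤ Ne → WaveProfile a b T B k bc V F → ∀ t ∈ Icc 0 T, ∀ i,
      cnorm k (waveCorrection M ρ Ne bc V Z W t i) ≤ K * M.size ^ (k + 2) ∧
      ∃ p : ℝ[X], p.natDegree ≤ k ∧
        HasCoeffDerivWithinAt (fun t => waveCorrection M ρ Ne bc V Z W t i) p (Icc 0 T) t ∧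
        cnorm k p ≤ K * (M.size ^ (k + 1) * waveOsc M F t i + M.size ^ (k + 2)) := by
  obtain ⟨K, hK0, hK⟩ := exists_waveProfile_damping_bound hk a b c T B hρ
  have hz := cnorm_nonneg k Z
  have hw := cnorm_nonneg k W
  set Q := 2 * (|B| * ((k + 1) * K)) with hQ
  have hQ0 : 0 ≤ Q := by positivity
  refine ⟨(1 + |B|) * cnorm k Z + Q * cnorm k W, by positivity, fun M Ne bc V F hM hsz hNe hV t ht i => ?_⟩
  have hh := M.len_pos i
  have hhH := M.len_le_size i
  have hH : 0 < M.size := hh.trans_le hhH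
  set h := M.len i with hhd
  set H := M.size with hHd
  have hmemL : M.left i - t ∈ Icc (a - T) b :=
    M.shift_mem i ht (left_mem_Icc.2 (by linarith [left_lt_right M i]))
  have hB0 : 0 ≤ B := (abs_nonneg _).trans (hV.bound 1 (by omega) _ hmemL)
  rw [abs_of_nonneg hB0] at *
  have hf := one_le_factorial_cast (k + 1)
  have hV1 : |deriv V (M.left i - t)| ≤ B := by
    rw [← iteratedDeriv_one]
    exact hV.bound 1 (by omega) _ hmemL
  have hV2 : |deriv (deriv V) (M.left i - t)| ≤ B := by
    have := hV.bound 2 (by omega) _ hmemL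
    rwa [iteratedDeriv_succ, iteratedDeriv_one] at this
  have hex : ∀ l, ∃ d, l ≤ k → HasDerivAt (fun t => waveDamping M ρ Ne bc V t i l) d t ∧ |d| ≤ K * H ^ (k + 1) := by
    intro l
    by_cases hl : l ≤ k
    · obtain ⟨d, hd⟩ := (hK M Ne bc V F hM hsz hNe hV t ht i l hl).2.2
      exact ⟨d, fun _ => hd⟩
    · exact ⟨0, fun h => absurd h hl⟩
  choose d hd using hex
  have hmem : ∀ l ∈ Finset.range (k + 1), l ≤ k := fun l hl => Nat.lt_succ_iff.1 (Finset.mem_range.1 hl)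
  have hS0 : 0 ≤ K * H ^ (k + 1) := by positivity
  have hsum : ∀ f : ℕ → ℝ, (∀ l ≤ k, |f l| ≤ K * H ^ (k + 1)) →
      |∑ l ∈ Finset.range (k + 1), if l ≤ 1 then f l else 0| ≤ (k + 1) * K * H ^ (k + 1) := by
    intro f hf
    refine (Finset.abs_sum_le_sum_abs _ _).trans ?_
    calc _ ≤ ∑ _l ∈ Finset.range (k + 1), K * H ^ (k + 1) := Finset.sum_le_sum fun l hl => by
          split_ifs
          · exact hf l (hmem l hl)
          · rwa [abs_zero]
      _ = (k + 1) * K * H ^ (k + 1) := by simp [mul_assoc]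
  have hLb : |linearDamping M ρ Ne bc V t i| ≤ (k + 1) * K * H ^ (k + 1) := hsum _ fun l hl => by
    obtain ⟨h1, h2, -⟩ := hK M Ne bc V F hM hsz hNe hV t ht i l hl
    rwa [abs_of_nonneg h1]
  set L' := ∑ l ∈ Finset.range (k + 1), (if l ≤ 1 then d l else 0) with hL'
  have hL'b : |L'| ≤ (k + 1) * K * H ^ (k + 1) := hsum _ fun l hl => (hd l hl).2
  have hLd : HasDerivAt (fun t => linearDamping M ρ Ne bc V t i) L' t := by
    refine HasDerivAt.fun_sum fun l hl => ?_
    split_ifs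
    · exact (hd l (hmem l hl)).1
    · exact hasDerivAt_const t 0
  have hprod : ∀ x y : ℝ, |x| ≤ B → |y| ≤ (k + 1) * K * H ^ (k + 1) →
      h * |x * y| ≤ B * ((k + 1) * K) * H ^ (k + 2) := fun x y hx hy => by
    rw [abs_mul]
    calc h * (|x| * |y|) ≤ H * (B * ((k + 1) * K * H ^ (k + 1))) :=
          mul_le_mul hhH (mul_le_mul hx hy (abs_nonneg _) hB0) (by positivity) hH.le
      _ = _ := by ring
  have hpow : ∀ n, h ^ n ≤ H ^ n := fun n => pow_le_pow_left₀ hh.le hhH n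
  constructor
  · refine (cnorm_add_le _ _ _).trans ?_
    rw [cnorm_C_mul, cnorm_C_mul]
    have e1 : |h ^ (k + 2) * waveSlope M k V t i / (k + 1).factorial| ≤ B * H ^ (k + 2) := by
      rw [abs_div, abs_mul, abs_of_pos (pow_pos hh _), Nat.abs_cast]
      refine (div_le_self (by positivity) hf).trans ?_
      rw [mul_comm B]
      exact mul_le_mul (hpow _) (hV.abs_waveSlope_le M ht i) (abs_nonneg _) (by positivity)
    have e2 : |-(h * deriv V (M.left i - t) * linearDamping M ρ Ne bc V t i)| ≤ B * ((k + 1) * K) * H ^ (k + 2) := by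
      rw [abs_neg, mul_assoc, abs_mul, abs_of_pos hh]
      exact hprod _ _ hV1 hLb
    have e3 := mul_le_mul_of_nonneg_right e1 hz
    have e4 := mul_le_mul_of_nonneg_right e2 hw
    have e5 : 0 ≤ H ^ (k + 2) * cnorm k Z := by positivity
    have e6 : 0 ≤ B * ((k + 1) * K) * H ^ (k + 2) * cnorm k W := by positivity
    rw [hQ]
    linarith
  · obtain ⟨q', hq', hq'b⟩ := hV.exists_hasDerivAt_waveSlope M t i
    have hV'd : Differentiable ℝ (deriv V) := by
      have := hV.contDiff.differentiable_iteratedDeriv 1 (by exact_mod_cast (by omega : 1 < k + 2))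
      rwa [iteratedDeriv_one] at this
    have hβ := (((hasDerivAt_wave hV'd (M.left i) t).const_mul h).mul hLd).neg
    have hα := (hq'.const_mul (h ^ (k + 2))).div_const ((k + 1).factorial : ℝ)
    refine ⟨_, ?_, (hasCoeffDerivWithinAt_C_mul hα.hasDerivWithinAt Z).add
      (hasCoeffDerivWithinAt_C_mul hβ.hasDerivWithinAt W), ?_⟩
    · exact (natDegree_add_le _ _).trans
        (max_le ((natDegree_C_mul_le _ _).trans hZ) ((natDegree_C_mul_le _ _).trans hW))
    · refine (cnorm_add_le _ _ _).trans ?_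
      rw [cnorm_C_mul, cnorm_C_mul]
      set o := waveOsc M F t i with ho
      have ho0 : 0 ≤ o := Real.sqrt_nonneg _
      have e1 : |h ^ (k + 2) * q' / (k + 1).factorial| ≤ H ^ (k + 1) * o := by
        rw [abs_div, abs_mul, abs_of_pos (pow_pos hh _), Nat.abs_cast]
        refine (div_le_self (by positivity) hf).trans ?_
        rw [pow_succ, mul_assoc]
        exact mul_le_mul (hpow _) hq'b (by positivity) (by positivity)
      have e2 : |-(h * -deriv (deriv V) (M.left i - t) * linearDamping M ρ Ne bc V t i +
          h * deriv V (M.left i - t) * L')| ≤ Q * H ^ (k + 2) := by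
        rw [abs_neg]
        refine (abs_add_le _ _).trans ?_
        rw [mul_assoc, mul_assoc, abs_mul, abs_mul h, abs_of_pos hh]
        have g1 := hprod (-deriv (deriv V) (M.left i - t)) _ (by rwa [abs_neg]) hLb
        have g2 := hprod _ _ hV1 hL'b
        rw [hQ]
        linarith
      have e3 := mul_le_mul_of_nonneg_right e1 hz
      have e4 := mul_le_mul_of_nonneg_right e2 hw
      have e5 : 0 ≤ B * cnorm k Z * (H ^ (k + 1) * o + H ^ (k + 2)) := by positivity
      have e6 : 0 ≤ H ^ (k + 2) * cnorm k Z := by positivity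
      have e7 : 0 ≤ Q * cnorm k W * (H ^ (k + 1) * o) := by positivity
      refine (add_le_add e3 e4).trans ?_
      linarith

end Wave

end OFSV

/-! ### Energy estimate on one cell. -/

namespace OFSV

section Defect

variable {a b c T B : ℝ} {k : ℕ} {bc : Boundary} {V F : ℝ → ℝ} {s : Scheme} {ρ : Fin (k + 2) → ℝ}

/-- The difference, on the reference cell, of a discrete function and the corrected interpolant of a wave. -/
def waveDefect (M : Mesh a b) (ρ : Fin (k + 2) → ℝ) (Ne : ℕ) (bc : Boundary) (V : ℝ → ℝ) (Z W : ℝ[X])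
    (p : Fin M.N → ℝ[X]) (t : ℝ) (i : Fin M.N) : ℝ[X] :=
  pull M i (p i) - refInterp ρ (fun y => V (M.left i - t + M.len i * y)) + waveCorrection M ρ Ne bc V Z W t i

theorem natDegree_interp_le (M : Mesh a b) (hρ : IsReferencePoints s k ρ) (v : ℝ → ℝ) (i : Fin M.N) :
    (interp M ρ v i).natDegree ≤ k := by
  have hinj : Set.InjOn (fun j : Fin (k + 1) => pt M ρ i j.succ) (Finset.univ : Finset (Fin (k + 1))) := by
    intro j _ j' _ h
    have h1 : M.len i * ρ j.succ = M.len i * ρ j'.succ := by simpa [pt] using h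
    exact Fin.succ_injective _ (hρ.strictMono.injective (mul_left_cancel₀ (M.len_pos i).ne' h1))
  refine natDegree_le_of_degree_le ((Lagrange.degree_interpolate_le _ hinj).trans ?_)
  simp

theorem natDegree_waveDefect_le (M : Mesh a b) (hρ : IsReferencePoints s k ρ) (Ne : ℕ) (bc : Boundary) (V : ℝ → ℝ)
    {Z W : ℝ[X]} (hZ : Z.natDegree ≤ k) (hW : W.natDegree ≤ k) {p : Fin M.N → ℝ[X]} (t : ℝ) {i : Fin M.N}
    (hp : (p i).natDegree ≤ k) : (waveDefect M ρ Ne bc V Z W p t i).natDegree ≤ k :=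
  (natDegree_add_le _ _).trans (max_le ((natDegree_sub_le _ _).trans
    (max_le (natDegree_pull_le M i hp) (natDegree_refInterp_le hρ _))) (natDegree_waveCorrection_le M ρ Ne bc V hZ hW t i))

/-- The time derivative of a curve of polynomials of degree at most `k`. -/
def timeDeriv (k : ℕ) (p : ℝ → ℝ[X]) (S : Set ℝ) (t : ℝ) : ℝ[X] :=
  ∑ n ∈ Finset.range (k + 1), C (derivWithin (fun r => (p r).coeff n) S t) * X ^ n

theorem natDegree_timeDeriv_le (p : ℝ → ℝ[X]) (S : Set ℝ) (t : ℝ) : (timeDeriv k p S t).natDegree ≤ k :=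
  natDegree_sum_le_of_forall_le _ _ fun _ hn =>
    (natDegree_C_mul_X_pow_le _ _).trans (Nat.lt_succ_iff.1 (Finset.mem_range.1 hn))

theorem hasCoeffDerivWithinAt_timeDeriv {p : ℝ → ℝ[X]} {S : Set ℝ} {t : ℝ} (ht : t ∈ S)
    (hp : ∀ r ∈ S, (p r).natDegree ≤ k) (hd : ∀ n, DifferentiableOn ℝ (fun r => (p r).coeff n) S) :
    HasCoeffDerivWithinAt p (timeDeriv k p S t) S t := by
  intro n
  have hc : (timeDeriv k p S t).coeff n = if n ≤ k then derivWithin (fun r => (p r).coeff n) S t else 0 := by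
    simp only [timeDeriv, finsetSum_coeff, coeff_C_mul, coeff_X_pow, mul_ite, mul_one, mul_zero]
    rw [Finset.sum_ite_eq]
    simp only [Finset.mem_range, Nat.lt_succ_iff]
  rw [hc]
  split_ifs with hn
  · exact (hd n t ht).hasDerivWithinAt
  · have h0 : ∀ r ∈ S, (p r).coeff n = 0 := fun r hr =>
      coeff_eq_zero_of_natDegree_lt ((hp r hr).trans_lt (not_le.1 hn))
    exact (hasDerivWithinAt_const t S (0 : ℝ)).congr h0 (h0 t ht)

theorem hasCoeffDerivWithinAt_refInterp (ρ : Fin (k + 2) → ℝ) (hV : Differentiable ℝ V) (x h t : ℝ) (S : Set ℝ) :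
    HasCoeffDerivWithinAt (fun t => refInterp ρ fun y => V (x - t + h * y))
      (-refInterp ρ fun y => deriv V (x - t + h * y)) S t := by
  have e : (-refInterp ρ fun y => deriv V (x - t + h * y)) = ∑ j : Fin (k + 1),
      C (-deriv V (x - t + h * ρ j.succ)) * Lagrange.basis Finset.univ (fun j : Fin (k + 1) => ρ j.succ) j := by
    rw [refInterp_eq_sum, ← Finset.sum_neg_distrib]
    simp
  rw [e]
  simp only [refInterp_eq_sum]
  refine hasCoeffDerivWithinAt_sum fun j _ => hasCoeffDerivWithinAt_C_mul (HasDerivAt.hasDerivWithinAt ?_) _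
  have h1 := hasDerivAt_wave hV (x + h * ρ j.succ) t
  have e1 : ∀ t, x + h * ρ j.succ - t = x - t + h * ρ j.succ := fun t => by ring
  simpa only [e1] using h1

/-- The convective part of the scheme on one cell, with exterior value `V x + l`. -/
theorem flux_lower_bound (hρ : IsReferencePoints s k ρ)
    (hsum : ∀ (p v : ℝ[X]) (c : ℝ), p.natDegree ≤ k → v.natDegree ≤ k →
      ∑ j : Fin (k + 1), refStar s ρ v j * (p.eval (ρ j.succ) - if j = 0 then c else p.eval (ρ j.castSucc)) =
        p.eval 1 * v.eval 1 - c * v.eval 0 - integ 0 1 (p * derivative v))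
    (hV : ContDiff ℝ 1 V) (x h l : ℝ) {P ω ξ : ℝ[X]} (hω : ω.natDegree ≤ k) (hω1 : ω.eval 1 = 0) (hξ : ξ.natDegree ≤ k)
    (hP : P = refInterp ρ (fun y => V (x + h * y)) - ω + ξ) :
    h * refPairing s ρ (fun y => deriv V (x + h * y)) ξ + integ 0 1 (ω * derivative ξ) +
        (ξ.eval 1 ^ 2 - l ^ 2) / 2 ≤
      ∑ j : Fin (k + 1), refStar s ρ ξ j *
        (P.eval (ρ j.succ) - if j = 0 then V x + l else P.eval (ρ j.castSucc)) := by
  -- Interpolation is exact at the right end of every control volume, and the exterior value is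
  -- measured from the wave, so the flux differences of `P` are exact integrals of the derivative of
  -- the wave plus the differences of `ξ - ω`. The left end of the cell is no interpolation point,
  -- which is harmless because an upwind flux does not use the inner value there.
  have hterm : ∀ j : Fin (k + 1), P.eval (ρ j.succ) - (if j = 0 then V x + l else P.eval (ρ j.castSucc)) =
      h * (∫ y in (ρ j.castSucc)..(ρ j.succ), deriv V (x + h * y)) +
      ((ξ - ω).eval (ρ j.succ) - if j = 0 then l else (ξ - ω).eval (ρ j.castSucc)) := by
    intro j
    have hint : h * (∫ y in (ρ j.castSucc)..(ρ j.succ), deriv V (x + h * y)) =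
        V (x + h * ρ j.succ) - V (x + h * ρ j.castSucc) := by
      rw [intervalIntegral.mul_integral_comp_add_mul (f := deriv V)]
      exact intervalIntegral.integral_deriv_eq_sub (fun y _ => hV.differentiable one_ne_zero y)
        ((hV.continuous_deriv le_rfl).intervalIntegrable _ _)
    have hIs := eval_refInterp hρ (fun y => V (x + h * y)) j
    rw [hint, hP, eval_add, eval_sub, hIs]
    by_cases hj : j = 0
    · rw [if_pos hj, if_pos hj, hj, Fin.castSucc_zero, hρ.first, eval_sub]
      ring_nf
    · obtain ⟨j', hj'⟩ := Fin.exists_succ_eq.2 (fun h0 => hj (Fin.castSucc_eq_zero_iff.1 h0))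
      rw [if_neg hj, if_neg hj, ← hj', eval_add, eval_sub, eval_refInterp hρ, eval_sub, eval_sub]
      ring
  have h1 := hsum (ξ - ω) ξ l ((natDegree_sub_le _ _).trans (max_le hξ hω)) hξ
  have h2 := integ_derivative_mul 0 1 ξ ξ
  rw [mul_comm (derivative ξ)] at h2
  simp only [hterm, mul_add, Finset.sum_add_distrib]
  rw [h1, refPairing, Finset.mul_sum, sub_mul, map_sub, eval_sub, hω1]
  have h3 : ∑ j : Fin (k + 1), refStar s ρ ξ j * (h * ∫ y in (ρ j.castSucc)..(ρ j.succ), deriv V (x + h * y)) =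
      ∑ j : Fin (k + 1), h * (refStar s ρ ξ j * ∫ y in (ρ j.castSucc)..(ρ j.succ), deriv V (x + h * y)) :=
    Finset.sum_congr rfl fun j _ => by ring
  rw [h3]
  -- The boundary terms add up to (ξ(1)² - l²)/2 + (ξ(0) - l)²/2; the last square is the dissipation
  -- of the upwind flux and is dropped.
  have h4 : 0 ≤ (ξ.eval 0 - l) ^ 2 := sq_nonneg _
  linarith

/-- The right end of a cell is an interpolation point and the correction vanishes there, so at
downwind points the defect is the whole error up to sign. -/
theorem eval_pull_eq_of_defect (M : Mesh a b) (hρ : IsReferencePoints s k ρ) (Ne : ℕ) (bc : Boundary) (V : ℝ → ℝ)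
    {Z W : ℝ[X]} (hZ1 : Z.eval 1 = 0) (hW1 : W.eval 1 = 0) (p : Fin M.N → ℝ[X]) (t : ℝ) (i : Fin M.N) :
    (p i).eval (M.right i) = V (M.right i - t) + (waveDefect M ρ Ne bc V Z W p t i).eval 1 := by
  rw [waveDefect, eval_add, eval_sub, eval_waveCorrection_one M ρ Ne bc V hZ1 hW1, eval_refInterp_one hρ, eval_pull,
    mul_one, M.left_add_len, show M.left i - t + M.len i = M.right i - t by linarith [M.left_add_len i]]
  ring

/-- The exterior values of a discrete function at the left end of a cell. -/
theorem exists_leftLimit_eq (M : Mesh a b) (hρ : IsReferencePoints s k ρ) (Ne : ℕ) {Z W : ℝ[X]} (hZ1 : Z.eval 1 = 0)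
    (hW1 : W.eval 1 = 0) {u : ℝ → ℝ → ℝ} (hbc : bc.Holds a b T u) {t : ℝ} (ht : t ∈ Icc 0 T)
    (hu : u a t = V (a - t)) (hV : WaveProfile a b T B k bc V F) (p : Fin M.N → ℝ[X]) (i : Fin M.N) :
    ∃ l : ℝ, l ^ 2 ≤ (waveDefect M ρ Ne bc V Z W p t (M.prev i)).eval 1 ^ 2 ∧ ∀ j : Fin (k + 1),
      leftLimit M ρ bc t p i j.succ - leftLimit M ρ bc t p i j.castSucc =
        (pull M i (p i)).eval (ρ j.succ) -
          if j = 0 then V (M.left i - t) + l else (pull M i (p i)).eval (ρ j.castSucc) := by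
  have hint : M.right (M.prev i) = M.left i ∨ (bc = .periodic ∧ M.right (M.prev i) = b ∧ M.left i = a) →
      (p (M.prev i)).eval (M.right (M.prev i)) =
        V (M.left i - t) + (waveDefect M ρ Ne bc V Z W p t (M.prev i)).eval 1 := by
    intro h
    rw [eval_pull_eq_of_defect M hρ Ne bc V hZ1 hW1]
    congr 1
    rcases h with h | ⟨h1, h2, h3⟩
    · rw [h]
    · rw [h2, h3]
      simpa using (hV.periodic t ht h1 0 (Nat.zero_le _)).symm
  have key : ∀ l, l ^ 2 ≤ (waveDefect M ρ Ne bc V Z W p t (M.prev i)).eval 1 ^ 2 →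
      leftLimit M ρ bc t p i 0 = V (M.left i - t) + l → ∃ l : ℝ,
      l ^ 2 ≤ (waveDefect M ρ Ne bc V Z W p t (M.prev i)).eval 1 ^ 2 ∧ ∀ j : Fin (k + 1),
      leftLimit M ρ bc t p i j.succ - leftLimit M ρ bc t p i j.castSucc =
        (pull M i (p i)).eval (ρ j.succ) -
          if j = 0 then V (M.left i - t) + l else (pull M i (p i)).eval (ρ j.castSucc) := by
    intro l hl h
    refine ⟨l, hl, fun j => ?_⟩
    congr 1
    · unfold leftLimit
      rw [if_neg (Fin.succ_ne_zero j), eval_pull, pt]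
    · by_cases hj : j = 0
      · rw [if_pos hj, hj, Fin.castSucc_zero, h]
      · unfold leftLimit
        rw [if_neg hj, if_neg (fun h0 => hj (Fin.castSucc_eq_zero_iff.1 h0)), eval_pull, pt]
  cases bc with
  | periodic =>
    refine key _ le_rfl (Eq.trans ?_ (hint ?_))
    · simp [leftLimit]
    · by_cases hi : i.val = 0
      · exact Or.inr ⟨rfl, M.right_prev_first hi, M.left_eq_a hi⟩
      · exact Or.inl (M.right_prev hi)
  | inflow g =>
    by_cases hi : i.val = 0
    -- The inflow value is exact, so `l = 0`. The bound by the square at the cyclic predecessor is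
    -- wasteful here, but it lets the flux terms telescope around the mesh for both boundary
    -- conditions.
    · refine key 0 (by simpa using sq_nonneg _) ?_
      rw [M.left_eq_a hi, add_zero, ← hu, hbc t ht]
      simp [leftLimit, hi]
    · refine key _ le_rfl (Eq.trans ?_ (hint (Or.inl (M.right_prev hi))))
      simp [leftLimit, hi]

theorem cnorm_pull_sub_waveInterp_le (M : Mesh a b) (hρ : IsReferencePoints s k ρ) (Ne : ℕ) (bc : Boundary)
    (V : ℝ → ℝ) (Z W : ℝ[X]) (p : Fin M.N → ℝ[X]) (t : ℝ) (i : Fin M.N) :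
    cnorm k (pull M i (p i - waveInterp M ρ V t i)) ≤
      cnorm k (waveDefect M ρ Ne bc V Z W p t i) + cnorm k (waveCorrection M ρ Ne bc V Z W t i) := by
  have : pull M i (p i - waveInterp M ρ V t i) =
      waveDefect M ρ Ne bc V Z W p t i - waveCorrection M ρ Ne bc V Z W t i := by
    rw [pull_sub, pull_waveInterp M hρ, waveDefect, add_sub_cancel_right]
  rw [this]
  exact cnorm_sub_le _ _ _

/-- The contribution of a cell to the form of the scheme. -/
def cellForm (M : Mesh a b) (ρ : Fin (k + 2) → ℝ) (Ne : ℕ) (T : ℝ) (bc : Boundary) (v : ℝ → Fin M.N → ℝ[X]) (t : ℝ)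
    (w : Fin M.N → Fin (k + 1) → ℝ) (i : Fin M.N) : ℝ :=
  cellPairing M ρ i (fun x => derivWithin (fun s => (v s i).eval x) (Icc 0 T) t) (w i) +
    ∑ j : Fin (k + 1), w i j * (leftLimit M ρ bc t (v t) i j.succ - leftLimit M ρ bc t (v t) i j.castSucc) +
    dampingForm M ρ (damping M k Ne bc t (v t) i) i (v t i) (w i)

/-- Bookkeeping of orders with `S = K H^(k+1)` and `δ = D R`, where `R` dominates `H^(k+2)`. Each
product keeps one factor `h`; the term quadratic in `S` is small enough because 2(k + 1) ≥ k + 2. -/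
theorem residual_error_le {h H o B D R K : ℝ} (hh : 0 < h) (hhH : h ≤ H) (hsz : H ≤ 1) (ho0 : 0 ≤ o) (hB0 : 0 ≤ B)
    (hD0 : 0 ≤ D) (hK₃ : 0 ≤ K) (hHR : H ^ (k + 2) ≤ R) :
    h ^ (k + 2) * o + h * (D * R) * B + (K * H ^ (k + 1) + D * R) * (h ^ 2 * B + h * (K * H ^ (k + 1)) * B) ≤
      (1 + (B * D + (B + K * B) * D + K * (B + K * B))) * (h * (H ^ (k + 1) * o + R)) := by
  have hH : 0 < H := hh.trans_le hhH
  have hR0 : 0 ≤ R := (by positivity : 0 ≤ H ^ (k + 2)).trans hHR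
  have hpow : h ^ (k + 2) * o ≤ h * (H ^ (k + 1) * o) := by
    rw [pow_succ']
    have := mul_le_mul_of_nonneg_left (pow_le_pow_left₀ hh.le hhH (k + 1)) hh.le
    calc _ ≤ h * H ^ (k + 1) * o := mul_le_mul_of_nonneg_right this ho0
      _ = _ := by ring
  have hHk1 : H ^ (k + 1) ≤ 1 := pow_le_one₀ hH.le hsz
  have hHk0 : 0 ≤ H ^ (k + 1) := by positivity
  have hS1 : K * H ^ (k + 1) ≤ K := mul_le_of_le_one_right hK₃ hHk1
  have hSS : K * H ^ (k + 1) * (h * B + K * H ^ (k + 1) * B) ≤ K * (B + K * B) * R := by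
    have f1 : H ^ (k + 1) * h ≤ R := by
      refine le_trans ?_ hHR
      rw [pow_succ _ (k + 1)]
      exact mul_le_mul_of_nonneg_left hhH hHk0
    have f2 : H ^ (k + 1) * H ^ (k + 1) ≤ R := by
      refine le_trans ?_ hHR
      rw [← pow_add]
      exact pow_le_pow_of_le_one hH.le hsz (by omega)
    have f3 := mul_le_mul_of_nonneg_left f1 (mul_nonneg hK₃ hB0)
    have f4 := mul_le_mul_of_nonneg_left f2 (mul_nonneg hK₃ (mul_nonneg hK₃ hB0))
    linarith
  have hδS : D * R * (h * B + K * H ^ (k + 1) * B) ≤ (B + K * B) * D * R := by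
    have f1 : h * B + K * H ^ (k + 1) * B ≤ B + K * B :=
      add_le_add (mul_le_of_le_one_left hB0 (hhH.trans hsz)) (mul_le_mul_of_nonneg_right hS1 hB0)
    have f2 := mul_le_mul_of_nonneg_left f1 (mul_nonneg hD0 hR0)
    linarith
  have f1 := mul_le_mul_of_nonneg_left (add_le_add hSS hδS) hh.le
  have f2 : 0 ≤ (B * D + (B + K * B) * D + K * (B + K * B)) * (h * (H ^ (k + 1) * o)) := by positivity
  have f3 : 0 ≤ h * R := by positivity
  linarith

theorem correction_error_le {h H o n R K K' x : ℝ} (hh : 0 < h) (hK : 0 ≤ K) (hK' : 0 ≤ K') (hn : 0 ≤ n)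
    (hHR : H ^ (k + 2) ≤ R) (hx : |x| ≤ K * (K' * (H ^ (k + 1) * o + H ^ (k + 2))) * n) :
    h * x ≤ K * K' * (h * n * (H ^ (k + 1) * o + R)) := by
  have f1 : 0 ≤ K * K' * (h * n) := by positivity
  have f2 := mul_le_mul_of_nonneg_left hHR f1
  have f3 := mul_le_mul_of_nonneg_left ((le_abs_self x).trans hx) hh.le
  linarith

/-- The energy estimate on one cell. -/
theorem exists_cellForm_lower_bound (hk : 1 ≤ k) (a b c T B : ℝ) (hT : 0 < T) (hρ : IsReferencePoints s k ρ)
    {Z W : ℝ[X]} (hZ : Z.natDegree ≤ k) (hW : W.natDegree ≤ k) (hZ1 : Z.eval 1 = 0) (hW1 : W.eval 1 = 0)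
    (hZe : ∀ v : ℝ[X], v.natDegree ≤ k →
      integ 0 1 (Z * derivative v) = refPairing s ρ (fun y => (refError ρ).eval y) v)
    (hWe : ∀ v : ℝ[X], v.natDegree ≤ k →
      integ 0 1 (W * derivative v) = refPairing s ρ (fun y => centered.eval y) v)
    {κ : ℝ} (hpair : ∀ p v : ℝ[X], p.natDegree ≤ k → v.natDegree ≤ k →
      refPairing s ρ (fun y => p.eval y) v = energyForm κ k p v)
    (hsum : ∀ (p v : ℝ[X]) (c : ℝ), p.natDegree ≤ k → v.natDegree ≤ k →
      ∑ j : Fin (k + 1), refStar s ρ v j * (p.eval (ρ j.succ) - if j = 0 then c else p.eval (ρ j.castSucc)) =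
        p.eval 1 * v.eval 1 - c * v.eval 0 - integ 0 1 (p * derivative v)) :
    ∃ K : ℝ, 0 ≤ K ∧ ∀ (M : Mesh a b) (Ne : ℕ) (bc : Boundary) (V F : ℝ → ℝ) (u : ℝ → ℝ → ℝ)
      (uh : ℝ → Fin M.N → ℝ[X]), M.ShapeRegular c → M.size ≤ 1 → 1 ≤ Ne → WaveProfile a b T B k bc V F →
      bc.Holds a b T u → (∀ t ∈ Icc 0 T, u a t = V (a - t)) →
      (∀ t ∈ Icc 0 T, ∀ i, (uh t i).natDegree ≤ k) →
      (∀ i n, DifferentiableOn ℝ (fun t => (uh t i).coeff n) (Icc 0 T)) → ∀ t ∈ Icc 0 T, ∀ i, ∃ ξ' : ℝ[X],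
      ξ'.natDegree ≤ k ∧
      HasCoeffDerivWithinAt (fun t => waveDefect M ρ Ne bc V Z W (uh t) t i) ξ' (Icc 0 T) t ∧
      M.len i * energyForm κ k ξ' (waveDefect M ρ Ne bc V Z W (uh t) t i) +
        ((waveDefect M ρ Ne bc V Z W (uh t) t i).eval 1 ^ 2 -
          (waveDefect M ρ Ne bc V Z W (uh t) t (M.prev i)).eval 1 ^ 2) / 2 -
        K * (M.len i * cnorm k (waveDefect M ρ Ne bc V Z W (uh t) t i) *
          (M.size ^ (k + 1) * waveOsc M F t i + cnorm k (waveDefect M ρ Ne bc V Z W (uh t) t i) +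
            cnorm k (waveDefect M ρ Ne bc V Z W (uh t) t (M.prev i)) +
            cnorm k (waveDefect M ρ Ne bc V Z W (uh t) t (M.next i)) + M.size ^ (k + 2))) ≤
      cellForm M ρ Ne T bc uh t
        (fun i => star M ρ s i (push M i (waveDefect M ρ Ne bc V Z W (uh t) t i))) i := by
  obtain ⟨K₁, hK₁, hb⟩ := exists_abs_refPairing_le (s := s) hρ
  obtain ⟨K₂, hK₂, hres⟩ := exists_cell_residual_bound hk hρ hZ hW hZe hWe
  obtain ⟨K₃, hK₃, hwd⟩ := exists_waveProfile_damping_bound hk a b c T B hρ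
  obtain ⟨K₄, hK₄, hwc⟩ := exists_waveCorrection_bound hk a b c T B hρ hZ hW
  obtain ⟨K₅, hK₅, hlip⟩ := exists_abs_damping_sub_le (a := a) (b := b) k hk c
  -- The discrete solution differs from the interpolant by the defect minus the correction. Three
  -- neighbouring corrections, each at most `K₄ H^(k+2)`, and the regularization account for the
  -- factor.
  set D := K₅ * (3 * K₄ + 1) with hD
  have hD0 : 0 ≤ D := by positivity
  set A := |B| * D + (|B| + K₃ * |B|) * D + K₃ * (|B| + K₃ * |B|) with hA
  have hA0 : 0 ≤ A := by positivity
  refine ⟨K₁ * K₄ + K₂ * (1 + A), by positivity, ?_⟩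
  intro M Ne bc V F u uh hM hsz hNe hV hbc hu hdeg hdiff t ht i
  have hh := M.len_pos i
  have hhH := M.len_le_size i
  have hH : 0 < M.size := hh.trans_le hhH
  have hmemL : M.left i - t ∈ Icc (a - T) b :=
    M.shift_mem i ht (left_mem_Icc.2 (by linarith [left_lt_right M i]))
  have hB0 : 0 ≤ B := (abs_nonneg _).trans (hV.bound 1 (by omega) _ hmemL)
  rw [abs_of_nonneg hB0] at hA
  obtain ⟨-, p', hp'deg, hp', hp'b⟩ := hwc M Ne bc V F hM hsz hNe hV t ht i
  obtain ⟨l, hl, hleft⟩ := exists_leftLimit_eq M hρ Ne hZ1 hW1 hbc ht (hu t ht) hV (uh t) i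
  set P' := timeDeriv k (fun t => uh t i) (Icc 0 T) t with hP'
  have hP'deg : P'.natDegree ≤ k := natDegree_timeDeriv_le _ _ _
  have hP'd : HasCoeffDerivWithinAt (fun t => uh t i) P' (Icc 0 T) t :=
    hasCoeffDerivWithinAt_timeDeriv ht (fun r hr => hdeg r hr i) (hdiff i)
  have hV1 : ContDiff ℝ 1 V := hV.contDiff.of_le (by exact_mod_cast (by omega : 1 ≤ k + 2))
  set J := refInterp ρ (fun y => deriv V (M.left i - t + M.len i * y)) with hJ
  have hJdeg : J.natDegree ≤ k := natDegree_refInterp_le hρ _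
  have hξ'deg : (pull M i P' - -J + p').natDegree ≤ k := (natDegree_add_le _ _).trans (max_le
    ((natDegree_sub_le _ _).trans (max_le (natDegree_pull_le M i hP'deg) (by rwa [natDegree_neg]))) hp'deg)
  refine ⟨pull M i P' - -J + p', hξ'deg,
    ((hP'd.pull M i ht (fun r hr => hdeg r hr i) hP'deg).sub
      (hasCoeffDerivWithinAt_refInterp ρ (hV1.differentiable one_ne_zero) _ _ _ _)).add hp', ?_⟩
  have hξdeg : ∀ j, (waveDefect M ρ Ne bc V Z W (uh t) t j).natDegree ≤ k := fun j =>
    natDegree_waveDefect_le M hρ Ne bc V hZ hW t (hdeg t ht j)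
  set ω := waveCorrection M ρ Ne bc V Z W t i with hω
  have hωdeg : ω.natDegree ≤ k := natDegree_waveCorrection_le M ρ Ne bc V hZ hW t i
  have hP : pull M i (uh t i) = refInterp ρ (fun y => V (M.left i - t + M.len i * y)) - ω +
      waveDefect M ρ Ne bc V Z W (uh t) t i := by
    rw [waveDefect]
    ring
  have hxle : ∀ j, cnorm k (pull M j (uh t j - waveInterp M ρ V t j)) ≤
      cnorm k (waveDefect M ρ Ne bc V Z W (uh t) t j) + K₄ * M.size ^ (k + 2) := fun j =>
    (cnorm_pull_sub_waveInterp_le M hρ Ne bc V Z W (uh t) t j).trans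
      (add_le_add le_rfl (hwc M Ne bc V F hM hsz hNe hV t ht j).1)
  set ξ := waveDefect M ρ Ne bc V Z W (uh t) t with hξ
  clear_value ξ
  have n1 := cnorm_nonneg k (ξ i)
  have n2 := cnorm_nonneg k (ξ (M.prev i))
  have n3 := cnorm_nonneg k (ξ (M.next i))
  set R := cnorm k (ξ i) + cnorm k (ξ (M.prev i)) + cnorm k (ξ (M.next i)) + M.size ^ (k + 2) with hR
  have n4 : 0 < M.size ^ (k + 2) := pow_pos hH _
  have hR0 : 0 ≤ R := add_nonneg (add_nonneg (add_nonneg n1 n2) n3) n4.le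
  have hHR : M.size ^ (k + 2) ≤ R := by linarith
  have hδ : ∀ m ≤ k, |damping M k Ne bc t (uh t) i m - waveDamping M ρ Ne bc V t i m| ≤ D * R := by
    intro m hm
    refine (hlip M ρ Ne bc V t (uh t) i hM hNe (fun m => jumpLeft_waveBoundary M hbc ht (hu t ht) _ _ _)
      (fun j => (natDegree_sub_le _ _).trans (max_le (hdeg t ht j) (natDegree_interp_le M hρ _ j))) m hm).trans ?_
    rw [hD, mul_assoc]
    refine mul_le_mul_of_nonneg_left ?_ hK₅
    have e1 := hxle i
    have e2 := hxle (M.prev i)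
    have e3 := hxle (M.next i)
    have e4 : 0 ≤ 3 * K₄ * (cnorm k (ξ i) + cnorm k (ξ (M.prev i)) + cnorm k (ξ (M.next i))) :=
      mul_nonneg (mul_nonneg zero_le_three hK₄) (add_nonneg (add_nonneg n1 n2) n3)
    rw [hR]
    linarith
  have hτ : ∀ m ≤ k, |waveDamping M ρ Ne bc V t i m| ≤ K₃ * M.size ^ (k + 1) := fun m hm => by
    obtain ⟨g1, g2, -⟩ := hwd M Ne bc V F hM hsz hNe hV t ht i m hm
    rwa [abs_of_nonneg g1]
  have hσ : ∀ m ≤ k, 0 ≤ damping M k Ne bc t (uh t) i m := fun m _ => by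
    rw [damping_eq M hH.le]
    exact mul_nonneg (dampingFactor_nonneg hk m) (regSqrt_nonneg _ _ _ _)
  have hcell : ∀ z ∈ Icc (M.left i - t) (M.left i - t + M.len i), z ∈ Icc (M.left i - t) (M.right i - t) :=
    fun z hz => ⟨hz.1, by linarith [hz.2, M.left_add_len i]⟩
  have hmain := hres V (M.left i - t) (M.len i) (waveSlope M k V t i) (waveOsc M F t i) B (D * R)
    (K₃ * M.size ^ (k + 1)) (damping M k Ne bc t (uh t) i) (fun m => waveDamping M ρ Ne bc V t i m)
    (pull M i (uh t i)) (ξ i) ω (fun m => projError M i (m - 1) (uh t i)) hh (hhH.trans hsz) hV.contDiff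
    (fun z hz => hV.bound 2 (by omega) z (M.shift_mem i ht (hcell z hz)))
    (by simpa using hV.bound 1 (by omega) _ hmemL) (hV.abs_waveSlope_le M ht i)
    (fun z hz => hV.abs_sub_waveSlope_le M t i (hcell z hz)) hσ hδ hτ rfl (hξdeg i) hP
    (fun m hm => ⟨natDegree_projError_le M i (by omega) (hdeg t ht i), natDegree_pull_sub_projError_le M i _ _,
      fun r hr => integ_projError_mul M i _ _ hr⟩)
  have hflux := flux_lower_bound hρ hsum hV1 (M.left i - t) (M.len i) l hωdeg
    (eval_waveCorrection_one M ρ Ne bc V hZ1 hW1 t i) (hξdeg i) hP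
  have hder : ∀ y, derivWithin (fun r => (uh r i).eval (M.left i + M.len i * y)) (Icc 0 T) t =
      (pull M i P').eval y := fun y => by
    rw [eval_pull]
    exact (hP'd.eval ht (fun r hr => hdeg r hr i) hP'deg _).derivWithin (uniqueDiffOn_Icc hT t ht)
  -- The time derivative of the discrete solution is that of the defect, minus the interpolant of
  -- V', minus that of the correction. The first gives the growth of the energy; the second joins
  -- the flux of the exact wave to form the interpolation error in `hmain`.
  have hsplit : refPairing s ρ (fun y => (pull M i P').eval y) (ξ i) =
      energyForm κ k (pull M i P' - -J + p') (ξ i) - refPairing s ρ (fun y => J.eval y) (ξ i) -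
        refPairing s ρ (fun y => p'.eval y) (ξ i) := by
    rw [← hpair _ _ hξ'deg (hξdeg i), refPairing_poly_add, sub_neg_eq_add, refPairing_poly_add]
    ring
  have hJsub : refPairing s ρ (fun y => J.eval y - deriv V (M.left i - t + M.len i * y)) (ξ i) =
      refPairing s ρ (fun y => J.eval y) (ξ i) -
        refPairing s ρ (fun y => deriv V (M.left i - t + M.len i * y)) (ξ i) :=
    refPairing_sub_left J.continuous ((hV1.continuous_deriv le_rfl).comp (by fun_prop)) _
  have hp'pair : |refPairing s ρ (fun y => p'.eval y) (ξ i)| ≤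
      K₁ * (K₄ * (M.size ^ (k + 1) * waveOsc M F t i + M.size ^ (k + 2))) * cnorm k (ξ i) :=
    (hb _ _ _ (hξdeg i) fun y hy => abs_eval_le hp'deg hy).trans
      (mul_le_mul_of_nonneg_right (mul_le_mul_of_nonneg_left hp'b hK₁.le) n1)
  rw [hJsub] at hmain
  rw [cellForm, cellPairing_star, pull_push, dampingForm_star, pull_push, star_eq, pull_push]
  simp only [hleft, hder]
  rw [hsplit]
  have hR' : M.size ^ (k + 1) * waveOsc M F t i + cnorm k (ξ i) + cnorm k (ξ (M.prev i)) + cnorm k (ξ (M.next i)) +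
      M.size ^ (k + 2) = M.size ^ (k + 1) * waveOsc M F t i + R := by
    rw [hR]
    ring
  have herr' := mul_le_mul_of_nonneg_left (residual_error_le (o := waveOsc M F t i) hh hhH hsz (Real.sqrt_nonneg _) hB0
    hD0 hK₃ hHR (k := k)) (mul_nonneg hK₂ n1)
  rw [← hA] at herr'
  have hp'2 := correction_error_le hh hK₁.le hK₄ n1 hHR hp'pair
  rw [hR']
  clear_value A D R
  linarith

end Defect

end OFSV

namespace OFSV

/-! ### Evolution of the energy -/

/-- A differential form of the inequality of Gronwall. -/
theorem le_exp_mul_of_derivWithin_le {T L R : ℝ} {E : ℝ → ℝ}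
    (h : ∀ t ∈ Icc 0 T, ∃ d, HasDerivWithinAt E d (Icc 0 T) t ∧ (0 < t → d ≤ L * (E t + R))) {t : ℝ}
    (ht : t ∈ Icc 0 T) : E t + R ≤ Real.exp (L * t) * (E 0 + R) := by
  -- Monotonicity needs the differential inequality at interior points only, so nothing is required
  -- of it at time 0, where the scheme is not imposed.
  have hanti : AntitoneOn (fun t => Real.exp (-(L * t)) * (E t + R)) (Icc 0 T) := by
    have hd : ∀ t ∈ Icc 0 T, ∀ d, HasDerivWithinAt E d (Icc 0 T) t →
        HasDerivWithinAt (fun t => Real.exp (-(L * t)) * (E t + R))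
          (Real.exp (-(L * t)) * (d - L * (E t + R))) (Icc 0 T) t := by
      intro t _ d hd
      have h1 : HasDerivWithinAt (fun t => Real.exp (-(L * t))) (Real.exp (-(L * t)) * (-(L * 1))) (Icc 0 T) t :=
        (((hasDerivAt_id t).const_mul L).neg.exp).hasDerivWithinAt
      exact (h1.mul (hd.add_const R)).congr_deriv (by ring)
    refine antitoneOn_of_deriv_nonpos (convex_Icc 0 T) (fun t ht => ?_) (fun t ht => ?_) (fun t ht => ?_)
    · obtain ⟨d, hdt, -⟩ := h t ht
      exact (hd t ht d hdt).continuousWithinAt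
    · have ht' := interior_subset ht
      obtain ⟨d, hdt, -⟩ := h t ht'
      exact ((hd t ht' d hdt).mono interior_subset).differentiableWithinAt
    · have ht' := interior_subset ht
      obtain ⟨d, hdt, hle⟩ := h t ht'
      rw [((hd t ht' d hdt).hasDerivAt (mem_interior_iff_mem_nhds.1 ht)).deriv]
      rw [interior_Icc] at ht
      exact mul_nonpos_of_nonneg_of_nonpos (Real.exp_pos _).le (by linarith [hle ht.1])
  have h1 := hanti ⟨le_rfl, ht.1.trans ht.2⟩ ht ht.1
  simp only [mul_zero, neg_zero, Real.exp_zero, one_mul] at h1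
  have h2 := mul_le_mul_of_nonneg_left h1 (Real.exp_pos (L * t)).le
  rwa [← mul_assoc, ← Real.exp_add, add_neg_cancel, Real.exp_zero, one_mul] at h2

theorem mul_add_le_sq (s o p n H : ℝ) : s * (o + s + p + n + H) ≤ 3 * s ^ 2 + p ^ 2 + n ^ 2 + o ^ 2 + H ^ 2 := by
  nlinarith [sq_nonneg (s - o), sq_nonneg (s - p), sq_nonneg (s - n), sq_nonneg (s - H), sq_nonneg o, sq_nonneg p,
    sq_nonneg n, sq_nonneg H]

section Energy

variable {a b c T B : ℝ} {k : ℕ} {bc : Boundary} {V F : ℝ → ℝ} {s : Scheme} {ρ : Fin (k + 2) → ℝ}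

/-- The weighted square of the oscillation is h_i² times an increment of `F`, and the increments
telescope. The square integrability behind `F` thus yields a full power of `H` in the mean, although
a single oscillation is only of order √h. -/
theorem WaveProfile.sum_waveOsc_sq (hV : WaveProfile a b T B k bc V F) (M : Mesh a b) {t : ℝ} (ht : t ∈ Icc 0 T) :
    ∑ i, M.len i * waveOsc M F t i ^ 2 ≤ M.size ^ 2 * (F b - F (a - T)) := by
  have h1 : ∀ i, M.len i * waveOsc M F t i ^ 2 ≤ M.size ^ 2 * (F (M.right i - t) - F (M.left i - t)) := fun i => by
    have h := M.len_pos i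
    have hF := sub_nonneg.2 (hV.monotone (by linarith [left_lt_right M i] : M.left i - t ≤ M.right i - t))
    rw [waveOsc, Real.sq_sqrt (hV.osc_nonneg M t i), ← mul_assoc, ← pow_two]
    exact mul_le_mul_of_nonneg_right (pow_le_pow_left₀ h.le (M.len_le_size i) 2) hF
  refine (Finset.sum_le_sum fun i _ => h1 i).trans ?_
  rw [← Finset.mul_sum, M.sum_sub_eq fun x => F (x - t)]
  have h2 := hV.monotone (by linarith [ht.1] : b - t ≤ b)
  have h3 := hV.monotone (by linarith [ht.2] : a - T ≤ a - t)
  exact mul_le_mul_of_nonneg_left (by linarith) (sq_nonneg _)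

/-- The sum over the cells of the error terms of the energy estimate. -/
theorem WaveProfile.sum_error_le (hV : WaveProfile a b T B k bc V F) {M : Mesh a b} (hM : M.ShapeRegular c) {t : ℝ}
    (ht : t ∈ Icc 0 T) (n : Fin M.N → ℝ) :
    ∑ i, M.len i * n i * (M.size ^ (k + 1) * waveOsc M F t i + n i + n (M.prev i) + n (M.next i) + M.size ^ (k + 2)) ≤
      (3 + 2 * c) * ∑ i, M.len i * n i ^ 2 + (F b - F (a - T) + (b - a)) * (M.size ^ (k + 2)) ^ 2 := by
  have h1 : ∀ i, M.len i * n i *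
      (M.size ^ (k + 1) * waveOsc M F t i + n i + n (M.prev i) + n (M.next i) + M.size ^ (k + 2)) ≤
      3 * (M.len i * n i ^ 2) + c * (M.len (M.prev i) * n (M.prev i) ^ 2) + c * (M.len (M.next i) * n (M.next i) ^ 2) +
        (M.size ^ (k + 1)) ^ 2 * (M.len i * waveOsc M F t i ^ 2) + M.len i * (M.size ^ (k + 2)) ^ 2 := fun i => by
    have e1 := mul_le_mul_of_nonneg_left (mul_add_le_sq (n i) (M.size ^ (k + 1) * waveOsc M F t i) (n (M.prev i))
      (n (M.next i)) (M.size ^ (k + 2))) (M.len_pos i).le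
    -- Shape regularity exchanges the length of a cell for that of its neighbour.
    have e2 : ∀ j, M.len i * n j ^ 2 ≤ c * (M.len j * n j ^ 2) := fun j => by
      rw [← mul_assoc]
      exact mul_le_mul_of_nonneg_right ((M.len_le_size i).trans (hM j)) (sq_nonneg _)
    have e3 := e2 (M.prev i)
    have e4 := e2 (M.next i)
    linarith
  refine (Finset.sum_le_sum fun i _ => h1 i).trans ?_
  simp only [Finset.sum_add_distrib, ← Finset.mul_sum, ← Finset.sum_mul]
  rw [M.sum_prev fun j => M.len j * n j ^ 2, M.sum_next fun j => M.len j * n j ^ 2, M.sum_len]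
  have e := mul_le_mul_of_nonneg_left (hV.sum_waveOsc_sq M ht) (sq_nonneg (M.size ^ (k + 1)))
  have e' : (M.size ^ (k + 2)) ^ 2 = (M.size ^ (k + 1)) ^ 2 * M.size ^ 2 := by ring
  rw [e']
  linarith

/-- The energy of a family of polynomials on the reference cell. -/
def meshEnergy (M : Mesh a b) (κ : ℝ) (k : ℕ) (ξ : Fin M.N → ℝ[X]) : ℝ := ∑ i, M.len i * energyForm κ k (ξ i) (ξ i)

/-- Testing with the image of the defect and summing over the cells cancels the flux terms
cyclically. The error terms are bounded by the energy plus `H^(2(k+2))`, and Gronwall's inequality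
applies. -/
theorem exists_energy_growth (hk : 1 ≤ k) (hab : a < b) (hT : 0 < T) (hρ : IsReferencePoints s k ρ)
    {Z W : ℝ[X]} (hZ : Z.natDegree ≤ k) (hW : W.natDegree ≤ k) (hZ1 : Z.eval 1 = 0) (hW1 : W.eval 1 = 0)
    (hZe : ∀ v : ℝ[X], v.natDegree ≤ k →
      integ 0 1 (Z * derivative v) = refPairing s ρ (fun y => (refError ρ).eval y) v)
    (hWe : ∀ v : ℝ[X], v.natDegree ≤ k →
      integ 0 1 (W * derivative v) = refPairing s ρ (fun y => centered.eval y) v)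
    {κ : ℝ} (hκ : 0 ≤ κ) (hpair : ∀ p v : ℝ[X], p.natDegree ≤ k → v.natDegree ≤ k →
      refPairing s ρ (fun y => p.eval y) v = energyForm κ k p v)
    (hsum : ∀ (p v : ℝ[X]) (c : ℝ), p.natDegree ≤ k → v.natDegree ≤ k →
      ∑ j : Fin (k + 1), refStar s ρ v j * (p.eval (ρ j.succ) - if j = 0 then c else p.eval (ρ j.castSucc)) =
        p.eval 1 * v.eval 1 - c * v.eval 0 - integ 0 1 (p * derivative v))
    (c : ℝ) (hV : WaveProfile a b T B k bc V F) {u : ℝ → ℝ → ℝ} (hbc : bc.Holds a b T u)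
    (hu : ∀ t ∈ Icc 0 T, u a t = V (a - t)) {Ne : ℕ} (hNe : 1 ≤ Ne) :
    ∃ L : ℝ, 0 ≤ L ∧ ∀ (M : Mesh a b) (uh : ℝ → Fin M.N → ℝ[X]), M.ShapeRegular c → M.size ≤ 1 →
      IsOFSVSolution M ρ Ne T bc uh → ∀ t ∈ Icc 0 T,
      meshEnergy M κ k (waveDefect M ρ Ne bc V Z W (uh t) t) + (M.size ^ (k + 2)) ^ 2 ≤
        Real.exp (L * t) * (meshEnergy M κ k (waveDefect M ρ Ne bc V Z W (uh 0) 0) + (M.size ^ (k + 2)) ^ 2) := by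
  obtain ⟨K, hK, hcell⟩ := exists_cellForm_lower_bound hk a b c T B hT hρ hZ hW hZ1 hW1 hZe hWe hpair hsum
  obtain ⟨K₀, hK₀, hnorm⟩ := exists_cnorm_sq_le k
  have hm : 0 ≤ F b - F (a - T) + (b - a) :=
    add_nonneg (sub_nonneg.2 (hV.monotone (by linarith))) (by linarith)
  refine ⟨2 * (K * ((3 + 2 * |c|) * K₀ + (F b - F (a - T) + (b - a)))), by positivity,
    fun M uh hM hsz hsol t ht => ?_⟩
  refine le_exp_mul_of_derivWithin_le (T := T)
    (E := fun t => meshEnergy M κ k (waveDefect M ρ Ne bc V Z W (uh t) t)) (fun t ht => ?_) ht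
  choose ξ' hξ'deg hξ'd hle using
    hcell M Ne bc V F u uh hM hsz hNe hV hbc hu hsol.natDegree_le hsol.differentiable t ht
  have hξdeg : ∀ r ∈ Icc 0 T, ∀ i, (waveDefect M ρ Ne bc V Z W (uh r) r i).natDegree ≤ k := fun r hr i =>
    natDegree_waveDefect_le M hρ Ne bc V hZ hW r (hsol.natDegree_le r hr i)
  refine ⟨_, HasDerivWithinAt.fun_sum fun i _ =>
    ((hξ'd i).energyForm ht (fun r hr => hξdeg r hr i) (hξ'deg i) κ).const_mul (M.len i), fun h0 => ?_⟩
  have hc : 0 < c := by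
    have i : Fin M.N := ⟨0, M.N_pos hab⟩
    have h1 := hM i
    have h2 := M.len_le_size i
    have h3 := M.len_pos i
    by_contra h
    nlinarith
  rw [abs_of_pos hc]
  have hξt := hξdeg t ht
  set ξ := waveDefect M ρ Ne bc V Z W (uh t) t with hξ
  clear_value ξ
  have hzero : ∑ i, cellForm M ρ Ne T bc uh t (fun i => star M ρ s i (push M i (ξ i))) i = 0 :=
    hsol.scheme t ⟨h0, ht.2⟩ _
  have hs := Finset.sum_le_sum fun i (_ : i ∈ Finset.univ) => hle i
  rw [hzero, Finset.sum_sub_distrib, Finset.sum_add_distrib, ← Finset.mul_sum, ← Finset.sum_div,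
    Finset.sum_sub_distrib, M.sum_prev fun j => (ξ j).eval 1 ^ 2, sub_self, zero_div, add_zero] at hs
  have herr := mul_le_mul_of_nonneg_left (hV.sum_error_le hM ht fun i => cnorm k (ξ i)) hK
  have hE : ∑ i, M.len i * cnorm k (ξ i) ^ 2 ≤ K₀ * meshEnergy M κ k ξ := by
    rw [meshEnergy, Finset.mul_sum]
    refine Finset.sum_le_sum fun i _ => ?_
    have e1 : integ 0 1 (ξ i * ξ i) ≤ energyForm κ k (ξ i) (ξ i) :=
      le_add_of_nonneg_right (mul_nonneg hκ (mul_self_nonneg _))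
    calc M.len i * cnorm k (ξ i) ^ 2 ≤ M.len i * (K₀ * energyForm κ k (ξ i) (ξ i)) :=
          mul_le_mul_of_nonneg_left ((hnorm _ (hξt i)).trans (mul_le_mul_of_nonneg_left e1 hK₀.le)) (M.len_pos i).le
      _ = _ := by ring
  have hE0 : 0 ≤ meshEnergy M κ k ξ :=
    Finset.sum_nonneg fun i _ => mul_nonneg (M.len_pos i).le (energyForm_self_nonneg hκ _)
  have h2 : ∑ i, M.len i * (2 * energyForm κ k (ξ' i) (ξ i)) = 2 * ∑ i, M.len i * energyForm κ k (ξ' i) (ξ i) := by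
    rw [Finset.mul_sum]
    exact Finset.sum_congr rfl fun i _ => by ring
  rw [h2]
  have e1 := mul_le_mul_of_nonneg_left hE (by positivity : 0 ≤ K * (3 + 2 * c))
  have e2 : 0 ≤ K * ((3 + 2 * c) * K₀ * (M.size ^ (k + 2)) ^ 2) := by positivity
  have e3 : 0 ≤ K * ((F b - F (a - T) + (b - a)) * meshEnergy M κ k ξ) := by positivity
  linarith

end Energy

/-! ### The corrected initial value -/

section Initial

variable {a b c T B : ℝ} {k : ℕ} {bc : Boundary} {V F : ℝ → ℝ} {s : Scheme} {ρ : Fin (k + 2) → ℝ}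

/-- The antiderivative of `X ^ m` with vanishing mean on the reference cell. -/
def meanFreePow (m : ℕ) : ℝ[X] := C (1 / ((m : ℝ) + 1)) * X ^ (m + 1) - C (1 / (((m : ℝ) + 1) * ((m : ℝ) + 2)))

theorem derivative_meanFreePow (m : ℕ) : derivative (meanFreePow m) = X ^ m := by
  have h : ((m : ℝ) + 1) ≠ 0 := by positivity
  rw [meanFreePow, derivative_sub, derivative_C, sub_zero, derivative_C_mul, derivative_X_pow, Nat.add_sub_cancel,
    ← mul_assoc, ← C_mul]
  push_cast
  rw [one_div, inv_mul_cancel₀ h, C_1, one_mul]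

theorem natDegree_meanFreePow_le {m : ℕ} (hm : m < k) : (meanFreePow m).natDegree ≤ k :=
  (natDegree_sub_le _ _).trans (max_le ((natDegree_C_mul_X_pow_le _ _).trans hm)
    ((natDegree_C _).le.trans (Nat.zero_le _)))

theorem integ_meanFreePow (m : ℕ) : integ 0 1 (meanFreePow m) = 0 := by
  have h : ((m : ℝ) + 1) ≠ 0 := by positivity
  have h' : ((m : ℝ) + 2) ≠ 0 := by positivity
  have h'' : ((m : ℝ) + 1 + 1) ≠ 0 := by positivity
  have e1 : integ 0 1 (X ^ (m + 1)) = 1 / ((m : ℝ) + 2) := by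
    rw [integ_apply]
    simp only [eval_pow, eval_X]
    rw [integral_pow]
    simp only [one_pow, ne_eq, Nat.succ_ne_zero, not_false_eq_true, zero_pow, sub_zero]
    push_cast
    congr 1
    ring
  have e2 : ∀ x : ℝ, integ 0 1 (C x) = x := fun x => by simp [integ_apply]
  rw [meanFreePow, map_sub, integ_C_mul, e1, e2]
  field_simp
  ring

theorem interp_congr (M : Mesh a b) (hρ : IsReferencePoints s k ρ) {v w : ℝ → ℝ} (h : ∀ x ∈ Icc a b, v x = w x)
    (i : Fin M.N) : interp M ρ v i = interp M ρ w i := by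
  rw [interp, interp]
  congr 1
  funext j
  exact h _ (M.mem_Icc_of_mem_cell i (M.mem_Icc_of_mem_unit i (hρ.mem_Icc j.succ)))

/-- The moments of the correction function, on the reference cell. -/
theorem IsCorrection.integ_pull_mul {M : Mesh a b} {ε t : ℝ} {u : ℝ → ℝ → ℝ} {σ : Fin M.N → ℕ → ℝ}
    {ω : Fin M.N → ℝ[X]} (h : IsCorrection M ρ s ε T u σ t ω) (i : Fin M.N) {v : ℝ[X]} (hv : v.natDegree ≤ k)
    (hv0 : integ 0 1 v = 0) :
    integ 0 1 (pull M i (ω i) * derivative v) =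
      M.len i * refPairing s ρ (fun y => derivWithin (fun r => ε * ((interp M ρ (fun y => u y r) i).eval
        (M.left i + M.len i * y) - u (M.left i + M.len i * y) r)) (Icc 0 T) t) v +
      ∑ l ∈ Finset.range (k + 1), σ i l *
        refPairing s ρ (fun y => (projError M i (l - 1) (interp M ρ (fun y => u y t) i)).eval y) v := by
  have h1 := h.eq i (push M i v) (natDegree_push_le M i hv) (by
    rw [integral_left_right]
    simp only [← eval_pull, pull_push]
    rw [← integ_apply, hv0, mul_zero])
  rw [cellPairing_star, dampingForm_star, pull_push, integral_left_right, ← intervalIntegral.integral_const_mul] at h1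
  rw [← h1, integ_apply]
  congr 1
  funext y
  have h2 := eval_iterate_derivative_pull M i 1 (push M i v) y
  rw [pull_push, Function.iterate_one, pow_one] at h2
  rw [eval_mul, h2, eval_pull]
  ring

theorem le_of_le_add_mul {x A D H : ℝ} (hx : 0 ≤ x) (hD : 0 ≤ D) (hH : H ≤ 1 / (2 * D + 1))
    (h : x ≤ A + D * (H * x)) : x ≤ 2 * A := by
  have h1 : H * (2 * D + 1) ≤ 1 := (le_div_iff₀ (by positivity)).1 hH
  rcases le_or_gt H 0 with h0 | h0
  · have : D * (H * x) ≤ 0 := mul_nonpos_of_nonneg_of_nonpos hD (mul_nonpos_of_nonpos_of_nonneg h0 hx)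
    linarith
  · have h2 : D * H ≤ 1 / 2 := by nlinarith
    have h3 := mul_le_mul_of_nonneg_right h2 hx
    nlinarith

/-- The defect of the corrected initial value. -/
theorem exists_initial_defect_bound (hk : 1 ≤ k) (hT : 0 < T) (hρ : IsReferencePoints s k ρ)
    {Z W : ℝ[X]} (hZ : Z.natDegree ≤ k) (hW : W.natDegree ≤ k) (c : ℝ) (hB : 0 ≤ B)
    (hV : WaveProfile a b T B k bc V F) {u₀ : ℝ → ℝ} {u : ℝ → ℝ → ℝ} (hbc : bc.Holds a b T u)
    (hu : ∀ x ∈ Icc a b, ∀ t ∈ Icc 0 T, u x t = V (x - t)) (hu₀ : ∀ x ∈ Icc a b, u x 0 = u₀ x)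
    {Ne : ℕ} (hNe : 1 ≤ Ne) {ε : ℝ} (hε : |ε| ≤ 1) :
    ∃ K h₀ : ℝ, 0 ≤ K ∧ 0 < h₀ ∧ ∀ (M : Mesh a b) (p : Fin M.N → ℝ[X]), M.ShapeRegular c → M.size ≤ 1 →
      M.size ≤ h₀ → (∀ i, (p i).natDegree ≤ k) → IsCorrectedInitial M ρ s ε Ne T bc u₀ u p →
      ∀ i, cnorm k (waveDefect M ρ Ne bc V Z W p 0 i) ≤ K * M.size ^ (k + 2) := by
  obtain ⟨K₁, hK₁, hb⟩ := exists_abs_refPairing_le (s := s) hρ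
  obtain ⟨K₂, hK₂, hexp⟩ := exists_refInterp_expansion hρ
  obtain ⟨K₃, hK₃, hwd⟩ := exists_waveProfile_damping_bound hk a b c T B hρ
  obtain ⟨K₄, hK₄, hwc⟩ := exists_waveCorrection_bound hk a b c T B hρ hZ hW
  obtain ⟨K₅, hK₅, hlip⟩ := exists_abs_damping_sub_le (a := a) (b := b) k hk c
  obtain ⟨K₆, hK₆, hproj⟩ := exists_cnorm_le_of_orthogonal k
  obtain ⟨K₇, hK₇, hlin⟩ := exists_cnorm_refInterp_sub_linear_le hρ hk
  obtain ⟨K₈, hK₈, hmom⟩ := exists_cnorm_le_of_moments hk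
  set Kv := ∑ m ∈ Finset.range k, cnorm k (meanFreePow m) with hKv
  have hKv0 : 0 ≤ Kv := Finset.sum_nonneg fun _ _ => cnorm_nonneg _ _
  have hKvm : ∀ m < k, cnorm k (meanFreePow m) ≤ Kv := fun m hm =>
    Finset.single_le_sum (f := fun m => cnorm k (meanFreePow m)) (fun _ _ => cnorm_nonneg _ _) (Finset.mem_range.2 hm)
  set G := ((k : ℝ) + 1) * (K₁ * (K₆ * ((K₇ + 1) * B)) * Kv) with hG
  have hG0 : 0 ≤ G := by positivity
  set A := K₁ * (K₂ * B) * Kv + G * (K₃ + K₅) with hA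
  have hA0 : 0 ≤ A := by positivity
  set D := K₈ * (G * K₅ * 3) with hD
  have hD0 : 0 ≤ D := by positivity
  clear_value Kv
  -- Below this mesh size `D * H ≤ 1/2`, so the self-dependence of the initial correction can be
  -- absorbed.
  refine ⟨2 * (K₈ * A) + K₄, 1 / (2 * D + 1), by positivity, by positivity, ?_⟩
  intro M p hM hsz hsz0 hdeg hini i
  obtain ⟨ω, hω, hp⟩ := hini
  have h0T : (0 : ℝ) ∈ Icc 0 T := ⟨le_rfl, hT.le⟩
  have hH : 0 < M.size := (M.len_pos i).trans_le (M.len_le_size i)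
  have hint : ∀ r ∈ Icc 0 T, ∀ i, interp M ρ (fun y => u y r) i = waveInterp M ρ V r i := fun r hr i =>
    interp_congr M hρ (fun x hx => hu x hx r hr) i
  have hint0 : ∀ i, interp M ρ u₀ i = waveInterp M ρ V 0 i := fun i =>
    interp_congr M hρ (fun x hx => (hu₀ x hx).symm.trans (hu x hx 0 h0T)) i
  have hcn : ∀ i, cnorm k (pull M i (p i - waveInterp M ρ V 0 i)) = cnorm k (pull M i (ω i)) := fun i => by
    rw [hp i, hint0 i, show waveInterp M ρ V 0 i - ω i - waveInterp M ρ V 0 i = 0 - ω i by ring, pull_sub]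
    rw [show pull M i 0 = 0 from zero_comp, zero_sub, cnorm_neg]
  set z : Fin M.N → ℝ := fun i => cnorm k (pull M i (ω i)) with hz
  have hz0 : ∀ i, 0 ≤ z i := fun i => cnorm_nonneg _ _
  -- The damping coefficients in the equation for `ω` are those of the initial value, which is the
  -- interpolant minus `ω`. By their Lipschitz dependence the size of `ω` on the cell and its
  -- neighbours reappears on the right, but with a factor `H` from the projection error of the
  -- interpolant.
  have hzi : ∀ i, z i ≤ K₈ * (A * M.size ^ (k + 2) + G * K₅ * (M.size * (z i + z (M.prev i) + z (M.next i)))) := by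
    intro i
    have hh := M.len_pos i
    have hhH := M.len_le_size i
    have hsum0 : 0 ≤ z i + z (M.prev i) + z (M.next i) := add_nonneg (add_nonneg (hz0 _) (hz0 _)) (hz0 _)
    set Y := z i + z (M.prev i) + z (M.next i) with hY
    have hx0 : M.left i - 0 ∈ Icc (a - T) b :=
      M.shift_mem i h0T (left_mem_Icc.2 (by linarith [left_lt_right M i]))
    have hmemI : ∀ x ∈ Icc (M.left i - 0) (M.left i - 0 + M.len i), x ∈ Icc (a - T) b := fun x hx =>
      M.shift_mem i h0T ⟨hx.1, by linarith [hx.2, M.left_add_len i]⟩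
    have hV1 : Differentiable ℝ V := hV.contDiff.differentiable (by simp)
    have hV' : ContDiff ℝ (k + 1 : ℕ) (deriv V) := ((contDiff_succ_iff_deriv (n := (k + 1 : ℕ))).1 (by
      exact_mod_cast hV.contDiff)).2.2
    have hωdeg : (pull M i (ω i)).natDegree ≤ k := natDegree_pull_le M i (hω.natDegree_le i)
    refine hmom (pull M i (ω i)) _ hωdeg ?_ (by positivity) fun m hm => ?_
    · rw [eval_pull, mul_one, M.left_add_len, hω.right]
    have hv := natDegree_meanFreePow_le hm
    have hvn := hKvm m hm
    have hvn0 := cnorm_nonneg k (meanFreePow m)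
    have e := hω.integ_pull_mul i hv (integ_meanFreePow m)
    rw [derivative_meanFreePow] at e
    rw [e]
    have hη : |M.len i * refPairing s ρ (fun y => derivWithin (fun r => ε * ((interp M ρ (fun y => u y r) i).eval
        (M.left i + M.len i * y) - u (M.left i + M.len i * y) r)) (Icc 0 T) 0) (meanFreePow m)| ≤
        K₁ * (K₂ * B) * Kv * M.size ^ (k + 2) := by
      have hf : ∀ y ∈ Icc (0 : ℝ) 1, |derivWithin (fun r => ε * ((interp M ρ (fun y => u y r) i).eval
          (M.left i + M.len i * y) - u (M.left i + M.len i * y) r)) (Icc 0 T) 0| ≤ K₂ * (M.len i ^ (k + 1) * B) := by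
        intro y hy
        have hx : M.left i + M.len i * y ∈ Icc a b := M.mem_Icc_of_mem_cell i (M.mem_Icc_of_mem_unit i hy)
        have hd : HasDerivWithinAt (fun r => ε * ((interp M ρ (fun y => u y r) i).eval
            (M.left i + M.len i * y) - u (M.left i + M.len i * y) r))
            (ε * (-(waveInterp M ρ (deriv V) 0 i).eval (M.left i + M.len i * y) -
              -deriv V (M.left i + M.len i * y - 0))) (Icc 0 T) 0 := by
          refine HasDerivWithinAt.congr (((hasDerivAt_eval_waveInterp M (ρ := ρ) hV1 0 i 0 _).sub
            (hasDerivAt_wave hV1 _ 0)).const_mul ε).hasDerivWithinAt (fun r hr => ?_) ?_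
          · rw [hint r hr, hu _ hx r hr]
            rfl
          · rw [hint 0 h0T, hu _ hx 0 h0T]
            rfl
        rw [hd.derivWithin (uniqueDiffOn_Icc hT 0 h0T), ← eval_pull, pull_waveInterp M hρ, abs_mul]
        -- With leading coefficient zero the expansion is a plain bound. Only the size of the
        -- initial correction matters, which is also why the sign convention plays no part.
        have h1 := hexp (deriv V) (M.left i - 0) (M.len i) 0 B hV' hh.le (fun x hx => by
          rw [← iteratedDeriv_succ', sub_zero]
          exact hV.bound _ le_rfl x (hmemI x hx)) y hy
        rw [mul_zero, zero_div, zero_mul, sub_zero] at h1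
        rw [neg_sub_neg, abs_sub_comm, show M.left i + M.len i * y - 0 = M.left i - 0 + M.len i * y by ring]
        exact (mul_le_of_le_one_left (abs_nonneg _) hε).trans h1
      rw [abs_mul, abs_of_pos hh]
      calc _ ≤ M.len i * (K₁ * (K₂ * (M.len i ^ (k + 1) * B)) * cnorm k (meanFreePow m)) :=
            mul_le_mul_of_nonneg_left (hb _ _ _ hv hf) hh.le
        _ = K₁ * (K₂ * B) * M.len i ^ (k + 2) * cnorm k (meanFreePow m) := by ring
        _ ≤ K₁ * (K₂ * B) * M.size ^ (k + 2) * Kv := by gcongr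
        _ = _ := by ring
    have hterm : ∀ l ∈ Finset.range (k + 1), |damping M k Ne bc 0 p i l *
        refPairing s ρ (fun y => (projError M i (l - 1) (interp M ρ (fun y => u y 0) i)).eval y) (meanFreePow m)| ≤
        (K₃ * M.size ^ (k + 1) + K₅ * (Y + M.size ^ (k + 2))) * (K₁ * (K₆ * ((K₇ + 1) * B)) * Kv * M.size) := by
      intro l hl
      have hlk : l ≤ k := Nat.lt_succ_iff.1 (Finset.mem_range.1 hl)
      have hσ : |damping M k Ne bc 0 p i l| ≤ K₃ * M.size ^ (k + 1) + K₅ * (Y + M.size ^ (k + 2)) := by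
        obtain ⟨g1, g2, -⟩ := hwd M Ne bc V F hM hsz hNe hV 0 h0T i l hlk
        have g3 := hlip M ρ Ne bc V 0 p i hM hNe
          (fun m => jumpLeft_waveBoundary M hbc h0T (hu a ⟨le_rfl, (M.a_le_left i).trans
            ((left_lt_right M i).le.trans (M.right_le_b i))⟩ 0 h0T) _ _ _)
          (fun j => (natDegree_sub_le _ _).trans (max_le (hdeg j) (natDegree_interp_le M hρ _ j))) l hlk
        rw [hcn, hcn, hcn] at g3
        have g4 := abs_le.1 g3
        rw [abs_le]
        constructor <;> linarith [g4.1, g4.2]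
      -- On a cell the interpolant differs from a constant by O(H), and every projection involved
      -- reproduces constants.
      have hd : cnorm k (projError M i (l - 1) (interp M ρ (fun y => u y 0) i)) ≤ K₆ * ((K₇ + 1) * B * M.size) := by
        set I := refInterp ρ (fun y => V (M.left i - 0 + M.len i * y)) with hI
        have hIe : pull M i (interp M ρ (fun y => u y 0) i) = I := by rw [hint 0 h0T, pull_waveInterp M hρ]
        have g1 := hlin V (M.left i - 0) (M.len i) B (hV.contDiff.of_le (by exact_mod_cast (by omega : 2 ≤ k + 2)))
          hh.le (fun x hx => hV.bound 2 (by omega) x (hmemI x hx))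
        have g2 : cnorm k (I - C (V (M.left i - 0))) ≤ (K₇ + 1) * B * M.size := by
          have : I - C (V (M.left i - 0)) = (I - (C (V (M.left i - 0)) + C (M.len i * deriv V (M.left i - 0)) * X)) +
              C (M.len i * deriv V (M.left i - 0)) * X := by ring
          rw [this]
          refine (cnorm_add_le _ _ _).trans ?_
          have g3 : cnorm k (X : ℝ[X]) ≤ 1 := by
            simp only [cnorm, coeff_X]
            rw [Finset.sum_eq_single 1 (fun n _ hn => by simp [hn.symm]) (fun h => by simp at h; omega)]
            simp
          have g4 : |deriv V (M.left i - 0)| ≤ B := by simpa using hV.bound 1 (by omega) _ hx0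
          rw [cnorm_C_mul, abs_mul, abs_of_pos hh]
          have g5 : M.len i ^ 2 ≤ M.size := by nlinarith
          have g6 : M.len i * |deriv V (M.left i - 0)| * cnorm k (X : ℝ[X]) ≤ M.size * B * 1 :=
            mul_le_mul (mul_le_mul hhH g4 (abs_nonneg _) hH.le) g3 (cnorm_nonneg _ _) (mul_nonneg hH.le hB)
          have g7 := mul_le_mul_of_nonneg_left g5 (by positivity : 0 ≤ K₇ * B)
          linarith
        refine (hproj (l - 1) _ (I - C (V (M.left i - 0))) ?_ ?_ ?_ ?_).trans (mul_le_mul_of_nonneg_left g2 hK₆.le)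
        · exact natDegree_projError_le M i (by omega) (natDegree_interp_le M hρ _ i)
        · exact (natDegree_sub_le _ _).trans (max_le (natDegree_refInterp_le hρ _)
            ((natDegree_C _).le.trans (Nat.zero_le _)))
        · have g3 := natDegree_pull_sub_projError_le M i (l - 1) (interp M ρ (fun y => u y 0) i)
          rw [hIe] at g3
          rw [show projError M i (l - 1) (interp M ρ (fun y => u y 0) i) - (I - C (V (M.left i - 0))) =
            C (V (M.left i - 0)) - (I - projError M i (l - 1) (interp M ρ (fun y => u y 0) i)) by ring]
          exact (natDegree_sub_le _ _).trans (max_le ((natDegree_C _).le.trans (Nat.zero_le _)) g3)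
        · exact fun r hr => integ_projError_mul M i _ _ hr
      rw [abs_mul]
      refine mul_le_mul hσ ?_ (abs_nonneg _) (by positivity)
      refine (hb _ _ _ hv fun y hy => abs_eval_le (natDegree_projError_le M i (by omega)
        (natDegree_interp_le M hρ _ i)) hy).trans ?_
      calc _ ≤ K₁ * (K₆ * ((K₇ + 1) * B * M.size)) * Kv := by gcongr
        _ = _ := by ring
    have hs := (Finset.abs_sum_le_sum_abs _ _).trans (Finset.sum_le_sum hterm)
    rw [Finset.sum_const, Finset.card_range, nsmul_eq_mul] at hs
    push_cast at hs
    refine (abs_add_le _ _).trans ((add_le_add hη hs).trans ?_)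
    have f1 : M.size ^ (k + 2) * M.size ≤ M.size ^ (k + 2) := mul_le_of_le_one_right (by positivity) hsz
    have f2 := mul_le_mul_of_nonneg_left f1 (mul_nonneg hG0 hK₅)
    rw [hA]
    rw [hG] at f2 ⊢
    clear hη hs hterm
    have f3 : M.size ^ (k + 2) = M.size ^ (k + 1) * M.size := pow_succ _ _
    clear_value Y
    rw [f3] at f2 ⊢
    linarith
  -- On the cell where the correction is largest its neighbours are dominated by itself, and the
  -- factor `H` allows absorption.
  obtain ⟨i₀, -, hmax⟩ := Finset.exists_max_image Finset.univ z ⟨i, Finset.mem_univ i⟩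
  have hz1 : z i₀ ≤ 2 * (K₈ * A * M.size ^ (k + 2)) := by
    refine le_of_le_add_mul (hz0 i₀) hD0 hsz0 ?_
    have e1 : z i₀ + z (M.prev i₀) + z (M.next i₀) ≤ 3 * z i₀ := by
      linarith [hmax _ (Finset.mem_univ (M.prev i₀)), hmax _ (Finset.mem_univ (M.next i₀))]
    have e2 := mul_le_mul_of_nonneg_left e1 (by positivity : 0 ≤ K₈ * (G * K₅ * M.size))
    have e3 := hzi i₀
    rw [hD]
    linarith
  -- The prescribed correction and the one used in the comparison need not be close to each other:
  -- both are O(H^(k+2)), hence so is their difference.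
  have hzz : waveDefect M ρ Ne bc V Z W p 0 i = waveCorrection M ρ Ne bc V Z W 0 i - pull M i (ω i) := by
    rw [waveDefect, hp i, hint0 i, pull_sub, pull_waveInterp M hρ]
    ring
  rw [hzz]
  refine (cnorm_sub_le _ _ _).trans ?_
  have e1 := (hwc M Ne bc V F hM hsz hNe hV 0 h0T i).1
  have e2 := hmax i (Finset.mem_univ i)
  linarith

end Initial

/-! ### Regularity of the profile -/

/-- The boundary condition says that V(y) = V(y + b - a) on [a - T, a]. On this nondegenerate
interval derivatives within the set determine the derivatives of `V`, also at its end points. -/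
theorem wavePeriodic_of_boundary {a b T : ℝ} (hT : 0 < T) {bc : Boundary} {u : ℝ → ℝ → ℝ} (hab : a ≤ b)
    (hbc : bc.Holds a b T u) {V : ℝ → ℝ} {n : ℕ} (hV : ContDiff ℝ n V)
    (hu : ∀ x ∈ Icc a b, ∀ t ∈ Icc 0 T, u x t = V (x - t)) {t : ℝ} (ht : t ∈ Icc 0 T) : WavePeriodic a b n bc V t := by
  intro hper l hl
  subst hper
  have hunique : UniqueDiffOn ℝ (Icc (a - T) a) := uniqueDiffOn_Icc (by linarith)
  have hmem : a - t ∈ Icc (a - T) a := ⟨by linarith [ht.2], by linarith [ht.1]⟩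
  have heq : EqOn V (fun y => V (y + (b - a))) (Icc (a - T) a) := by
    intro y hy
    have hy' : a - y ∈ Icc 0 T := ⟨by linarith [hy.2], by linarith [hy.1]⟩
    have h1 := hbc (a - y) hy'
    rw [hu a ⟨le_rfl, hab⟩ _ hy', hu b ⟨hab, le_rfl⟩ _ hy'] at h1
    rw [sub_sub_cancel] at h1
    rw [h1]
    congr 1
    ring
  have hVl : ContDiff ℝ l V := hV.of_le (by exact_mod_cast hl)
  have hVl' : ContDiff ℝ l fun y => V (y + (b - a)) := hVl.comp (contDiff_id.add contDiff_const)
  have h := iteratedDerivWithin_congr (n := l) heq hmem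
  rw [iteratedDerivWithin_eq_iteratedDeriv hunique hVl.contDiffAt hmem,
    iteratedDerivWithin_eq_iteratedDeriv hunique hVl'.contDiffAt hmem, iteratedDeriv_comp_add_const] at h
  refine h.trans ?_
  change iteratedDeriv l V (a - t + (b - a)) = _
  congr 1
  ring

theorem exists_abs_iteratedDeriv_le {V : ℝ → ℝ} {n : ℕ} (hV : ContDiff ℝ n V) (α β : ℝ) :
    ∃ B : ℝ, 0 ≤ B ∧ ∀ j ≤ n, ∀ z ∈ Icc α β, |iteratedDeriv j V z| ≤ B := by
  have h : ∀ j, ∃ B : ℝ, 0 ≤ B ∧ (j ≤ n → ∀ z ∈ Icc α β, |iteratedDeriv j V z| ≤ B) := fun j => by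
    by_cases hj : j ≤ n
    · obtain ⟨B, hB⟩ := isCompact_Icc.exists_bound_of_continuousOn (s := Icc α β)
        (hV.continuous_iteratedDeriv j (by exact_mod_cast hj)).continuousOn
      exact ⟨|B|, abs_nonneg _, fun _ z hz => (hB z hz).trans (le_abs_self B)⟩
    · exact ⟨0, le_rfl, fun h => absurd h hj⟩
  choose B hB0 hB using h
  refine ⟨∑ j ∈ Finset.range (n + 1), B j, Finset.sum_nonneg fun j _ => hB0 j, fun j hj z hz => ?_⟩
  exact (hB j hj z hz).trans (Finset.single_le_sum (f := B) (fun j _ => hB0 j) (Finset.mem_range.2 (by omega)))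

end OFSV

/-! ### From the defect to the nodal errors and the errors of cell averages. -/

namespace OFSV

section Errors

variable {a b c T B : ℝ} {k : ℕ} {bc : Boundary} {V F : ℝ → ℝ} {s : Scheme} {ρ : Fin (k + 2) → ℝ}

/-- The mean over the cells is controlled by the mean with respect to the lengths. -/
theorem Mesh.mean_le {M : Mesh a b} (hab : a < b) (hM : M.ShapeRegular c) {f : Fin M.N → ℝ} (hf : ∀ i, 0 ≤ f i) :
    1 / (M.N : ℝ) * ∑ i, f i ≤ c / (b - a) * ∑ i, M.len i * f i := by
  have hba : 0 < b - a := sub_pos.2 hab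
  have hN : (0 : ℝ) < M.N := by exact_mod_cast M.N_pos hab
  have h1 : b - a ≤ M.N * M.size := by
    rw [← M.sum_len]
    refine (Finset.sum_le_sum fun i _ => M.len_le_size i).trans ?_
    simp
  rw [div_mul_eq_mul_div, div_mul_eq_mul_div, div_le_div_iff₀ hN hba, one_mul, Finset.mul_sum, Finset.sum_mul,
    Finset.sum_mul]
  refine Finset.sum_le_sum fun i _ => ?_
  calc f i * (b - a) ≤ f i * (M.N * M.size) := mul_le_mul_of_nonneg_left h1 (hf i)
    _ ≤ f i * (M.N * (c * M.len i)) := mul_le_mul_of_nonneg_left (mul_le_mul_of_nonneg_left (hM i) hN.le) (hf i)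
    _ = _ := by ring

theorem WaveProfile.abs_iteratedDeriv_sub_le (hV : WaveProfile a b T B k bc V F) (M : Mesh a b) {t : ℝ}
    (ht : t ∈ Icc 0 T) (i : Fin M.N) {z : ℝ} (hz : z ∈ Icc (M.left i - t) (M.right i - t)) :
    |iteratedDeriv (k + 1) V z - iteratedDeriv (k + 1) V (M.left i - t)| ≤ B * M.len i := by
  have h := (convex_Icc (M.left i - t) (M.right i - t)).norm_image_sub_le_of_norm_hasDerivWithin_le
    (f := iteratedDeriv (k + 1) V) (C := B) (fun x _ => (hV.hasDerivAt_iteratedDeriv x).hasDerivWithinAt)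
    (fun x hx => hV.bound _ le_rfl x (M.shift_mem i ht hx))
    (left_mem_Icc.2 (by linarith [left_lt_right M i])) hz
  have hB : 0 ≤ B := (abs_nonneg _).trans (hV.bound _ le_rfl z (M.shift_mem i ht hz))
  refine h.trans (mul_le_mul_of_nonneg_left ?_ hB)
  rw [Real.norm_eq_abs, abs_of_nonneg (by linarith [hz.1])]
  linarith [hz.2, M.left_add_len i]

/-- The error of a cell average in terms of the defect. -/
theorem exists_abs_average_le (hk : 1 ≤ k) (hkL : s = Scheme.LSV → 2 ≤ k) (a b c T B : ℝ)
    (hρ : IsReferencePoints s k ρ) {Z W : ℝ[X]} (hZ : Z.natDegree ≤ k) (hW : W.natDegree ≤ k) :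
    ∃ K : ℝ, 0 ≤ K ∧ ∀ (M : Mesh a b) (Ne : ℕ) (bc : Boundary) (V F : ℝ → ℝ) (u : ℝ → ℝ → ℝ) (p : Fin M.N → ℝ[X]),
      M.ShapeRegular c → M.size ≤ 1 → 1 ≤ Ne → WaveProfile a b T B k bc V F →
      (∀ x ∈ Icc a b, ∀ t ∈ Icc 0 T, u x t = V (x - t)) → (∀ i, (p i).natDegree ≤ k) → ∀ t ∈ Icc 0 T, ∀ i,
      |1 / M.len i * ∫ x in (M.left i)..(M.right i), (u x t - (p i).eval x)| ≤
        cnorm k (waveDefect M ρ Ne bc V Z W p t i) + K * M.size ^ (k + 2) := by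
  obtain ⟨K₂, hK₂, hexp⟩ := exists_refInterp_expansion hρ
  obtain ⟨K₄, hK₄, hwc⟩ := exists_waveCorrection_bound hk a b c T B hρ hZ hW
  refine ⟨K₂ * |B| + K₄, by positivity, fun M Ne bc V F u p hM hsz hNe hV hu hdeg t ht i => ?_⟩
  have hh := M.len_pos i
  have hhH := M.len_le_size i
  have hB : 0 ≤ B := (abs_nonneg _).trans (hV.bound 0 (Nat.zero_le _) (M.left i - t)
    (M.shift_mem i ht (left_mem_Icc.2 (by linarith [left_lt_right M i]))))
  rw [abs_of_nonneg hB, integral_left_right, ← mul_assoc, one_div_mul_cancel hh.ne', one_mul]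
  -- The leading interpolation error is `q` times `refError`. Its mean is zero, so it can be added
  -- under the integral at no cost, and the rest is of order k + 2.
  set q := M.len i ^ (k + 1) * iteratedDeriv (k + 1) V (M.left i - t) / (k + 1).factorial with hq
  have hVc : Continuous V := hV.contDiff.continuous
  have hmem : ∀ y ∈ uIcc (0 : ℝ) 1, M.left i + M.len i * y ∈ Icc a b := fun y hy => by
    rw [uIcc_of_le zero_le_one] at hy
    exact M.mem_Icc_of_mem_cell i (M.mem_Icc_of_mem_unit i hy)
  have h1 : ∫ y in (0 : ℝ)..1, (u (M.left i + M.len i * y) t - (p i).eval (M.left i + M.len i * y)) =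
      ∫ y in (0 : ℝ)..1, (V (M.left i - t + M.len i * y) - (pull M i (p i)).eval y + q * (refError ρ).eval y) := by
    have h0 : ∫ y in (0 : ℝ)..1, q * (refError ρ).eval y = 0 := by
      rw [intervalIntegral.integral_const_mul, ← integ_apply, integ_refError hρ hk hkL, mul_zero]
    rw [intervalIntegral.integral_add, h0, add_zero]
    · refine intervalIntegral.integral_congr fun y hy => ?_
      simp only [hu _ (hmem y hy) t ht, eval_pull]
      congr 2
      ring
    · exact ((hVc.comp (by fun_prop)).sub (Polynomial.continuous _)).intervalIntegrable _ _
    · exact (continuous_const.mul (Polynomial.continuous _)).intervalIntegrable _ _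
  rw [h1]
  have hV1 : ContDiff ℝ (k + 1 : ℕ) V := hV.contDiff.of_le (by exact_mod_cast Nat.le_succ _)
  have hbound : ∀ y ∈ uIoc (0 : ℝ) 1,
      ‖V (M.left i - t + M.len i * y) - (pull M i (p i)).eval y + q * (refError ρ).eval y‖ ≤
        cnorm k (waveDefect M ρ Ne bc V Z W p t i) + (K₂ * B + K₄) * M.size ^ (k + 2) := by
    intro y hy
    rw [uIoc_of_le zero_le_one] at hy
    have hy' : y ∈ Icc (0 : ℝ) 1 := Ioc_subset_Icc_self hy
    have e1 := hexp V (M.left i - t) (M.len i) (iteratedDeriv (k + 1) V (M.left i - t)) (B * M.len i) hV1 hh.le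
      (fun z hz => hV.abs_iteratedDeriv_sub_le M ht i ⟨hz.1, by linarith [hz.2, M.left_add_len i]⟩) y hy'
    rw [← hq] at e1
    have e2 := abs_eval_le (natDegree_waveDefect_le M hρ Ne bc V hZ hW t (hdeg i)) hy'
    have e3 := (abs_eval_le (natDegree_waveCorrection_le M ρ Ne bc V hZ hW t i) hy').trans
      (hwc M Ne bc V F hM hsz hNe hV t ht i).1
    have e4 : M.len i ^ (k + 1) * (B * M.len i) ≤ B * M.size ^ (k + 2) := by
      have := mul_le_mul_of_nonneg_left (pow_le_pow_left₀ hh.le hhH (k + 2)) hB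
      calc _ = B * M.len i ^ (k + 2) := by ring
        _ ≤ _ := this
    have e5 := mul_le_mul_of_nonneg_left e4 hK₂.le
    have e6 : (pull M i (p i)).eval y = (refInterp ρ fun y => V (M.left i - t + M.len i * y)).eval y -
        (waveCorrection M ρ Ne bc V Z W t i).eval y + (waveDefect M ρ Ne bc V Z W p t i).eval y := by
      rw [waveDefect, eval_add, eval_sub]
      ring
    rw [e6, Real.norm_eq_abs, abs_le]
    have g1 := abs_le.1 e1
    have g2 := abs_le.1 e2
    have g3 := abs_le.1 e3
    constructor <;> linarith [g1.1, g1.2, g2.1, g2.2, g3.1, g3.2]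
  have h2 := intervalIntegral.norm_integral_le_of_norm_le_const hbound
  rwa [sub_zero, abs_one, mul_one, Real.norm_eq_abs] at h2

theorem sqrt_le_mul_of_le {x y D C : ℝ} (hy : 0 ≤ y) (hC : 1 ≤ C) (hDC : D ≤ C) (h : x ≤ D * y ^ 2) : √x ≤ C * y := by
  refine Real.sqrt_le_iff.2 ⟨mul_nonneg (by linarith) hy, h.trans ?_⟩
  rw [mul_pow]
  exact mul_le_mul_of_nonneg_right (hDC.trans (by nlinarith)) (sq_nonneg y)

end Errors

end OFSV

end

/-! ### Assembly of the estimates. -/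

theorem theorem3p5 {a b T : ℝ} (hab : a < b) (hT : 0 < T)
    (s : OFSV.Scheme) {k : ℕ} (hk : 1 ≤ k) (hkL : s = OFSV.Scheme.LSV → 2 ≤ k)
    {ρ : Fin (k + 2) → ℝ} (hρ : OFSV.IsReferencePoints s k ρ)
    {Ne : ℕ} (hNe : 1 ≤ Ne) {ε : ℝ} (hε : ε = 1 ∨ ε = -1) (c : ℝ)
    (bc : OFSV.Boundary) {u₀ : ℝ → ℝ} {u : ℝ → ℝ → ℝ}
    (hu : OFSV.IsExactSolution a b T bc u₀ u)
    (hreg : ∀ t ∈ Set.Icc 0 T, OFSV.MemSobolev (k + 3) a b (fun x => u x t)) :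
    ∃ C h₀ : ℝ, 0 < C ∧ 0 < h₀ ∧
      ∀ M : OFSV.Mesh a b, M.ShapeRegular c → M.size ≤ h₀ →
      ∀ uh : ℝ → Fin M.N → Polynomial ℝ,
        OFSV.IsOFSVSolution M ρ Ne T bc uh →
        OFSV.IsCorrectedInitial M ρ s ε Ne T bc u₀ u (uh 0) →
        ∀ t ∈ Set.Icc 0 T,
          OFSV.nodalError M u uh t ≤ C * M.size ^ (k + 2) ∧
          OFSV.cellAverageError M u uh t ≤ C * M.size ^ (k + 2) := by
  open OFSV in
  obtain ⟨V, F, hVc, hF, huV, hosc⟩ := hu.exists_profile hab hT (m := k + 2) hreg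
  obtain ⟨B, hB0, hB⟩ := exists_abs_iteratedDeriv_le hVc (a - T) b
  have hV : WaveProfile a b T B k bc V F := ⟨hVc, hF, hosc, hB, fun t ht =>
    wavePeriodic_of_boundary hT hab.le hu.boundary (hVc.of_le (by exact_mod_cast Nat.le_succ _)) huV ht⟩
  have hua : ∀ t ∈ Icc 0 T, u a t = V (a - t) := huV a (left_mem_Icc.2 hab.le)
  -- The two building blocks of the correction: `Z` for the interpolation error, `W` for the damping
  -- of linear functions.
  obtain ⟨Z, hZ, hZ1, hZe⟩ := exists_correction hk hρ (refError ρ).continuous (integ_refError hρ hk hkL)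
  obtain ⟨W, hW, hW1, hWe⟩ := exists_correction hk hρ centered.continuous integ_centered
  obtain ⟨κ, hκ, hpair, hsum⟩ := exists_refPairing_eq hk hρ
  obtain ⟨L, hL, hgrow⟩ := exists_energy_growth hk hab hT hρ hZ hW hZ1 hW1 hZe hWe hκ hpair hsum c hV hu.boundary
    hua hNe
  obtain ⟨K, h₀, hK, hh₀, hinit⟩ := exists_initial_defect_bound hk hT hρ hZ hW c hB0 hV hu.boundary huV hu.init hNe
    (ε := ε) (by rcases hε with rfl | rfl <;> simp)
  obtain ⟨D, hD, havg⟩ := exists_abs_average_le hk hkL a b c T B hρ hZ hW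
  obtain ⟨K₀, hK₀, hnorm⟩ := exists_cnorm_sq_le k
  have hba : 0 < b - a := sub_pos.2 hab
  -- The factors come from passing from the mean over cells to the mean by length, from the
  -- equivalence of norms, from Gronwall's inequality, and from the initial energy together with the
  -- source term `H^(2(k+2))`.
  set Q := |c| / (b - a) * (K₀ * (Real.exp (L * T) * ((b - a) * ((1 + κ) * K ^ 2) + 1))) with hQ
  have hQ0 : 0 ≤ Q := by positivity
  refine ⟨1 + 2 * Q + 2 * D ^ 2, min 1 h₀, by positivity, lt_min one_pos hh₀, fun M hM hsz uh hsol hini t ht => ?_⟩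
  have hsz1 := hsz.trans (min_le_left _ _)
  have hN : (0 : ℝ) < M.N := by exact_mod_cast M.N_pos hab
  have hc : 0 < c := by
    have i : Fin M.N := ⟨0, M.N_pos hab⟩
    have h1 := hM i
    have h2 := M.len_le_size i
    have h3 := M.len_pos i
    by_contra h
    nlinarith
  have hH : 0 ≤ M.size ^ (k + 2) := pow_nonneg (M.size_pos hab).le _
  have h0T : (0 : ℝ) ∈ Icc 0 T := ⟨le_rfl, hT.le⟩
  have hdeg : ∀ r ∈ Icc 0 T, ∀ i, (waveDefect M ρ Ne bc V Z W (uh r) r i).natDegree ≤ k := fun r hr i =>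
    natDegree_waveDefect_le M hρ Ne bc V hZ hW r (hsol.natDegree_le r hr i)
  have hE0 : meshEnergy M κ k (waveDefect M ρ Ne bc V Z W (uh 0) 0) ≤
      (b - a) * ((1 + κ) * K ^ 2) * (M.size ^ (k + 2)) ^ 2 := by
    rw [meshEnergy, ← M.sum_len, mul_assoc, Finset.sum_mul]
    refine Finset.sum_le_sum fun i _ => mul_le_mul_of_nonneg_left ?_ (M.len_pos i).le
    have h1 := hinit M (uh 0) hM hsz1 (hsz.trans (min_le_right _ _)) (hsol.natDegree_le 0 h0T) hini i
    have h2 := pow_le_pow_left₀ (cnorm_nonneg k _) h1 2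
    rw [mul_pow] at h2
    rw [mul_assoc]
    exact (energyForm_self_le hκ (hdeg 0 h0T i)).trans (mul_le_mul_of_nonneg_left h2 (by linarith))
  have hEt := hgrow M uh hM hsz1 hsol t ht
  have hexp : Real.exp (L * t) ≤ Real.exp (L * T) := Real.exp_le_exp.2 (mul_le_mul_of_nonneg_left ht.2 hL)
  set ξ := waveDefect M ρ Ne bc V Z W (uh t) t with hξ
  have hmean : 1 / (M.N : ℝ) * ∑ i, cnorm k (ξ i) ^ 2 ≤ Q * (M.size ^ (k + 2)) ^ 2 := by
    refine (Mesh.mean_le hab hM fun i => sq_nonneg _).trans ?_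
    rw [hQ, abs_of_pos hc, mul_assoc]
    refine mul_le_mul_of_nonneg_left ?_ (by positivity)
    have h1 : ∑ i, M.len i * cnorm k (ξ i) ^ 2 ≤ K₀ * meshEnergy M κ k ξ := by
      rw [meshEnergy, Finset.mul_sum]
      refine Finset.sum_le_sum fun i _ => ?_
      have e1 : integ 0 1 (ξ i * ξ i) ≤ energyForm κ k (ξ i) (ξ i) :=
        le_add_of_nonneg_right (mul_nonneg hκ (mul_self_nonneg _))
      calc M.len i * cnorm k (ξ i) ^ 2 ≤ M.len i * (K₀ * energyForm κ k (ξ i) (ξ i)) :=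
            mul_le_mul_of_nonneg_left ((hnorm _ (hdeg t ht i)).trans (mul_le_mul_of_nonneg_left e1 hK₀.le))
              (M.len_pos i).le
        _ = _ := by ring
    have h2 : meshEnergy M κ k ξ ≤
        Real.exp (L * T) * ((b - a) * ((1 + κ) * K ^ 2) + 1) * (M.size ^ (k + 2)) ^ 2 := by
      have e1 : meshEnergy M κ k (waveDefect M ρ Ne bc V Z W (uh 0) 0) + (M.size ^ (k + 2)) ^ 2 ≤
          ((b - a) * ((1 + κ) * K ^ 2) + 1) * (M.size ^ (k + 2)) ^ 2 := by linarith
      have e2 : 0 ≤ ((b - a) * ((1 + κ) * K ^ 2) + 1) * (M.size ^ (k + 2)) ^ 2 := by positivity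
      have e3 := (mul_le_mul_of_nonneg_left e1 (Real.exp_pos (L * t)).le).trans (mul_le_mul_of_nonneg_right hexp e2)
      have e4 : 0 ≤ (M.size ^ (k + 2)) ^ 2 := sq_nonneg _
      linarith
    exact h1.trans ((mul_le_mul_of_nonneg_left h2 hK₀.le).trans_eq (by ring))
  constructor
  · refine sqrt_le_mul_of_le (D := Q) hH (by nlinarith [sq_nonneg D]) (by nlinarith [sq_nonneg D]) (le_trans ?_ hmean)
    refine mul_le_mul_of_nonneg_left (Finset.sum_le_sum fun i _ => ?_) (by positivity)
    have hmem : M.right i ∈ Icc a b := M.mem_Icc_of_mem_cell i (right_mem_Icc.2 (left_lt_right M i).le)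
    rw [huV _ hmem t ht, eval_pull_eq_of_defect M hρ Ne bc V hZ1 hW1, sub_add_cancel_left, neg_sq, ← sq_abs]
    exact pow_le_pow_left₀ (abs_nonneg _) (abs_eval_le (hdeg t ht i) (right_mem_Icc.2 zero_le_one)) 2
  · refine sqrt_le_mul_of_le (D := 2 * Q + 2 * D ^ 2) hH (by nlinarith [sq_nonneg D]) (by linarith) ?_
    have h1 : ∀ i, (1 / M.len i * ∫ x in (M.left i)..(M.right i), (u x t - (uh t i).eval x)) ^ 2 ≤
        2 * cnorm k (ξ i) ^ 2 + 2 * D ^ 2 * (M.size ^ (k + 2)) ^ 2 := fun i => by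
      have e1 := pow_le_pow_left₀ (abs_nonneg _)
        (havg M Ne bc V F u (uh t) hM hsz1 hNe hV huV (hsol.natDegree_le t ht) t ht i) 2
      rw [sq_abs] at e1
      refine e1.trans ?_
      nlinarith [sq_nonneg (cnorm k (ξ i) - D * M.size ^ (k + 2))]
    refine (mul_le_mul_of_nonneg_left (Finset.sum_le_sum fun i _ => h1 i) (by positivity)).trans ?_
    rw [Finset.sum_add_distrib, ← Finset.mul_sum, Finset.sum_const, Finset.card_univ, Fintype.card_fin, nsmul_eq_mul,
      mul_add, ← mul_assoc (1 / (M.N : ℝ)) (M.N : ℝ), one_div_mul_cancel hN.ne', one_mul]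
    linarith
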